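/- Let $n\ge 1$ and let $M^n$ be a smooth manifold of dimension $n$ (all maps are smooth). Let $\mathbb{C}P^{n+1}(4)$ carry the Fubini-Study metric $g$, for which the Hopf fibration $\pi:S^{2n+3}(1)\to\mathbb{C}P^{n+1}(4)$, $z\mapsto[z]$, is a Riemannian submersion, and the complex structure $J$. Let $Q^n=\{[z] : z_0^2+\dots+z_{n+1}^2=0\}\subset\mathbb{C}P^{n+1}(4)$ be the complex quadric with the induced structure. For a unit normal $\nu$ of $Q^n$ at a point $q$, let $A$ be the corresponding shape operator on $T_qQ^n$, i.e. $AX=-(\nabla_X\zeta)^\top$ for a unit normal field $\zeta$ of $Q^n$ near $q$ with $\zeta_q=\nu$, where $\nabla$ is the Levi-Civita connection of $\mathbb{C}P^{n+1}(4)$. An immersion $f:M^n\to Q^n$ is Lagrangian if $J$ maps tangent spaces of $f$ into normal spaces (within $TQ^n$) and vice versa. A choice of $A$ along $f$ is a choice, for each $p$, of the shape operator $A$ at $f(p)$ with respect to a unit normal $\nu_p$ of $Q^n$ at $f(p)$. Given such a choice, functions $\theta_1,\dots,\theta_n$ are called angle functions for a frame $e_1,\dots,e_n$ on an open subset of $M^n$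 if $$A(df)e_j=\cos(2\theta_j)\,(df)e_j-\sin(2\theta_j)\,J(df)e_j\qquad(j=1,\dots,n).\qquad(*)$$ (1) Let $a:M^n\to S^{n+1}(1)\subset\mathbb{R}^{n+2}$ be an immersed hypersurface with unit normal $b$ tangent to the sphere. Then its Gauss map $G=[a+ib]:M^n\to Q^n$ is a Lagrangian immersion, and $\hat G=(a+ib)/\sqrt2$ is a horizontal lift of $G$, with $\sum_k\hat G_k^2=0$. The vector $\nu=(d\pi)_{\hat G}(\overline{\hat G})$ is a unit normal of $Q^n$ along $G$, and the corresponding shape operator exists and is given by $AX=-(d\pi)_{\hat G}(\overline{\hat X})$, where $\hat X$ is the horizontal lift of $X$ to $\hat G$. With this choice of $A$, let $e_1,\dots,e_n$ be a frame on an open subset of $M^n$. If the $e_j$ are principal directions of $a$ with principal curvatures $\lambda_j$ with respect to the shape operator associated to $b$, then angle functions for $G$ and this frame exist (and $\theta_j$ can be chosen smooth if $\lambda_j$ is smooth), and any such angle functions satisfy $\sin\theta_j\ne0$ and $$\lambda_j=\cot\theta_j .$$ Conversely, if $\theta_1,\dots,\theta_n$ are angle functions for $G$ and the frame, then $\sin\theta_j\neq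 0$ and the $e_j$ are principal directions of $a$ with principal curvatures $\cot\theta_j$. (2) Let $f:M^n\to Q^n$ be a Lagrangian immersion. (a) Every point of $M^n$ has an open neighborhood $U$ on which there is an immersion $a:U\to S^{n+1}(1)$ with a unit normal $b$ such that $f|_U=[a+ib]$. (b) Neither $a$ nor its principal curvatures are unique: if $(a,b)$ is such a hypersurface on an open set $U$ and $p_0\in U$, then on some open neighborhood $U'\subset U$ of $p_0$ there is another such hypersurface $(a',b')$ with $f|_{U'}=[a'+ib']$, with $a'(p_0)\ne a(p_0)$, and whose set of principal curvatures at $p_0$ differs from that of $a$. (c) If $(a,b)$ and $(a',b')$ are two such hypersurfaces on the same connected open set $U$, then they are parallel: there is a constant $t\in\mathbb{R}$ with $a'=(\cos t)a+(\sin t)b$ and $b'=-(\sin t)a+(\cos t)b$ on $U$. (d) Let $(a,b)$ be any such hypersurface on an open set $U$, let $\varepsilon\in\{1,-1\}$, and let $e_1,\dots,e_n$ be a frame, on an open subset $W$ of $U$, of principal directions of $a$ with principal curvature functions $\lambda_1,\dots,\lambda_n$ with respect to the unit normal $\varepsilon b$. If $e_j,e_k$ are orthogonal at a point for the metric induced by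 $a$, they are also orthogonal there for the metric induced by $f$. For every choice of $A$ along $f|_W$ the frame is adapted to $f$, i.e. there are functions $\theta_1,\dots,\theta_n$ on $W$ with $(*)$; if the $\lambda_j$ and the unit normals $\nu_p$ of $Q^n$ defining $A$ depend smoothly on $p$, then near every point of $W$ the $\theta_j$ can be chosen smooth. Moreover, for any angle functions $\theta_1,\dots,\theta_n$ on $W$ with $(*)$ and at every point where $\lambda_j\neq\lambda_k$, one has $\sin(\theta_j-\theta_k)\neq0$ and $$\cot(\theta_j-\theta_k)=\pm\frac{\lambda_j\lambda_k+1}{\lambda_j-\lambda_k},$$ where the sign is $-\varepsilon$, i.e. it depends only on the choice of orientation of the unit normal. -/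

import Mathlib

open scoped Manifold ContDiff LinearAlgebra.Projectivization Topology

noncomputable section

/-- The complex coordinate space `ℂ^(m+1)` with its Hermitian inner product. -/
abbrev CVec (m : ℕ) : Type := EuclideanSpace ℂ (Fin (m + 1))

/-- The model space `ℂ^m` of the affine charts of `ℂP^m`, regarded as a real vector space. -/
abbrev CModel (m : ℕ) : Type := EuclideanSpace ℂ (Fin m)

/-- Complex projective space `ℂP^m`. -/
def CProj (m : ℕ) : Type := ℙ ℂ (CVec m)

namespace CProj

instance (m : ℕ) : TopologicalSpace (CProj m) :=
  inferInstanceAs (TopologicalSpace (Quotient (projectivizationSetoid ℂ (CVec m))))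

/-- The class `[w]` of a nonzero vector. -/
def mk {m : ℕ} (w : {w : CVec m // w ≠ 0}) : CProj m := Projectivization.mk ℂ w.1 w.2

theorem isQuotientMap_mk {m : ℕ} : Topology.IsQuotientMap (mk (m := m)) :=
  isQuotientMap_quotient_mk'

/-- Affine coordinates `w ↦ (w_j / w_i)_{j ≠ i}` on vectors. -/
def affCoord {m : ℕ} (i : Fin (m + 1)) (w : CVec m) : CModel m :=
  WithLp.toLp 2 fun j => w (i.succAbove j) / w i

/-- The vector with `i`-th coordinate `1` and remaining coordinates `v`. -/
def affVec {m : ℕ} (i : Fin (m + 1)) (v : CModel m) : CVec m :=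
  WithLp.toLp 2 (i.insertNth (1 : ℂ) v.ofLp)

theorem affVec_self {m : ℕ} (i : Fin (m + 1)) (v : CModel m) : affVec i v i = 1 := by
  simp [affVec]

theorem affVec_succAbove {m : ℕ} (i : Fin (m + 1)) (v : CModel m) (j : Fin m) :
    affVec i v (i.succAbove j) = v j := by
  simp [affVec]

theorem affVec_ne_zero {m : ℕ} (i : Fin (m + 1)) (v : CModel m) : affVec i v ≠ 0 := by
  intro h
  have := affVec_self i v
  simp [h] at this

theorem affCoord_smul {m : ℕ} (i : Fin (m + 1)) (w : CVec m) {t : ℂ} (ht : t ≠ 0) :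
    affCoord i (t • w) = affCoord i w := by
  ext j
  simp [affCoord, mul_div_mul_left _ _ ht]

theorem affCoord_affVec {m : ℕ} (i : Fin (m + 1)) (v : CModel m) :
    affCoord i (affVec i v) = v := by
  ext j
  simp [affCoord, affVec_self, affVec_succAbove]

theorem smul_affVec_affCoord {m : ℕ} (i : Fin (m + 1)) (w : CVec m) (hw : w i ≠ 0) :
    w i • affVec i (affCoord i w) = w := by
  ext k
  rcases Fin.eq_self_or_eq_succAbove i k with rfl | ⟨j, rfl⟩
  · simp [affVec_self]
  · simp [affVec_succAbove, affCoord, mul_div_cancel₀ _ hw]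

theorem contDiff_affVec {m : ℕ} (i : Fin (m + 1)) : ContDiff ℝ ∞ (affVec (m := m) i) := by
  suffices h : ContDiff ℂ ∞ (affVec (m := m) i) from h.restrict_scalars ℝ
  rw [contDiff_euclidean]
  intro k
  rcases Fin.eq_self_or_eq_succAbove i k with rfl | ⟨j, rfl⟩
  · simp only [affVec_self]; exact contDiff_const
  · simp only [affVec_succAbove]; fun_prop

theorem contDiffAt_affCoord {m : ℕ} (i : Fin (m + 1)) (w : CVec m) (hw : w i ≠ 0) :
    ContDiffAt ℝ ∞ (affCoord (m := m) i) w := by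
  suffices h : ContDiffAt ℂ ∞ (affCoord (m := m) i) w from h.restrict_scalars ℝ
  rw [contDiffAt_euclidean]
  intro k
  simp only [affCoord]
  exact (contDiffAt_euclidean.1 contDiffAt_id _).div (contDiffAt_euclidean.1 contDiffAt_id _) hw

/-- The affine coordinates as a function on `ℂP^m`. -/
def coord {m : ℕ} (i : Fin (m + 1)) : CProj m → CModel m :=
  Projectivization.lift (fun w => affCoord i w.1) (by
    intro a b t h
    have ht : t ≠ 0 := by
      rintro rfl
      exact a.2 (by simpa using h)
    simp only [h]
    exact affCoord_smul i _ ht)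

/-- The affine open set `{[w] | w_i ≠ 0}`. -/
def affOpen {m : ℕ} (i : Fin (m + 1)) : Set (CProj m) := {q | q.rep i ≠ 0}

theorem mk_mem_affOpen {m : ℕ} (i : Fin (m + 1)) (w : {w : CVec m // w ≠ 0}) :
    mk w ∈ affOpen i ↔ w.1 i ≠ 0 := by
  obtain ⟨a, ha⟩ := Projectivization.exists_smul_eq_mk_rep ℂ w.1 w.2
  have : (mk w).rep = a • w.1 := ha.symm
  simp only [affOpen, Set.mem_ofPred_eq, this]
  rw [Units.smul_def]
  simp

theorem isOpen_affOpen {m : ℕ} (i : Fin (m + 1)) : IsOpen (affOpen (m := m) i) := by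
  rw [← isQuotientMap_mk.isOpen_preimage]
  have : mk ⁻¹' affOpen (m := m) i = {w | w.1 i ≠ 0} := by
    ext w; exact mk_mem_affOpen i w
  rw [this]
  exact isOpen_ne_fun (by fun_prop) continuous_const

theorem coord_mk {m : ℕ} (i : Fin (m + 1)) (w : {w : CVec m // w ≠ 0}) :
    coord i (mk w) = affCoord i w.1 := rfl

theorem mk_surjective {m : ℕ} : Function.Surjective (mk (m := m)) :=
  isQuotientMap_mk.surjective

theorem mk_smul {m : ℕ} (w w' : {w : CVec m // w ≠ 0}) {t : ℂ} (h : t • w.1 = w'.1) :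
    mk w' = mk w :=
  (Projectivization.mk_eq_mk_iff' ℂ _ _ _ _).2 ⟨t, h⟩

/-- The affine chart `[w] ↦ (w_j / w_i)_{j ≠ i}` of `ℂP^m`. -/
def affChart {m : ℕ} (i : Fin (m + 1)) : OpenPartialHomeomorph (CProj m) (CModel m) where
  toFun := coord i
  invFun v := mk ⟨affVec i v, affVec_ne_zero i v⟩
  source := affOpen i
  target := Set.univ
  map_source' _ _ := trivial
  map_target' v _ := by rw [mk_mem_affOpen]; simp [affVec_self]
  left_inv' q hq := by
    obtain ⟨w, rfl⟩ := mk_surjective q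
    rw [mk_mem_affOpen] at hq
    exact (mk_smul _ _ (smul_affVec_affCoord i w.1 hq)).symm
  right_inv' v _ := affCoord_affVec i v
  open_source := isOpen_affOpen i
  open_target := isOpen_univ
  continuousOn_toFun := by
    rw [isQuotientMap_mk.continuousOn_isOpen_iff (isOpen_affOpen i)]
    intro w hw
    have hw' : w.1 i ≠ 0 := (mk_mem_affOpen i w).1 hw
    exact ((contDiffAt_affCoord i w.1 hw').continuousAt.comp
      continuous_subtype_val.continuousAt).continuousWithinAt
  continuousOn_invFun := by
    apply Continuous.continuousOn
    exact isQuotientMap_mk.continuous.comp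
      ((contDiff_affVec i).continuous.subtype_mk _)

theorem exists_mem_affOpen {m : ℕ} (q : CProj m) : ∃ i, q ∈ affOpen i := by
  by_contra! h
  apply Projectivization.rep_nonzero q
  ext i
  simpa [affOpen] using h i

instance (m : ℕ) : ChartedSpace (CModel m) (CProj m) where
  atlas := Set.range affChart
  chartAt q := affChart (exists_mem_affOpen q).choose
  mem_chart_source q := (exists_mem_affOpen q).choose_spec
  chart_mem_atlas _ := ⟨_, rfl⟩

instance (m : ℕ) : IsManifold 𝓘(ℝ, CModel m) ∞ (CProj m) := by
  apply isManifold_of_contDiffOn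
  rintro _ _ ⟨i, rfl⟩ ⟨j, rfl⟩
  simp only [modelWithCornersSelf_coe, modelWithCornersSelf_coe_symm, Function.comp_id,
    Function.id_comp, Set.range_id, Set.inter_univ, Set.preimage_id]
  intro v hv
  have hv' : affVec i v j ≠ 0 := by
    have h2 := hv.2
    simpa using (mk_mem_affOpen j ⟨affVec i v, affVec_ne_zero i v⟩).1 h2
  exact ((contDiffAt_affCoord j _ hv').comp v (contDiff_affVec i).contDiffAt).contDiffWithinAt


/-- The differential of the affine coordinates at `z`. -/
def dAffCoord {m : ℕ} (i : Fin (m + 1)) (z : CVec m) : CVec m →L[ℂ] CModel m :=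
  LinearMap.toContinuousLinearMap
    { toFun := fun w => WithLp.toLp 2 fun j =>
        (w (i.succAbove j) * z i - z (i.succAbove j) * w i) / z i ^ 2
      map_add' := fun v w => by
        ext j
        simp only [PiLp.add_apply]
        ring
      map_smul' := fun c w => by
        ext j
        simp only [PiLp.smul_apply, smul_eq_mul, RingHom.id_apply]
        ring }

theorem dAffCoord_apply {m : ℕ} (i : Fin (m + 1)) (z w : CVec m) (j : Fin m) :
    dAffCoord i z w j = (w (i.succAbove j) * z i - z (i.succAbove j) * w i) / z i ^ 2 := rfl

theorem hasFDerivAt_affCoord {m : ℕ} (i : Fin (m + 1)) (z : CVec m) (hz : z i ≠ 0) :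
    HasFDerivAt (𝕜 := ℂ) (affCoord i) (dAffCoord i z) z := by
  rw [← hasFDerivWithinAt_univ, hasFDerivWithinAt_euclidean]
  intro j
  rw [hasFDerivWithinAt_univ]
  have h1 (k : Fin (m + 1)) : HasFDerivAt (fun w : CVec m => w k)
      (EuclideanSpace.proj k : CVec m →L[ℂ] ℂ) z :=
    (EuclideanSpace.proj k : CVec m →L[ℂ] ℂ).hasFDerivAt
  have h := (h1 (i.succAbove j)).mul ((hasDerivAt_inv hz).comp_hasFDerivAt z (h1 i))
  refine (h.congr_fderiv ?_).congr_of_eventuallyEq (Filter.Eventually.of_forall fun x => ?_)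
  · ext w
    change _ = (w (i.succAbove j) * z i - z (i.succAbove j) * w i) / z i ^ 2
    simp
    field_simp
    ring
  · simp [affCoord, div_eq_mul_inv]

theorem dAffCoord_eq_zero_iff {m : ℕ} (i : Fin (m + 1)) (z w : CVec m) (hz : z i ≠ 0) :
    dAffCoord i z w = 0 ↔ ∃ c : ℂ, w = c • z := by
  constructor
  · intro h
    refine ⟨w i / z i, ?_⟩
    ext k
    rcases Fin.eq_self_or_eq_succAbove i k with rfl | ⟨j, rfl⟩
    · simp [hz]
    · have hj : dAffCoord i z w j = 0 := by rw [h]; rfl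
      rw [dAffCoord_apply, div_eq_zero_iff] at hj
      have := hj.resolve_right (pow_ne_zero 2 hz)
      simp only [PiLp.smul_apply, smul_eq_mul]
      field_simp
      linear_combination this
  · rintro ⟨c, rfl⟩
    ext j
    rw [dAffCoord_apply]
    simp only [PiLp.smul_apply, smul_eq_mul, PiLp.zero_apply]
    ring

theorem dAffCoord_surjective {m : ℕ} (i : Fin (m + 1)) (z : CVec m) (hz : z i ≠ 0) :
    Function.Surjective (dAffCoord i z) := by
  intro v
  refine ⟨WithLp.toLp 2 (i.insertNth (0 : ℂ) fun j => z i * v j), ?_⟩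
  ext j
  rw [dAffCoord_apply]
  simp
  field_simp

/-- The projection `w ↦ [w]`, with an irrelevant value at `w = 0`. Its restriction to the unit
sphere is the Hopf fibration. -/
def hopf {m : ℕ} (w : CVec m) : CProj m :=
  open Classical in
  if h : w ≠ 0 then mk ⟨w, h⟩ else mk ⟨affVec 0 0, affVec_ne_zero 0 0⟩

theorem hopf_of_ne {m : ℕ} {w : CVec m} (h : w ≠ 0) : hopf w = mk ⟨w, h⟩ := by
  simp [hopf, h]

theorem continuousAt_hopf {m : ℕ} {z : CVec m} (hz : z ≠ 0) : ContinuousAt hopf z := by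
  have ho : IsOpen {w : CVec m | w ≠ 0} := isOpen_ne
  have h : ContinuousOn (hopf (m := m)) {w | w ≠ 0} := by
    rw [continuousOn_iff_continuous_domRestrict]
    refine (isQuotientMap_mk (m := m)).continuous.congr fun w => ?_
    exact (hopf_of_ne w.2).symm
  exact h.continuousAt (ho.mem_nhds hz)

theorem chartAt_eq {m : ℕ} (q : CProj m) :
    chartAt (CModel m) q = affChart (exists_mem_affOpen q).choose := rfl

theorem contMDiffAt_hopf {m : ℕ} {z : CVec m} (hz : z ≠ 0) :
    ContMDiffAt 𝓘(ℝ, CVec m) 𝓘(ℝ, CModel m) ∞ hopf z := by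
  rw [contMDiffAt_iff]
  refine ⟨continuousAt_hopf hz, ?_⟩
  set i := (exists_mem_affOpen (hopf z)).choose with hi
  have hzi : z i ≠ 0 := by
    have h := (exists_mem_affOpen (hopf z)).choose_spec
    rw [← hi, hopf_of_ne hz, mk_mem_affOpen] at h
    exact h
  simp only [mfld_simps]
  refine ((contDiffAt_affCoord i z hzi).congr_of_eventuallyEq ?_).contDiffWithinAt
  filter_upwards [isOpen_ne.mem_nhds hz] with w hw
  change coord i (hopf w) = affCoord i w
  rw [hopf_of_ne hw]
  rfl

theorem hasMFDerivAt_hopf {m : ℕ} {z : CVec m} (hz : z ≠ 0) :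
    HasMFDerivAt 𝓘(ℝ, CVec m) 𝓘(ℝ, CModel m) hopf z
      ((dAffCoord (exists_mem_affOpen (hopf z)).choose z).restrictScalars ℝ) := by
  refine ⟨continuousAt_hopf hz, ?_⟩
  set i := (exists_mem_affOpen (hopf z)).choose with hi
  have hzi : z i ≠ 0 := by
    have h := (exists_mem_affOpen (hopf z)).choose_spec
    rw [← hi, hopf_of_ne hz, mk_mem_affOpen] at h
    exact h
  simp only [mfld_simps]
  refine (((hasFDerivAt_affCoord i z hzi).restrictScalars ℝ).congr_of_eventuallyEq
    ?_).hasFDerivWithinAt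
  filter_upwards [isOpen_ne.mem_nhds hz] with w hw
  change coord i (hopf w) = affCoord i w
  rw [hopf_of_ne hw]
  rfl

/-- The (real) tangent space of `ℂP^m` at `q`. -/
abbrev Tan {m : ℕ} (q : CProj m) : Type := TangentSpace 𝓘(ℝ, CModel m) q

/-- The differential of the projection `w ↦ [w]`. -/
def dHopf {m : ℕ} (z : CVec m) : CVec m →L[ℝ] Tan (hopf z) :=
  mfderiv 𝓘(ℝ, CVec m) 𝓘(ℝ, CModel m) hopf z

/-- The horizontal space at `z`: the Hermitian orthogonal complement of `ℂ z`. -/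
def horizontal {m : ℕ} (z : CVec m) : Submodule ℝ (CVec m) :=
  (ℂ ∙ z)ᗮ.restrictScalars ℝ

theorem mem_horizontal {m : ℕ} (z w : CVec m) : w ∈ horizontal z ↔ inner ℂ z w = 0 := by
  simp [horizontal, Submodule.mem_orthogonal_singleton_iff_inner_right]

theorem dHopf_eq {m : ℕ} {z : CVec m} (hz : z ≠ 0) :
    ∃ i, z i ≠ 0 ∧ dHopf z = (dAffCoord i z).restrictScalars ℝ := by
  refine ⟨(exists_mem_affOpen (hopf z)).choose, ?_, (hasMFDerivAt_hopf hz).mfderiv⟩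
  have h := (exists_mem_affOpen (hopf z)).choose_spec
  rwa [hopf_of_ne hz, mk_mem_affOpen, ← hopf_of_ne hz] at h

theorem dHopf_eq_zero_iff {m : ℕ} {z : CVec m} (hz : z ≠ 0) (w : CVec m) :
    dHopf z w = 0 ↔ ∃ c : ℂ, w = c • z := by
  obtain ⟨i, hi, h⟩ := dHopf_eq hz
  rw [h]
  exact dAffCoord_eq_zero_iff i z w hi

theorem dHopf_horizontal_bijective {m : ℕ} {z : CVec m} (hz : z ≠ 0) :
    Function.Bijective ((dHopf z).toLinearMap ∘ₗ (horizontal z).subtype) := by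
  constructor
  · rw [← LinearMap.ker_eq_bot, LinearMap.ker_eq_bot']
    rintro ⟨w, hw⟩ h
    obtain ⟨c, hc⟩ := (dHopf_eq_zero_iff hz w).1 h
    rw [mem_horizontal, hc, inner_smul_right] at hw
    rcases mul_eq_zero.1 hw with h0 | h0
    · ext1
      simp [hc, h0]
    · exact absurd (inner_self_eq_zero.1 h0) hz
  · intro X
    obtain ⟨w, hw⟩ : ∃ w, dHopf z w = X := by
      obtain ⟨i, hi, h⟩ := dHopf_eq hz
      rw [h]
      exact dAffCoord_surjective i z hi X
    have hn : (inner ℂ z z : ℂ) ≠ 0 := fun h => hz (inner_self_eq_zero.1 h)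
    refine ⟨⟨w - (inner ℂ z w / inner ℂ z z) • z, ?_⟩, ?_⟩
    · rw [mem_horizontal, inner_sub_right, inner_smul_right, div_mul_cancel₀ _ hn, sub_self]
    · change dHopf z (w - (inner ℂ z w / inner ℂ z z) • z) = X
      rw [map_sub, hw, (dHopf_eq_zero_iff hz _).2 ⟨_, rfl⟩, sub_zero]

/-- The horizontal lift to `z ≠ 0` of vectors tangent to `ℂP^m` at `[z]`. -/
def hLift {m : ℕ} (z : CVec m) : Tan (hopf z) →ₗ[ℝ] CVec m :=
  open Classical in
  if hz : z ≠ 0 then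
    (horizontal z).subtype ∘ₗ
      (LinearEquiv.ofBijective _ (dHopf_horizontal_bijective hz)).symm.toLinearMap
  else 0

theorem dHopf_hLift {m : ℕ} {z : CVec m} (hz : z ≠ 0) (X : Tan (hopf z)) :
    dHopf z (hLift z X) = X := by
  rw [hLift, dif_pos hz]
  exact (LinearEquiv.ofBijective _ (dHopf_horizontal_bijective hz)).apply_symm_apply X

theorem inner_hLift {m : ℕ} {z : CVec m} (hz : z ≠ 0) (X : Tan (hopf z)) :
    inner ℂ z (hLift z X) = 0 := by
  rw [hLift, dif_pos hz, ← mem_horizontal]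
  exact ((LinearEquiv.ofBijective _ (dHopf_horizontal_bijective hz)).symm X).2

/-- A point of the unit sphere over `q`. The notions below do not depend on its choice. -/
def unitRep {m : ℕ} (q : CProj m) : CVec m := ((‖q.rep‖ : ℂ)⁻¹) • q.rep

theorem norm_unitRep {m : ℕ} (q : CProj m) : ‖unitRep q‖ = 1 := by
  have h : ‖q.rep‖ ≠ 0 := norm_ne_zero_iff.2 (Projectivization.rep_nonzero q)
  simp [unitRep, norm_smul, h]

theorem hopf_unitRep {m : ℕ} (q : CProj m) : hopf (unitRep q) = q := by
  have h0 : unitRep q ≠ 0 := by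
    intro h
    have := norm_unitRep q
    simp [h] at this
  rw [hopf_of_ne h0, mk_smul ⟨q.rep, Projectivization.rep_nonzero q⟩ ⟨unitRep q, h0⟩ rfl]
  exact Projectivization.mk_rep q

/-- The Fubini-Study metric of constant holomorphic sectional curvature `4`: the metric for which
the Hopf fibration of the unit sphere is a Riemannian submersion. -/
def fsMetric {m : ℕ} (q : CProj m) (X Y : Tan q) : ℝ :=
  inner ℝ (hLift (unitRep q) X) (hLift (unitRep q) Y)

/-- The complex structure of `ℂP^m`, induced by multiplication by `i` on horizontal vectors. -/
def cpxJ {m : ℕ} (q : CProj m) (X : Tan q) : Tan q :=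
  dHopf (unitRep q) (Complex.I • hLift (unitRep q) X)


/-- Index of the preferred affine chart at `q`. -/
def idx {m : ℕ} (q : CProj m) : Fin (m + 1) := (exists_mem_affOpen q).choose

theorem idx_hopf {m : ℕ} {w : CVec m} (hw : w ≠ 0) : w (idx (hopf w)) ≠ 0 := by
  have h := (exists_mem_affOpen (hopf w)).choose_spec
  rwa [hopf_of_ne hw, mk_mem_affOpen, ← hopf_of_ne hw] at h

theorem dHopf_eq_idx {m : ℕ} {z : CVec m} (hz : z ≠ 0) :
    dHopf z = (dAffCoord (idx (hopf z)) z).restrictScalars ℝ := (hasMFDerivAt_hopf hz).mfderiv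

/-- Coordinate expression of a vector field in the preferred chart at `q`. -/
def coordField {m : ℕ} (q : CProj m) (σ : (x : CProj m) → Tan x) : CModel m → CModel m :=
  VectorField.mpullbackWithin 𝓘(ℝ, CModel m) 𝓘(ℝ, CModel m)
    (extChartAt 𝓘(ℝ, CModel m) q).symm σ (Set.range 𝓘(ℝ, CModel m))

theorem symm_affCoord {m : ℕ} (q : CProj m) {w : CVec m} (hw : w (idx q) ≠ 0) :
    (extChartAt 𝓘(ℝ, CModel m) q).symm (affCoord (idx q) w) = hopf w := by
  have h0 : w ≠ 0 := by rintro rfl; simp at hw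
  rw [hopf_of_ne h0]
  exact (mk_smul _ _ (smul_affVec_affCoord (idx q) w hw)).symm

theorem dAffCoord_hLift {m : ℕ} (q : CProj m) (σ : (x : CProj m) → Tan x) {w : CVec m}
    (hw : w (idx q) ≠ 0) :
    dAffCoord (idx q) w (hLift w (σ (hopf w))) = coordField q σ (affCoord (idx q) w) := by
  have h0 : w ≠ 0 := by rintro rfl; simp at hw
  set v := affCoord (idx q) w with hv
  have hvt : v ∈ (extChartAt 𝓘(ℝ, CModel m) q).target := by
    rw [extChartAt_target]
    simp [chartAt_eq, affChart]
  let D : CModel m →L[ℝ] CModel m := mfderivWithin 𝓘(ℝ, CModel m) 𝓘(ℝ, CModel m)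
    (extChartAt 𝓘(ℝ, CModel m) q).symm (Set.range 𝓘(ℝ, CModel m)) v
  have hD : HasMFDerivAt 𝓘(ℝ, CModel m) 𝓘(ℝ, CModel m)
      (extChartAt 𝓘(ℝ, CModel m) q).symm v D := by
    have := (mdifferentiableWithinAt_extChartAt_symm hvt).hasMFDerivWithinAt
    rw [modelWithCornersSelf_coe, Set.range_id, hasMFDerivWithinAt_univ] at this
    simpa only [D, modelWithCornersSelf_coe, Set.range_id] using this
  have hinv : D.IsInvertible := isInvertible_mfderivWithin_extChartAt_symm hvt
  have hA : HasMFDerivAt 𝓘(ℝ, CVec m) 𝓘(ℝ, CModel m) (affCoord (idx q)) w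
      ((dAffCoord (idx q) w).restrictScalars ℝ) :=
    ((hasFDerivAt_affCoord (idx q) w hw).restrictScalars ℝ).hasMFDerivAt
  have hcomp := hD.comp w hA
  have hopen : {x : CVec m | x (idx q) ≠ 0} ∈ 𝓝 w := by
    apply IsOpen.mem_nhds _ hw
    exact isOpen_ne_fun (by fun_prop) continuous_const
  have hcomp' := hcomp.congr_of_eventuallyEq (f₁ := hopf) (by
    filter_upwards [hopen] with x hx
    exact (symm_affCoord q hx).symm)
  have key : (dHopf w (hLift w (σ (hopf w))) : CModel m) =
      D (dAffCoord (idx q) w (hLift w (σ (hopf w)))) :=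
    congrArg (fun L : CVec m →L[ℝ] CModel m => L (hLift w (σ (hopf w)))) hcomp'.mfderiv
  rw [dHopf_hLift h0] at key
  have hσ : ∀ x, x = hopf w → (σ x : CModel m) = σ (hopf w) := by rintro _ rfl; rfl
  change _ = D.inverse (σ ((extChartAt 𝓘(ℝ, CModel m) q).symm v) : CModel m)
  rw [hσ _ (symm_affCoord q hw)]
  obtain ⟨D', hD'⟩ := hinv
  refine Eq.trans ?_ (congrArg D.inverse key).symm
  rw [← hD', ContinuousLinearMap.inverse_equiv]
  simp

/-- Explicit form of the horizontal lift in affine coordinates. -/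
def liftCoord {m : ℕ} (i : Fin (m + 1)) (w : CVec m) (v : CModel m) : CVec m :=
  w i • (affVec i v - affVec i 0) -
    (inner ℂ w (w i • (affVec i v - affVec i 0)) / inner ℂ w w) • w

theorem hLift_unique {m : ℕ} {w : CVec m} (hw : w ≠ 0) (u : CVec m) (h : inner ℂ w u = 0) :
    hLift w (dHopf w u) = u := by
  have := dHopf_horizontal_bijective hw
  have h2 : (⟨hLift w (dHopf w u), (mem_horizontal _ _).2 (inner_hLift hw _)⟩ : horizontal w) =
      ⟨u, (mem_horizontal _ _).2 h⟩ := this.1 (dHopf_hLift hw _)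
  exact congrArg Subtype.val h2

theorem eq_liftCoord {m : ℕ} (i : Fin (m + 1)) {w u : CVec m} (hw : w i ≠ 0)
    (h : inner ℂ w u = 0) : u = liftCoord i w (dAffCoord i w u) := by
  have h0 : w ≠ 0 := by rintro rfl; simp at hw
  have hn : (inner ℂ w w : ℂ) ≠ 0 := fun h => h0 (inner_self_eq_zero.1 h)
  have e : w i • (affVec i (dAffCoord i w u) - affVec i 0) = u - (u i / w i) • w := by
    ext k
    rcases Fin.eq_self_or_eq_succAbove i k with rfl | ⟨j, rfl⟩
    · simp [affVec_self, hw]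
    · simp [affVec_succAbove, dAffCoord_apply]
      field_simp
  rw [liftCoord, e, inner_sub_right, h, inner_smul_right, zero_sub, neg_div,
    mul_div_cancel_right₀ _ hn]
  module

theorem contDiffAt_liftCoord {m : ℕ} (i : Fin (m + 1)) {w : CVec m} (hw : w ≠ 0) (v : CModel m) :
    ContDiffAt ℝ ∞ (fun x : CVec m × CModel m => liftCoord i x.1 x.2) (w, v) := by
  have hn : (inner ℂ w w : ℂ) ≠ 0 := fun h => hw (inner_self_eq_zero.1 h)
  have h1 : ContDiff ℝ ∞ (fun x : CVec m × CModel m =>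
      x.1 i • (affVec i x.2 - affVec i 0)) := by
    have ha := (contDiff_affVec i).comp (contDiff_snd (𝕜 := ℝ) (E := CVec m) (F := CModel m))
    have hb : ContDiff ℝ ∞ (fun x : CVec m × CModel m => x.1 i) := by
      have := ((EuclideanSpace.proj i : CVec m →L[ℂ] ℂ).restrictScalars ℝ).contDiff (n := ∞)
      exact this.comp contDiff_fst
    exact hb.smul (ha.sub contDiff_const)
  unfold liftCoord
  have h2 : ContDiffAt ℝ ∞ (fun x : CVec m × CModel m =>
      inner ℂ x.1 (x.1 i • (affVec i x.2 - affVec i 0)) / inner ℂ x.1 x.1) (w, v) := by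
    simp only [div_eq_mul_inv]
    refine ContDiffAt.mul (contDiff_fst.contDiffAt.inner ℂ h1.contDiffAt) (ContDiffAt.inv ?_ hn)
    exact contDiff_fst.contDiffAt.inner ℂ contDiff_fst.contDiffAt
  exact h1.contDiffAt.sub (h2.smul contDiff_fst.contDiffAt)

theorem eventually_ne {m : ℕ} (i : Fin (m + 1)) {z : CVec m} (hz : z i ≠ 0) :
    ∀ᶠ w in 𝓝 z, w i ≠ 0 :=
  (isOpen_ne_fun (by fun_prop) continuous_const).mem_nhds hz

theorem differentiableAt_coordField {m : ℕ} {q : CProj m} {σ : (x : CProj m) → TangentSpace 𝓘(ℝ, CModel m) x}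
    (hσ : MDifferentiableAt 𝓘(ℝ, CModel m) 𝓘(ℝ, CModel m).tangent
      (fun x => (⟨x, σ x⟩ : TangentBundle 𝓘(ℝ, CModel m) (CProj m))) q) :
    DifferentiableAt ℝ (coordField q σ) (extChartAt 𝓘(ℝ, CModel m) q q) := by
  rw [← mdifferentiableWithinAt_univ] at hσ
  have := hσ.differentiableWithinAt_mpullbackWithin_vectorField
  rw [← differentiableWithinAt_univ]
  simpa [coordField] using this

theorem differentiableAt_hLift {m : ℕ} {z : CVec m} (hz : z ≠ 0) {σ : (x : CProj m) → TangentSpace 𝓘(ℝ, CModel m) x}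
    (hσ : MDifferentiableAt 𝓘(ℝ, CModel m) 𝓘(ℝ, CModel m).tangent
      (fun x => (⟨x, σ x⟩ : TangentBundle 𝓘(ℝ, CModel m) (CProj m))) (hopf z)) :
    DifferentiableAt ℝ (fun w => hLift w (σ (hopf w))) z := by
  set i := idx (hopf z) with hi
  have hzi : z i ≠ 0 := idx_hopf hz
  have e : (fun w => hLift w (σ (hopf w))) =ᶠ[𝓝 z]
      fun w => liftCoord i w (coordField (hopf z) σ (affCoord i w)) := by
    filter_upwards [eventually_ne i hzi] with w hw
    have h0 : w ≠ 0 := by rintro rfl; simp at hw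
    rw [← dAffCoord_hLift (hopf z) σ hw]
    exact eq_liftCoord i hw (inner_hLift h0 _)
  refine DifferentiableAt.congr_of_eventuallyEq ?_ e
  have h2 : DifferentiableAt ℝ (fun w => coordField (hopf z) σ (affCoord i w)) z := by
    refine DifferentiableAt.comp z (g := coordField (hopf z) σ) (f := affCoord i) ?_
      ((contDiffAt_affCoord i z hzi).differentiableAt (by simp))
    have hx : extChartAt 𝓘(ℝ, CModel m) (hopf z) (hopf z) = affCoord i z := by
      change coord i (hopf z) = _
      rw [hopf_of_ne hz]
      rfl
    rw [← hx]
    exact differentiableAt_coordField hσ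
  have h3 := (contDiffAt_liftCoord i hz (coordField (hopf z) σ (affCoord i z))).differentiableAt
    (by simp)
  exact DifferentiableAt.comp (f := fun w => (w, coordField (hopf z) σ (affCoord i w))) z h3
    (differentiableAt_id.prodMk h2)

/-- The horizontal lift as a continuous linear map. -/
def hLiftL {m : ℕ} (z : CVec m) : Tan (hopf z) →L[ℝ] CVec m :=
  (LinearMap.toContinuousLinearMap (hLift z : CModel m →ₗ[ℝ] CVec m) : CModel m →L[ℝ] CVec m)

theorem unitRep_ne_zero {m : ℕ} (q : CProj m) : unitRep q ≠ 0 := by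
  intro h
  have := norm_unitRep q
  simp [h] at this

theorem differentiableAt_hLift' {m : ℕ} {q : CProj m}
    {σ : (x : CProj m) → TangentSpace 𝓘(ℝ, CModel m) x} (hσ : MDifferentiableAt 𝓘(ℝ, CModel m) 𝓘(ℝ, CModel m).tangent
      (fun x => (⟨x, σ x⟩ : TangentBundle 𝓘(ℝ, CModel m) (CProj m))) q) :
    DifferentiableAt ℝ (fun w => hLift w (σ (hopf w))) (unitRep q) := by
  apply differentiableAt_hLift (unitRep_ne_zero q)
  rw [hopf_unitRep]
  exact hσ

/-- The Levi-Civita connection of the Fubini-Study metric, `(∇_X ζ)_q = fsConnection m ζ q X`. For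
the Riemannian submersion `π` from the unit sphere it is `dπ (D_X̂ ζ̂)`, where hats denote horizontal
lifts and `D` is the flat connection; the component of `D_X̂ ζ̂` normal to the sphere is killed by
`dπ`. It is torsion-free and metric, see `torsion_fsConnection` and `fsConnection_metric`. -/
def fsConnection (m : ℕ) : CovariantDerivative 𝓘(ℝ, CModel m) (CModel m)
    (fun q : CProj m => TangentSpace 𝓘(ℝ, CModel m) q) where
  toFun ζ q := (dHopf (unitRep q)).comp
    ((fderiv ℝ (fun w => hLift w (ζ (hopf w))) (unitRep q)).comp (hLiftL (unitRep q)))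
  isCovariantDerivativeOnUniv := by
    constructor
    · intro σ σ' q hσ hσ' _
      have h1 := differentiableAt_hLift' hσ
      have h2 := differentiableAt_hLift' hσ'
      have e : (fun w => hLift w ((σ + σ') (hopf w))) =
          (fun w => hLift w (σ (hopf w))) + fun w => hLift w (σ' (hopf w)) := by
        ext1 w
        exact map_add (hLift w) _ _
      rw [e, fderiv_add h1 h2]
      ext1 X
      exact map_add (dHopf (unitRep q)) _ _
    · intro σ g q hσ hg _
      have h1 := differentiableAt_hLift' hσ
      have hm : HasMFDerivAt 𝓘(ℝ, CModel m) 𝓘(ℝ, ℝ) g (hopf (unitRep q))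
          (mfderiv 𝓘(ℝ, CModel m) 𝓘(ℝ, ℝ) g (hopf (unitRep q))) := by
        apply MDifferentiableAt.hasMFDerivAt
        rw [hopf_unitRep]
        exact hg
      have hh : HasMFDerivAt 𝓘(ℝ, CVec m) 𝓘(ℝ, CModel m) hopf (unitRep q) (dHopf (unitRep q)) :=
        ((contMDiffAt_hopf (unitRep_ne_zero q)).mdifferentiableAt (by simp)).hasMFDerivAt
      let g' : CModel m →L[ℝ] ℝ := mfderiv 𝓘(ℝ, CModel m) 𝓘(ℝ, ℝ) g (hopf (unitRep q))
      let p' : CVec m →L[ℝ] CModel m := dHopf (unitRep q)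
      have h2 : HasFDerivAt (fun w => g (hopf w)) (g'.comp p') (unitRep q) :=
        (hm.comp (unitRep q) hh).hasFDerivAt
      have e : (fun w => hLift w ((g • σ) (hopf w))) =
          (fun w => g (hopf w) • hLift w (σ (hopf w))) := by
        ext1 w
        exact map_smul (hLift w) _ _
      have hd := (h2.fun_smul h1.hasFDerivAt).fderiv
      rw [← e] at hd
      ext1 X
      refine (congrArg (fun L : CVec m →L[ℝ] CVec m => p' (L (hLift (unitRep q) X))) hd).trans ?_
      have e1 : p' (hLift (unitRep q) X) = X := dHopf_hLift (unitRep_ne_zero q) X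
      have e2 : (p' (hLift (unitRep q) (σ (hopf (unitRep q)))) : CModel m) = σ q := by
        have h : ∀ x, x = q → (σ x : CModel m) = σ q := by rintro _ rfl; rfl
        exact (dHopf_hLift (unitRep_ne_zero q) _).trans (h _ (hopf_unitRep q))
      let g'' : CModel m →L[ℝ] ℝ := mfderiv 𝓘(ℝ, CModel m) 𝓘(ℝ, ℝ) g q
      have e3 : g' = g'' := by
        have h : ∀ x, x = q → (mfderiv 𝓘(ℝ, CModel m) 𝓘(ℝ, ℝ) g x : CModel m →L[ℝ] ℝ) =
          mfderiv 𝓘(ℝ, CModel m) 𝓘(ℝ, ℝ) g q := by rintro _ rfl; rfl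
        exact h _ (hopf_unitRep q)
      change p' (g (hopf (unitRep q)) • fderiv ℝ _ (unitRep q) (hLift (unitRep q) X) +
        g' (p' (hLift (unitRep q) X)) • hLift (unitRep q) (σ (hopf (unitRep q)))) =
          g q • p' (fderiv ℝ _ (unitRep q) (hLift (unitRep q) X)) +
          (HSMul.hSMul (γ := CModel m) (g'' X) (show CModel m from σ q))
      rw [map_add, map_smul, map_smul, e1, e2, e3, hopf_unitRep]

theorem fsConnection_apply {m : ℕ} (σ : (x : CProj m) → TangentSpace 𝓘(ℝ, CModel m) x)
    (q : CProj m) (X : Tan q) : fsConnection m σ q X = dHopf (unitRep q)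
      (fderiv ℝ (fun w => hLift w (σ (hopf w))) (unitRep q) (hLift (unitRep q) X)) := rfl

theorem hLift_cast {m : ℕ} (σ : (x : CProj m) → Tan x) (q : CProj m) :
    hLift (unitRep q) (σ q) = hLift (unitRep q) (σ (hopf (unitRep q))) := by
  have h : ∀ x, x = q → (σ x : CModel m) = σ q := by rintro _ rfl; rfl
  exact congrArg (fun v : CModel m => hLift (unitRep q) v) (h _ (hopf_unitRep q)).symm

theorem fderiv_hLift {m : ℕ} {q : CProj m}
    (X Y : (x : CProj m) → TangentSpace 𝓘(ℝ, CModel m) x)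
    (hY : MDifferentiableAt 𝓘(ℝ, CModel m) 𝓘(ℝ, CModel m).tangent
      (fun x => (⟨x, Y x⟩ : TangentBundle 𝓘(ℝ, CModel m) (CProj m))) q) :
    @Eq (CModel m) (fsConnection m Y q (X q))
      (fderiv ℝ (coordField q Y) (extChartAt 𝓘(ℝ, CModel m) q q)
        (coordField q X (extChartAt 𝓘(ℝ, CModel m) q q)) -
      fderiv ℝ (fderiv ℝ (affCoord (idx q))) (unitRep q) (hLift (unitRep q) (X q))
        (hLift (unitRep q) (Y q))) := by
  have hz := unitRep_ne_zero q
  have hi : unitRep q (idx q) ≠ 0 := by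
    have := idx_hopf hz
    rwa [hopf_unitRep] at this
  have hx : extChartAt 𝓘(ℝ, CModel m) q q = affCoord (idx q) (unitRep q) := by
    change coord (idx q) q = _
    have h : q = mk ⟨unitRep q, hz⟩ := by rw [← hopf_of_ne hz, hopf_unitRep]
    exact (congrArg (coord (idx q)) h).trans (coord_mk _ _)
  have hfd : ∀ᶠ w in 𝓝 (unitRep q), fderiv ℝ (affCoord (idx q)) w =
      (dAffCoord (idx q) w).restrictScalars ℝ := by
    filter_upwards [eventually_ne (idx q) hi] with w hw
    exact ((hasFDerivAt_affCoord (idx q) w hw).restrictScalars ℝ).fderiv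
  have hA := contDiffAt_affCoord (idx q) _ hi
  have h1 : DifferentiableAt ℝ (fderiv ℝ (affCoord (idx q))) (unitRep q) :=
    (hA.fderiv_right (m := 1) (by norm_cast)).differentiableAt (by simp)
  have h2 := differentiableAt_hLift' hY
  have h3 := (h1.hasFDerivAt.clm_apply h2.hasFDerivAt)
  have hc : DifferentiableAt ℝ (coordField q Y) (affCoord (idx q) (unitRep q)) := by
    rw [← hx]
    exact differentiableAt_coordField hY
  have h4 := hc.hasFDerivAt.comp (unitRep q) (hA.differentiableAt (by simp)).hasFDerivAt
  have h5 : (fun w => fderiv ℝ (affCoord (idx q)) w (hLift w (Y (hopf w)))) =ᶠ[𝓝 (unitRep q)]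
      coordField q Y ∘ affCoord (idx q) := by
    filter_upwards [hfd, eventually_ne (idx q) hi] with w hw hw'
    rw [hw]
    exact dAffCoord_hLift q Y hw'
  have h6 := (h3.congr_of_eventuallyEq h5.symm).unique h4
  have h7 := congrArg (fun L : CVec m →L[ℝ] CModel m => L (hLift (unitRep q) (X q))) h6
  have h8 : fderiv ℝ (affCoord (idx q)) (unitRep q) (hLift (unitRep q) (X q)) =
      coordField q X (affCoord (idx q) (unitRep q)) := by
    rw [hfd.self_of_nhds, hLift_cast]
    exact dAffCoord_hLift q X hi
  have h9 : fderiv ℝ (affCoord (idx q)) (unitRep q) = (dHopf (unitRep q) : CVec m →L[ℝ] CModel m) := by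
    rw [hfd.self_of_nhds, dHopf_eq_idx hz, hopf_unitRep]
  rw [hx, ← h8, hLift_cast Y]
  simp only [add_apply, ContinuousLinearMap.comp_apply,
    ContinuousLinearMap.flip_apply] at h7
  rw [← h7, add_sub_cancel_right, h9]
  rfl

/-- The connection is torsion-free. -/
theorem torsion_fsConnection (m : ℕ) : (fsConnection m).torsion = 0 := by
  rw [CovariantDerivative.torsion_eq_zero_iff]
  intro X Y q hX hY
  have hz := unitRep_ne_zero q
  have hi : unitRep q (idx q) ≠ 0 := by
    have := idx_hopf hz
    rwa [hopf_unitRep] at this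
  have h1 := fderiv_hLift X Y hY
  have h2 := fderiv_hLift Y X hX
  have h3 : fderiv ℝ (fderiv ℝ (affCoord (idx q))) (unitRep q) (hLift (unitRep q) (X q))
        (hLift (unitRep q) (Y q)) =
      fderiv ℝ (fderiv ℝ (affCoord (idx q))) (unitRep q) (hLift (unitRep q) (Y q))
        (hLift (unitRep q) (X q)) :=
    ((contDiffAt_affCoord (idx q) _ hi).isSymmSndFDerivAt (by simp; norm_cast)) _ _
  rw [← VectorField.mlieBracketWithin_univ, VectorField.mlieBracketWithin_apply]
  have h4 : mfderiv 𝓘(ℝ, CModel m) 𝓘(ℝ, CModel m) (extChartAt 𝓘(ℝ, CModel m) q) q =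
      ContinuousLinearMap.id ℝ (CModel m) := by
    simp only [mfld_simps]
    rw [mfderiv_chartAt_eq_tangentCoordChange (mem_chart_source _ q)]
    ext1 v
    exact tangentCoordChange_self (mem_extChartAt_source q)
  refine Eq.trans ?_ (congrArg (fun L : CModel m →L[ℝ] CModel m => L.inverse _) h4).symm
  rw [ContinuousLinearMap.inverse_id]
  change @HSub.hSub (CModel m) (CModel m) (CModel m) _ (fsConnection m Y q (X q))
    (fsConnection m X q (Y q)) = _
  rw [h1, h2, h3, sub_sub_sub_cancel_right]
  have hs : (extChartAt 𝓘(ℝ, CModel m) q).symm ⁻¹' Set.univ ∩ Set.range 𝓘(ℝ, CModel m) =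
      Set.univ := by simp
  rw [hs]
  change _ = fderivWithin ℝ (coordField q Y) Set.univ _ (coordField q X _) -
    fderivWithin ℝ (coordField q X) Set.univ _ (coordField q Y _)
  rw [fderivWithin_univ, fderivWithin_univ]

theorem fsMetric_hopf {m : ℕ} {w : CVec m} (hw : w ≠ 0) (X Y : Tan (hopf w)) :
    fsMetric (hopf w) X Y = inner ℝ (hLift w X) (hLift w Y) / ‖w‖ ^ 2 := by
  have hu := unitRep_ne_zero (hopf w)
  obtain ⟨c, hc⟩ : ∃ c : ℂ, c • w = unitRep (hopf w) := by
    have := hopf_unitRep (hopf w)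
    conv_rhs at this => rw [hopf_of_ne hw]
    rw [hopf_of_ne hu] at this
    exact (Projectivization.mk_eq_mk_iff' ℂ _ _ _ _).1 this
  have hc0 : c ≠ 0 := by
    rintro rfl
    exact hu (by rw [← hc, zero_smul])
  have hn : ‖c‖ * ‖w‖ = 1 := by
    rw [← norm_smul, hc, norm_unitRep]
  have hi := idx_hopf hw
  have key (X : Tan (hopf w)) : hLift (unitRep (hopf w)) X = c • hLift w X := by
    have h1 : inner ℂ (unitRep (hopf w)) (c • hLift w X) = 0 := by
      rw [← hc, inner_smul_left, inner_smul_right, inner_hLift hw]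
      simp
    have h2 : (dHopf (unitRep (hopf w)) (c • hLift w X) : CModel m) = X := by
      rw [dHopf_eq_idx hu, hopf_unitRep]
      have h3 : (dHopf w (hLift w X) : CModel m) = X := dHopf_hLift hw X
      rw [dHopf_eq_idx hw] at h3
      refine Eq.trans ?_ h3
      refine PiLp.ext fun j => ?_
      change dAffCoord (idx (hopf w)) (unitRep (hopf w)) (c • hLift w X) j =
        dAffCoord (idx (hopf w)) w (hLift w X) j
      rw [dAffCoord_apply, dAffCoord_apply, ← hc]
      simp only [PiLp.smul_apply, smul_eq_mul]
      field_simp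
    rw [← hLift_unique hu _ h1]
    exact congrArg (fun v : CModel m => hLift (unitRep (hopf w)) v) h2.symm
  have hw2 : ‖c‖ ^ 2 = 1 / ‖w‖ ^ 2 := by
    have : ‖w‖ ≠ 0 := norm_ne_zero_iff.2 hw
    field_simp
    rw [← mul_pow, hn, one_pow]
  rw [fsMetric]
  refine (congrArg₂ (fun a b : CVec m => inner ℝ a b) (key X) (key Y)).trans ?_
  have hre : ∀ a b : CVec m, inner ℝ a b = (inner ℂ a b).re := by
    intro a b
    simp [PiLp.inner_apply, Complex.inner]
  rw [hre, hre, inner_smul_left, inner_smul_right, ← mul_assoc, Complex.conj_mul', ← Complex.ofReal_pow,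
    Complex.re_ofReal_mul, hw2]
  ring

/-- The connection is metric: `X g(σ, τ) = g(∇_X σ, τ) + g(σ, ∇_X τ)`. -/
theorem fsConnection_metric {m : ℕ} {σ τ : (x : CProj m) → TangentSpace 𝓘(ℝ, CModel m) x}
    {q : CProj m}
    (hσ : MDifferentiableAt 𝓘(ℝ, CModel m) 𝓘(ℝ, CModel m).tangent
      (fun x => (⟨x, σ x⟩ : TangentBundle 𝓘(ℝ, CModel m) (CProj m))) q)
    (hτ : MDifferentiableAt 𝓘(ℝ, CModel m) 𝓘(ℝ, CModel m).tangent
      (fun x => (⟨x, τ x⟩ : TangentBundle 𝓘(ℝ, CModel m) (CProj m))) q) (X : Tan q) :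
    MDifferentiableAt 𝓘(ℝ, CModel m) 𝓘(ℝ, ℝ) (fun x => fsMetric x (σ x) (τ x)) q ∧
    (mfderiv 𝓘(ℝ, CModel m) 𝓘(ℝ, ℝ) (fun x => fsMetric x (σ x) (τ x)) q X : ℝ) =
      fsMetric q (fsConnection m σ q X) (τ q) + fsMetric q (σ q) (fsConnection m τ q X) := by
  have hz := unitRep_ne_zero q
  have hi : unitRep q (idx q) ≠ 0 := by
    have := idx_hopf hz
    rwa [hopf_unitRep] at this
  have h1 := differentiableAt_hLift' hσ
  have h2 := differentiableAt_hLift' hτ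
  have hn : HasFDerivAt (fun w : CVec m => (‖w‖ ^ 2)⁻¹)
      (-(‖unitRep q‖ ^ 2 ^ 2)⁻¹ • (2 : ℕ) • innerSL ℝ (unitRep q)) (unitRep q) := by
    have h := (hasDerivAt_inv (x := ‖unitRep q‖ ^ 2) (by simp [norm_unitRep]))
    have := h.comp_hasFDerivAt (unitRep q) (hasStrictFDerivAt_norm_sq (unitRep q)).hasFDerivAt
    simpa [norm_unitRep, Function.comp_def] using this
  have hφ := (h1.hasFDerivAt.inner ℝ h2.hasFDerivAt).mul hn
  have he : (fun w => fsMetric (hopf w) (σ (hopf w)) (τ (hopf w))) =ᶠ[𝓝 (unitRep q)]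
      ((fun w => inner ℝ (hLift w (σ (hopf w))) (hLift w (τ (hopf w)))) *
        fun w => (‖w‖ ^ 2)⁻¹) := by
    filter_upwards [isOpen_ne.mem_nhds hz] with w hw
    exact (fsMetric_hopf hw _ _).trans (div_eq_mul_inv _ _)
  have hφ' := hφ.congr_of_eventuallyEq he
  have hq : q ∈ affOpen (idx q) := (exists_mem_affOpen q).choose_spec
  have hsec : MDifferentiableAt 𝓘(ℝ, CModel m) 𝓘(ℝ, ℝ) (fun x => fsMetric x (σ x) (τ x)) q := by
    let s : CModel m → CVec m := fun v => unitRep q (idx q) • affVec (idx q) v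
    have hs : ContDiff ℝ ∞ s := (contDiff_affVec (idx q)).const_smul _
    have hsq : s (chartAt (CModel m) q q) = unitRep q := by
      have h : q = mk ⟨unitRep q, hz⟩ := by rw [← hopf_of_ne hz, hopf_unitRep]
      have h' : chartAt (CModel m) q q = affCoord (idx q) (unitRep q) :=
        (congrArg (coord (idx q)) h).trans (coord_mk _ _)
      rw [h']
      exact smul_affVec_affCoord _ _ hi
    have hc : MDifferentiableAt 𝓘(ℝ, CModel m) 𝓘(ℝ, CModel m) (chartAt (CModel m) q) q :=
      mdifferentiableAt_atlas (ChartedSpace.chart_mem_atlas q) (mem_chart_source _ q)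
    have h3 : DifferentiableAt ℝ ((fun w => fsMetric (hopf w) (σ (hopf w)) (τ (hopf w))) ∘ s)
        (chartAt (CModel m) q q) := by
      apply DifferentiableAt.comp
      · rw [hsq]
        exact hφ'.differentiableAt
      · exact hs.differentiable (by simp) _
    have h4 := h3.mdifferentiableAt.comp q hc
    refine h4.congr_of_eventuallyEq ?_
    filter_upwards [(isOpen_affOpen (idx q)).mem_nhds hq] with x hx
    have h5 : hopf (s (chartAt (CModel m) q x)) = x := by
      have h6 : hopf (s (chartAt (CModel m) q x)) =
          (chartAt (CModel m) q).symm (chartAt (CModel m) q x) := by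
        have h7 : s (chartAt (CModel m) q x) ≠ 0 := smul_ne_zero hi (affVec_ne_zero _ _)
        rw [hopf_of_ne h7]
        exact mk_smul ⟨_, affVec_ne_zero _ _⟩ ⟨_, h7⟩ rfl
      rw [h6]
      exact (chartAt (CModel m) q).left_inv hx
    simp only [Function.comp_apply]
    rw [h5]
  refine ⟨hsec, ?_⟩
  have hh : HasMFDerivAt 𝓘(ℝ, CVec m) 𝓘(ℝ, CModel m) hopf (unitRep q) (dHopf (unitRep q)) :=
    ((contMDiffAt_hopf hz).mdifferentiableAt (by simp)).hasMFDerivAt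
  let F' : CModel m →L[ℝ] ℝ :=
    mfderiv 𝓘(ℝ, CModel m) 𝓘(ℝ, ℝ) (fun x => fsMetric x (σ x) (τ x)) q
  have hF : HasMFDerivAt 𝓘(ℝ, CModel m) 𝓘(ℝ, ℝ) (fun x => fsMetric x (σ x) (τ x))
      (hopf (unitRep q)) F' := by
    rw [hopf_unitRep]
    exact hsec.hasMFDerivAt
  have hcomp : HasFDerivAt (fun w => fsMetric (hopf w) (σ (hopf w)) (τ (hopf w)))
      (F'.comp (dHopf (unitRep q) : CVec m →L[ℝ] CModel m)) (unitRep q) :=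
    (hF.comp (unitRep q) hh).hasFDerivAt
  have h8 := congrArg (fun L : CVec m →L[ℝ] ℝ => L (hLift (unitRep q) X)) (hcomp.unique hφ')
  have h9 : (dHopf (unitRep q) (hLift (unitRep q) X) : CModel m) = X := dHopf_hLift hz X
  have hre : ∀ a b : CVec m, inner ℝ a b = (inner ℂ a b).re := by
    intro a b
    simp [PiLp.inner_apply, Complex.inner]
  have h10 (u : CVec m) (Y : CVec m) (hY : inner ℂ (unitRep q) Y = 0) :
      inner ℝ (hLift (unitRep q) (dHopf (unitRep q) u)) Y = inner ℝ u Y := by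
    have h11 : ∃ c : ℂ, u - hLift (unitRep q) (dHopf (unitRep q) u) = c • unitRep q := by
      rw [← dHopf_eq_zero_iff hz, map_sub, dHopf_hLift hz, sub_self]
    obtain ⟨c, hc⟩ := h11
    rw [eq_comm, ← sub_eq_zero, ← inner_sub_left, hc, hre, inner_smul_left, hY]
    simp
  have h12 : inner ℝ (unitRep q) (hLift (unitRep q) X) = 0 := by
    rw [hre, show inner ℂ (unitRep q) (hLift (unitRep q) X) = 0 from inner_hLift hz X]
    rfl
  change F' X = _
  refine ((congrArg F' h9).symm.trans h8).trans ?_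
  rw [fsMetric, fsMetric, fsConnection_apply, fsConnection_apply]
  have h13 := h10 (fderiv ℝ (fun w => hLift w (σ (hopf w))) (unitRep q) (hLift (unitRep q) X))
    (hLift (unitRep q) (τ q)) (inner_hLift hz (τ q))
  have h14 := h10 (fderiv ℝ (fun w => hLift w (τ (hopf w))) (unitRep q) (hLift (unitRep q) X))
    (hLift (unitRep q) (σ q)) (inner_hLift hz (σ q))
  rw [real_inner_comm] at h14
  refine Eq.trans ?_ (congrArg₂ (· + ·) h13 h14).symm
  rw [hLift_cast σ, hLift_cast τ]
  simp [fderivInnerCLM_apply, h12, norm_unitRep]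
  rw [real_inner_comm, add_comm]

end CProj

/-! ### The complex quadric -/

open CProj

/-- The complex quadric `Q^n` in `ℂP^(n+1)`. -/
def quadric (n : ℕ) : Set (CProj (n + 1)) :=
  {q | ∃ z : CVec (n + 1), z ≠ 0 ∧ hopf z = q ∧ ∑ i, z i ^ 2 = 0}

/-- The kernel of the differential of `z ↦ ∑ z_i ^ 2` at `z`. -/
def quadricKer {n : ℕ} (z : CVec (n + 1)) : Submodule ℝ (CVec (n + 1)) where
  carrier := {w | ∑ i, z i * w i = 0}
  add_mem' := by
    intro v w hv hw
    simp only [Set.mem_ofPred_eq, PiLp.add_apply, mul_add, Finset.sum_add_distrib] at *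
    rw [hv, hw, add_zero]
  zero_mem' := by simp
  smul_mem' := by
    intro c w hw
    simp only [Set.mem_ofPred_eq, PiLp.smul_apply, mul_smul_comm, ← Finset.smul_sum] at *
    rw [hw, smul_zero]

/-- The tangent space of the quadric at a point `q` of it, as a subspace of the tangent space of
the projective space. -/
def quadricTan {n : ℕ} (q : CProj (n + 1)) : Submodule ℝ (Tan q) :=
  (quadricKer (unitRep q)).map (dHopf (unitRep q)).toLinearMap

/-- `ν` is a unit normal of the quadric in `ℂP^(n+1)` at `q`. -/
def IsQuadricUnitNormal {n : ℕ} (q : CProj (n + 1)) (ν : Tan q) : Prop :=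
  fsMetric q ν ν = 1 ∧ ∀ X ∈ quadricTan q, fsMetric q ν X = 0

/-- `A` restricts to the shape operator `X ↦ -(∇_X ζ)^⊤` of the quadric in `ℂP^(n+1)` at `q`
associated with a unit normal field `ζ`, defined near `q`, with `ζ_q = ν`. The values of `A` on
vectors that are not tangent to the quadric are irrelevant. -/
def IsQuadricShapeOperator {n : ℕ} (q : CProj (n + 1)) (ν : Tan q) (A : Tan q →ₗ[ℝ] Tan q) :
    Prop :=
  ∃ (O : Set (CProj (n + 1))) (ζ : (x : CProj (n + 1)) → Tan x),
    IsOpen O ∧ q ∈ O ∧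
    ContMDiffOn 𝓘(ℝ, CModel (n + 1)) 𝓘(ℝ, CModel (n + 1)).tangent ∞
      (fun x => (⟨x, ζ x⟩ : TangentBundle 𝓘(ℝ, CModel (n + 1)) (CProj (n + 1)))) O ∧
    (∀ x ∈ O ∩ quadric n, IsQuadricUnitNormal x (ζ x)) ∧ ζ q = ν ∧
    ∀ X ∈ quadricTan q, A X ∈ quadricTan q ∧
      ∀ Y ∈ quadricTan q, fsMetric q (A X) Y = -fsMetric q (fsConnection (n + 1) ζ q X) Y

/-! ### Maps from an `n`-dimensional manifold into the quadric -/

section Maps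

variable {n : ℕ} {M : Type*} [TopologicalSpace M] [ChartedSpace (EuclideanSpace ℝ (Fin n)) M]

/-- The differential `(df)_p` of a map into `ℂP^(n+1)`. -/
abbrev mapD (f : M → CProj (n + 1)) (p : M) : TangentSpace (𝓡 n) p →L[ℝ] Tan (f p) :=
  mfderiv (𝓡 n) 𝓘(ℝ, CModel (n + 1)) f p

/-- `f` is, on the open set `U`, a Lagrangian immersion into the quadric: a smooth immersion such
that `J` maps tangent spaces into normal spaces (within the tangent space of the quadric) and vice
versa. The quadric is an embedded submanifold of `ℂP^(n+1)`, so smoothness and immersivity may be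
tested in `ℂP^(n+1)`; the metric on the source is the induced one. -/
structure IsLagrangianImmersion (U : Set M) (f : M → CProj (n + 1)) : Prop where
  mem_quadric : ∀ p ∈ U, f p ∈ quadric n
  smooth : ContMDiffOn (𝓡 n) 𝓘(ℝ, CModel (n + 1)) ∞ f U
  injective : ∀ p ∈ U, Function.Injective (mapD f p)
  tangent_to_normal : ∀ p ∈ U, ∀ v w, fsMetric (f p) (cpxJ (f p) (mapD f p v)) (mapD f p w) = 0
  normal_to_tangent : ∀ p ∈ U, ∀ N ∈ quadricTan (f p),
    (∀ w, fsMetric (f p) N (mapD f p w) = 0) → ∃ v, mapD f p v = cpxJ (f p) N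

/-- `F` is, on the open set `U`, a horizontal lift of `f` to the Stiefel manifold of the unit
vectors `z` with `∑ z_i ^ 2 = 0`. -/
structure IsHorizontalLift (U : Set M) (f : M → CProj (n + 1)) (F : M → CVec (n + 1)) : Prop where
  smooth : ContMDiffOn (𝓡 n) 𝓘(ℝ, CVec (n + 1)) ∞ F U
  norm_eq : ∀ p ∈ U, ‖F p‖ = 1
  sum_sq : ∀ p ∈ U, ∑ i, F p i ^ 2 = 0
  lift : ∀ p ∈ U, hopf (F p) = f p
  horizontal : ∀ p ∈ U, ∀ v,
    inner ℂ (F p) (mfderiv (𝓡 n) 𝓘(ℝ, CVec (n + 1)) F p v : CVec (n + 1)) = 0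

/-- `A` assigns to `p ∈ U` the shape operator of the quadric at `f p` associated with the unit
normal `ν p`. -/
def IsShapeOperatorAlong (U : Set M) (f : M → CProj (n + 1)) (ν : (p : M) → Tan (f p))
    (A : (p : M) → Tan (f p) →ₗ[ℝ] Tan (f p)) : Prop :=
  ∀ p ∈ U, IsQuadricShapeOperator (f p) (ν p) (A p)

/-- A frame of tangent vectors at every point of `U`. -/
def IsFrameOn (U : Set M) (e : Fin n → (p : M) → TangentSpace (𝓡 n) p) : Prop :=
  ∀ p ∈ U, LinearIndependent ℝ fun j => e j p

/-- `A (df) e_j = cos (2 θ_j) (df) e_j - sin (2 θ_j) J (df) e_j` on `U` for all `j`: the `θ_j` are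
angle functions for `f`, `A` and the frame `e`. -/
def AreAngleFunctions (U : Set M) (f : M → CProj (n + 1))
    (A : (p : M) → Tan (f p) →ₗ[ℝ] Tan (f p))
    (e : Fin n → (p : M) → TangentSpace (𝓡 n) p) (θ : Fin n → M → ℝ) : Prop :=
  ∀ p ∈ U, ∀ j, A p (mapD f p (e j p)) =
    Real.cos (2 * θ j p) • mapD f p (e j p) -
      Real.sin (2 * θ j p) • cpxJ (f p) (mapD f p (e j p))

/-! ### Hypersurfaces of the unit sphere and their Gauss maps -/

/-- The differential `(da)_p` of a map into `ℝ^(n+2)`. -/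
def vecD (a : M → EuclideanSpace ℝ (Fin (n + 2))) (p : M) :
    TangentSpace (𝓡 n) p →L[ℝ] EuclideanSpace ℝ (Fin (n + 2)) :=
  mfderiv (𝓡 n) 𝓘(ℝ, EuclideanSpace ℝ (Fin (n + 2))) a p

/-- `a` is, on the open set `U`, a smooth immersion into the unit sphere of `ℝ^(n+2)`, with smooth
unit normal `b` tangent to the sphere. -/
structure IsSphereHypersurface (U : Set M) (a b : M → EuclideanSpace ℝ (Fin (n + 2))) : Prop where
  smooth : ContMDiffOn (𝓡 n) 𝓘(ℝ, EuclideanSpace ℝ (Fin (n + 2))) ∞ a U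
  smooth_normal : ContMDiffOn (𝓡 n) 𝓘(ℝ, EuclideanSpace ℝ (Fin (n + 2))) ∞ b U
  norm_eq : ∀ p ∈ U, ‖a p‖ = 1
  injective : ∀ p ∈ U, Function.Injective (vecD a p)
  norm_normal : ∀ p ∈ U, ‖b p‖ = 1
  inner_eq : ∀ p ∈ U, inner ℝ (a p) (b p) = 0
  inner_tangent : ∀ p ∈ U, ∀ v, inner ℝ (vecD a p v) (b p) = 0

/-- The covariant derivative in the unit sphere of a vector field `b` along `a`, tangent to the
sphere: the part of the derivative orthogonal to the position vector. -/
def sphereCovD (a b : M → EuclideanSpace ℝ (Fin (n + 2))) (p : M) (v : TangentSpace (𝓡 n) p) :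
    EuclideanSpace ℝ (Fin (n + 2)) :=
  vecD b p v - inner ℝ (a p) (vecD b p v) • a p

/-- `S v = c v` for the shape operator `S` of `a` at `p` associated with the unit normal `b`, which
is given by `∇_v b = -(da) (S v)`. -/
def IsPrincipalAt (a b : M → EuclideanSpace ℝ (Fin (n + 2))) (p : M) (v : TangentSpace (𝓡 n) p)
    (c : ℝ) : Prop :=
  sphereCovD a b p v = -vecD a p (c • v)

/-- The set of principal curvatures of `a` at `p`, with respect to the unit normal `b`. -/
def principalCurvatures (a b : M → EuclideanSpace ℝ (Fin (n + 2))) (p : M) : Set ℝ :=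
  {c | ∃ v : TangentSpace (𝓡 n) p, v ≠ 0 ∧ IsPrincipalAt a b p v c}

/-- `e` is on `U` a frame of principal directions of `a`, with principal curvature functions `l`
with respect to the unit normal `b`. -/
def IsPrincipalFrame (U : Set M) (a b : M → EuclideanSpace ℝ (Fin (n + 2)))
    (e : Fin n → (p : M) → TangentSpace (𝓡 n) p) (l : Fin n → M → ℝ) : Prop :=
  IsFrameOn U e ∧ ∀ p ∈ U, ∀ j, IsPrincipalAt a b p (e j p) (l j p)

/-- The vector `u + i v` of `ℂ^(n+2)`, for `u v` in `ℝ^(n+2)`. -/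
def cpxVec (u v : EuclideanSpace ℝ (Fin (n + 2))) : CVec (n + 1) :=
  WithLp.toLp 2 fun i => (u i : ℂ) + Complex.I * (v i : ℂ)

/-- Complex conjugation on `ℂ^(n+2)`. -/
def conjVec (z : CVec (n + 1)) : CVec (n + 1) :=
  WithLp.toLp 2 fun i => (starRingEnd ℂ) (z i)

/-- The Gauss map `p ↦ [a(p) + i b(p)]`. -/
def gaussMap (a b : M → EuclideanSpace ℝ (Fin (n + 2))) (p : M) : CProj (n + 1) :=
  hopf (cpxVec (a p) (b p))

/-- The canonical lift `p ↦ (a(p) + i b(p)) / √2` of the Gauss map. -/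
def gaussLift (a b : M → EuclideanSpace ℝ (Fin (n + 2))) (p : M) : CVec (n + 1) :=
  ((Real.sqrt 2 : ℂ)⁻¹) • cpxVec (a p) (b p)

/-- The unit normal `dπ (conj z)` of the quadric along the Gauss map, `z` being the canonical
lift. -/
def gaussNormal (a b : M → EuclideanSpace ℝ (Fin (n + 2))) (p : M) : Tan (gaussMap a b p) :=
  dHopf (gaussLift a b p) (conjVec (gaussLift a b p))

end Maps

end

/-! Everything is computed upstairs, in the horizontal spaces over unit vectors `z` with `∑ z_i ^ 2
= 0`. There a tangent vector of the quadric lifts to a vector Hermitian-orthogonal to `z` and to its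
conjugate, `J` is multiplication by `i`, the unit normals are `c • conjVec z` with `|c| = 1`
(`isQuadricUnitNormal_iff`), and the shape operator of such a normal is `X ↦ -c X̄`
(`IsQuadricShapeOperator.liftAt_eq`), because the normal field differentiates like `c z̄` along the
cone.

For `z = (a + i b) / √2` the lift of `df v` is `(da v + i db v) / √2` (`IsFront.liftAt_mapD`). If
`v` is principal with curvature `λ`, then `db v = -λ da v`, so this lift is `1 - iλ` times a real
vector, and conjugation replaces the factor by `1 + iλ`. The angle equation is therefore the scalar
identity `-c (1 + iλ) = e^(-2iθ) (1 - iλ)`. For `c = 1` it says `λ = cot θ`. For general `c` it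
always has a solution `θ`, and comparing two such identities eliminates `c` and leaves the formula
for `cot (θ_j - θ_k)` (`cot_sub_of_anglePhase`); reversing the normal changes the sign of each `λ`.

For the local existence of hypersurfaces, take any smooth unit lift `G` of a Lagrangian immersion.
The form `Im ⟨G, dG⟩` is closed, since its differential is the pulled back Kähler form; if `φ` is a
primitive, then `e^(-iφ) G` is horizontal (`exists_phase`). The real and imaginary parts of a
horizontal lift, scaled by `√2`, satisfy all the equations of a hypersurface with unit normal, but
`a` need not be immersive. Such pairs are the fronts of `IsFront`, with pointwise linear data
`LegendrianPair`. Multiplying the lift by `e^(-it)` rotates `(a, b)` without changing the Gauss map.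
Since `⟨da v, db w⟩` is symmetric, the pencil `da + s db` is singular for finitely many `s` only
(`LegendrianPair.finite_singular`), so a generic rotation is immersive at the point, hence near it.

The same freedom gives non-uniqueness: with `s = tan t`, a curvature `λ` turns into `(λ + s) / (1 -
sλ)`, and all but finitely many `s` move it off the finite set of old curvatures
(`LegendrianPair.exists_rotate_ne`). Conversely, two horizontal lifts of the same map differ by a
unit factor, which horizontality forces to be locally constant (`IsFront.exists_parallel`). -/

open CProj

noncomputable section

/-! ### Horizontal lifts at an arbitrary representative of a point -/

namespace CProj

variable {m : ℕ} {z : CVec m} {q : CProj m}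

/-- The horizontal lift to `z`, on the model space of the tangent spaces. -/
def liftAt (z : CVec m) : CModel m →ₗ[ℝ] CVec m := hLift z

/-- The differential of the projection at `z`, with values in the model space of the tangent
spaces. -/
def projAt (z : CVec m) : CVec m →L[ℝ] CModel m := dHopf z

theorem ne_zero_of_norm_eq_one (hz : ‖z‖ = 1) : z ≠ 0 := by
  rintro rfl
  simp at hz

theorem projAt_liftAt (hz : z ≠ 0) (X : CModel m) : projAt z (liftAt z X) = X :=
  dHopf_hLift hz X

theorem inner_liftAt (hz : z ≠ 0) (X : CModel m) : inner ℂ z (liftAt z X) = 0 :=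
  inner_hLift hz X

theorem liftAt_projAt (hz : z ≠ 0) {u : CVec m} (h : inner ℂ z u = 0) :
    liftAt z (projAt z u) = u :=
  hLift_unique hz u h

theorem liftAt_injective (hz : z ≠ 0) : Function.Injective (liftAt z) := fun X Y h => by
  rw [← projAt_liftAt hz X, h, projAt_liftAt hz]

theorem projAt_eq_zero_iff (hz : z ≠ 0) (w : CVec m) : projAt z w = 0 ↔ ∃ c : ℂ, w = c • z :=
  dHopf_eq_zero_iff hz w

theorem hopf_smul (hz : z ≠ 0) {c : ℂ} (hc : c ≠ 0) : hopf (c • z) = hopf z := by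
  rw [hopf_of_ne hz, hopf_of_ne (smul_ne_zero hc hz)]
  exact mk_smul ⟨z, hz⟩ ⟨c • z, _⟩ rfl

theorem exists_smul_of_hopf_eq {w : CVec m} (hz : z ≠ 0) (hw : w ≠ 0) (h : hopf w = hopf z) :
    ∃ c : ℂ, c ≠ 0 ∧ w = c • z := by
  rw [hopf_of_ne hz, hopf_of_ne hw] at h
  obtain ⟨c, hc⟩ := (Projectivization.mk_eq_mk_iff' ℂ _ _ _ _).1 h
  refine ⟨c, ?_, hc.symm⟩
  rintro rfl
  exact hw (hc.symm.trans (zero_smul ℂ z))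

/-- Affine coordinates are homogeneous of degree zero. The two sides can be compared because both
points determine the same class, hence the same preferred chart, and both values are read in the
model space. -/
theorem projAt_smul (hz : z ≠ 0) {c : ℂ} (hc : c ≠ 0) (w : CVec m) :
    projAt (c • z) (c • w) = projAt z w := by
  have hi := idx_hopf hz
  have h1 : projAt z w = dAffCoord (idx (hopf z)) z w := by
    rw [projAt, dHopf_eq_idx hz]; rfl
  have h2 : projAt (c • z) (c • w) = dAffCoord (idx (hopf (c • z))) (c • z) (c • w) := by
    rw [projAt, dHopf_eq_idx (smul_ne_zero hc hz)]; rfl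
  rw [h1, h2, hopf_smul hz hc]
  ext j
  rw [dAffCoord_apply, dAffCoord_apply]
  simp only [PiLp.smul_apply, smul_eq_mul]
  field_simp

theorem liftAt_smul (hz : z ≠ 0) {c : ℂ} (hc : c ≠ 0) (X : CModel m) :
    liftAt (c • z) X = c • liftAt z X := by
  have h : inner ℂ (c • z) (c • liftAt z X) = 0 := by
    rw [inner_smul_left, inner_smul_right, inner_liftAt hz]
    simp
  rw [← liftAt_projAt (smul_ne_zero hc hz) h, projAt_smul hz hc, projAt_liftAt hz]

theorem exists_unitRep_eq (hz : z ≠ 0) (h : hopf z = q) :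
    ∃ c : ℂ, c ≠ 0 ∧ unitRep q = c • z :=
  exists_smul_of_hopf_eq hz (unitRep_ne_zero q) (by rw [hopf_unitRep, h])

/-- Frees the metric from the chosen `unitRep q`, so that the canonical lift of a Gauss map can be
used instead. -/
theorem fsMetric_eq (hz : ‖z‖ = 1) (h : hopf z = q) (X Y : Tan q) :
    fsMetric q X Y = inner ℝ (liftAt z X) (liftAt z Y) := by
  subst h
  rw [fsMetric_hopf (ne_zero_of_norm_eq_one hz), hz, one_pow, div_one]
  rfl

theorem liftAt_cpxJ (hz : z ≠ 0) (h : hopf z = q) (X : Tan q) :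
    liftAt z (cpxJ q X) = Complex.I • liftAt z X := by
  obtain ⟨c, hc, hu⟩ := exists_unitRep_eq hz h
  have h1 : cpxJ q X = projAt (unitRep q) (Complex.I • liftAt (unitRep q) X) := rfl
  have h2 : liftAt (unitRep q) X = c • liftAt z X := by rw [hu]; exact liftAt_smul hz hc X
  have h3 : inner ℂ z (Complex.I • liftAt z X) = 0 := by
    rw [inner_smul_right, inner_liftAt hz X, mul_zero]
  rw [h1, h2, smul_comm, hu, projAt_smul hz hc, liftAt_projAt hz h3]

theorem inner_real_eq_re (u v : CVec m) : inner ℝ u v = (inner ℂ u v).re := by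
  simp [PiLp.inner_apply, Complex.inner]

end CProj

/-! ### Complex conjugation, real and imaginary parts -/

section Vectors

variable {n : ℕ}

theorem inner_cvec (u v : CVec n) : inner ℂ u v = ∑ i, (starRingEnd ℂ) (u i) * v i := by
  simp [PiLp.inner_apply, mul_comm]

/-- Complex conjugation as a real continuous linear map. -/
def conjCLM : CVec (n + 1) →L[ℝ] CVec (n + 1) :=
  LinearMap.toContinuousLinearMap
    { toFun := conjVec
      map_add' := fun u v => by ext i; simp [conjVec]
      map_smul' := fun c u => by ext i; simp [conjVec] }

@[simp] theorem conjCLM_apply (z : CVec (n + 1)) : conjCLM z = conjVec z := rfl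

theorem conjVec_smul (c : ℂ) (z : CVec (n + 1)) :
    conjVec (c • z) = (starRingEnd ℂ) c • conjVec z := by
  ext i; simp [conjVec]

@[simp] theorem conjVec_conjVec (z : CVec (n + 1)) : conjVec (conjVec z) = z := by
  ext i; simp [conjVec]

/-- Expresses the complex bilinear form through the Hermitian product, so that the equation of the
quadric becomes an orthogonality condition. -/
theorem inner_conjVec_left (u v : CVec (n + 1)) : inner ℂ (conjVec u) v = ∑ i, u i * v i := by
  simp [inner_cvec, conjVec]

theorem inner_conjVec_left_comm (u v : CVec (n + 1)) :
    inner ℂ (conjVec u) v = inner ℂ (conjVec v) u := by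
  simp [inner_conjVec_left, mul_comm]

theorem inner_conjVec_conjVec (u v : CVec (n + 1)) :
    inner ℂ (conjVec u) (conjVec v) = inner ℂ v u := by
  simp [inner_cvec, conjVec, mul_comm]

theorem inner_conjVec_self (u : CVec (n + 1)) : inner ℂ (conjVec u) u = ∑ i, u i ^ 2 := by
  simp [inner_conjVec_left, sq]

theorem norm_conjVec (u : CVec (n + 1)) : ‖conjVec u‖ = ‖u‖ := by
  rw [norm_eq_sqrt_re_inner (𝕜 := ℂ), norm_eq_sqrt_re_inner (𝕜 := ℂ), inner_conjVec_conjVec]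

theorem inner_self_conjVec {z : CVec (n + 1)} (hs : ∑ i, z i ^ 2 = 0) :
    inner ℂ z (conjVec z) = 0 := by
  rw [← inner_conj_symm, inner_conjVec_self, hs, map_zero]

/-- The vector `u + i v` as a real continuous linear function of `(u, v)`. -/
def cpxCLM : EuclideanSpace ℝ (Fin (n + 2)) × EuclideanSpace ℝ (Fin (n + 2)) →L[ℝ] CVec (n + 1) :=
  LinearMap.toContinuousLinearMap
    { toFun := fun x => cpxVec x.1 x.2
      map_add' := fun u v => by ext i; simp [cpxVec]; ring
      map_smul' := fun c u => by ext i; simp [cpxVec]; ring }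

/-- The coordinatewise real part. -/
def reCLM : CVec (n + 1) →L[ℝ] EuclideanSpace ℝ (Fin (n + 2)) :=
  LinearMap.toContinuousLinearMap
    { toFun := fun z => WithLp.toLp 2 fun i => (z i).re
      map_add' := fun u v => by ext i; simp
      map_smul' := fun c u => by ext i; simp }

/-- The coordinatewise imaginary part. -/
def imCLM : CVec (n + 1) →L[ℝ] EuclideanSpace ℝ (Fin (n + 2)) :=
  LinearMap.toContinuousLinearMap
    { toFun := fun z => WithLp.toLp 2 fun i => (z i).im
      map_add' := fun u v => by ext i; simp
      map_smul' := fun c u => by ext i; simp }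

theorem reCLM_apply (z : CVec (n + 1)) (i : Fin (n + 2)) : reCLM z i = (z i).re := rfl

theorem imCLM_apply (z : CVec (n + 1)) (i : Fin (n + 2)) : imCLM z i = (z i).im := rfl

theorem cpxVec_apply (u v : EuclideanSpace ℝ (Fin (n + 2))) (i : Fin (n + 2)) :
    cpxVec u v i = (u i : ℂ) + Complex.I * (v i : ℂ) := rfl

@[simp] theorem reCLM_cpxVec (u v : EuclideanSpace ℝ (Fin (n + 2))) : reCLM (cpxVec u v) = u := by
  ext i; simp [reCLM_apply, cpxVec_apply]

@[simp] theorem imCLM_cpxVec (u v : EuclideanSpace ℝ (Fin (n + 2))) : imCLM (cpxVec u v) = v := by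
  ext i; simp [imCLM_apply, cpxVec_apply]

@[simp] theorem cpxVec_reCLM_imCLM (z : CVec (n + 1)) : cpxVec (reCLM z) (imCLM z) = z := by
  ext i
  simp only [cpxVec_apply, reCLM_apply, imCLM_apply]
  rw [mul_comm, Complex.re_add_im]

theorem cpxVec_inj {u v u' v' : EuclideanSpace ℝ (Fin (n + 2))} :
    cpxVec u v = cpxVec u' v' ↔ u = u' ∧ v = v' := by
  refine ⟨fun h => ⟨?_, ?_⟩, fun ⟨h, h'⟩ => by rw [h, h']⟩
  · simpa using congrArg reCLM h
  · simpa using congrArg imCLM h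

theorem smul_cpxVec (c : ℂ) (u v : EuclideanSpace ℝ (Fin (n + 2))) :
    c • cpxVec u v = cpxVec (c.re • u - c.im • v) (c.im • u + c.re • v) := by
  ext i
  apply Complex.ext
  · simp [cpxVec_apply]
  · simp [cpxVec_apply, add_comm]

theorem conjVec_cpxVec (u v : EuclideanSpace ℝ (Fin (n + 2))) :
    conjVec (cpxVec u v) = cpxVec u (-v) := by
  ext i
  simp [cpxVec_apply, conjVec]

theorem inner_cpxVec (a b c d : EuclideanSpace ℝ (Fin (n + 2))) :
    inner ℂ (cpxVec a b) (cpxVec c d) =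
      ⟨inner ℝ a c + inner ℝ b d, inner ℝ a d - inner ℝ b c⟩ := by
  rw [inner_cvec]
  apply Complex.ext
  · simp [cpxVec_apply, PiLp.inner_apply, ← Finset.sum_add_distrib, mul_comm]
  · simp [cpxVec_apply, PiLp.inner_apply, Finset.sum_add_distrib, mul_comm, sub_eq_add_neg]

end Vectors

/-! ### The tangent space of the quadric -/

namespace CProj

variable {n : ℕ} {z : CVec (n + 1)} {q : CProj (n + 1)}

/-- Pairing with the conjugate of `z` is half the differential of `∑ z_i ^ 2`. On the cone it
vanishes on multiples of `z`, which are also what the projection kills, so a kernel vector may be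
replaced by its horizontal part; rescaling then replaces `unitRep q` by `z`. -/
theorem mem_quadricTan_iff (hz : z ≠ 0) (h : hopf z = q) (hs : ∑ i, z i ^ 2 = 0) (X : Tan q) :
    X ∈ quadricTan q ↔ inner ℂ (conjVec z) (liftAt z X) = 0 := by
  obtain ⟨c, hc, hu⟩ := exists_unitRep_eq hz h
  have hk (w : CVec (n + 1)) : w ∈ quadricKer (unitRep q) ↔ inner ℂ (conjVec z) w = 0 := by
    change ∑ i, unitRep q i * w i = 0 ↔ _
    rw [← inner_conjVec_left, hu, conjVec_smul, inner_smul_left]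
    simp [hc]
  have hp (w : CVec (n + 1)) : projAt (unitRep q) w = projAt z (c⁻¹ • w) := by
    rw [← projAt_smul hz hc, smul_smul, mul_inv_cancel₀ hc, one_smul, hu]
  constructor
  · rintro ⟨w, hw, rfl⟩
    have hw' := (hk w).1 hw
    have h1 : liftAt z (projAt (unitRep q) w) = c⁻¹ • w - (inner ℂ z (c⁻¹ • w) / inner ℂ z z) • z := by
      have hn : (inner ℂ z z : ℂ) ≠ 0 := fun h => hz (inner_self_eq_zero.1 h)
      rw [hp, ← liftAt_projAt hz (u := c⁻¹ • w - (inner ℂ z (c⁻¹ • w) / inner ℂ z z) • z), map_sub,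
        (projAt_eq_zero_iff hz _).2 ⟨_, rfl⟩, sub_zero]
      rw [inner_sub_right, inner_smul_right _ _ (_ / _), div_mul_cancel₀ _ hn, sub_self]
    change inner ℂ (conjVec z) (liftAt z (projAt (unitRep q) w)) = 0
    rw [h1, inner_sub_right, inner_smul_right, inner_smul_right, hw', inner_conjVec_self, hs]
    simp
  · intro hX
    refine ⟨c • liftAt z X, (hk _).2 (by rw [inner_smul_right, hX, mul_zero]), ?_⟩
    change projAt (unitRep q) (c • liftAt z X) = X
    rw [hu, projAt_smul hz hc]
    exact projAt_liftAt hz X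

theorem liftAt_mem_quadric_cone (hz : z ≠ 0) (hq : hopf z ∈ quadric n) : ∑ i, z i ^ 2 = 0 := by
  obtain ⟨w, hw, h, hs⟩ := hq
  obtain ⟨c, hc, rfl⟩ := exists_smul_of_hopf_eq hw hz h.symm
  simp [mul_pow, ← Finset.mul_sum, hs]

end CProj

/-! ### Unit normals and shape operators of the quadric -/

namespace CProj

variable {n : ℕ} {z : CVec (n + 1)} {q : CProj (n + 1)}

theorem inner_conjVec_of_orthogonal {X : CVec (n + 1)} (h : inner ℂ (conjVec z) X = 0) :
    inner ℂ z (conjVec X) = 0 := by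
  rw [← conjVec_conjVec z, inner_conjVec_conjVec, ← inner_conj_symm, h, map_zero]

theorem inner_conjVec_conjVec_of_orthogonal {X : CVec (n + 1)} (h : inner ℂ z X = 0) :
    inner ℂ (conjVec z) (conjVec X) = 0 := by
  rw [inner_conjVec_conjVec, ← inner_conj_symm, h, map_zero]

theorem projAt_mem_quadricTan (hz : z ≠ 0) (h : hopf z = q) (hs : ∑ i, z i ^ 2 = 0)
    {u : CVec (n + 1)} (h1 : inner ℂ z u = 0) (h2 : inner ℂ (conjVec z) u = 0) :
    (projAt z u : Tan q) ∈ quadricTan q := by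
  exact (mem_quadricTan_iff hz h hs _).2
    ((congrArg (inner ℂ (conjVec z)) (liftAt_projAt hz h1)).trans h2)

/-- A vector orthogonal to all lifts of tangent vectors of the quadric vanishes if it is itself
such a lift. -/
theorem eq_zero_of_forall_quadricTan (hz : ‖z‖ = 1) (h : hopf z = q) (hs : ∑ i, z i ^ 2 = 0)
    {u : CVec (n + 1)} (h1 : inner ℂ z u = 0) (h2 : inner ℂ (conjVec z) u = 0)
    (h3 : ∀ X ∈ quadricTan q, inner ℝ u (liftAt z X) = 0) : u = 0 := by
  have hz0 := ne_zero_of_norm_eq_one hz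
  have h4 := h3 _ (projAt_mem_quadricTan hz0 h hs h1 h2)
  exact inner_self_eq_zero.1 ((congrArg (inner ℝ u) (liftAt_projAt hz0 h1)).symm.trans h4)

/-- The horizontal space at `z` is the orthogonal sum of the lifted tangent space of the quadric and
the complex line of `conjVec z`. Subtracting the component along this line from the lift of a normal
leaves a vector that is both tangent and normal. -/
theorem isQuadricUnitNormal_iff (hz : ‖z‖ = 1) (h : hopf z = q) (hs : ∑ i, z i ^ 2 = 0)
    (ν : Tan q) :
    IsQuadricUnitNormal q ν ↔ ∃ c : ℂ, ‖c‖ = 1 ∧ liftAt z ν = c • conjVec z := by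
  have hz0 := ne_zero_of_norm_eq_one hz
  have hcc : inner ℂ (conjVec z) (conjVec z) = (1 : ℂ) := by
    rw [inner_self_eq_norm_sq_to_K, norm_conjVec, hz]; simp
  have hm := fsMetric_eq hz h ν ν
  constructor
  · rintro ⟨h1, h2⟩
    set N : CVec (n + 1) := liftAt z ν with hN
    set c : ℂ := inner ℂ (conjVec z) N with hc
    have hNz : inner ℂ z N = 0 := inner_liftAt hz0 ν
    have hR1 : inner ℂ z (N - c • conjVec z) = 0 := by
      rw [inner_sub_right, inner_smul_right, inner_self_conjVec hs, hNz]; simp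
    have hR2 : inner ℂ (conjVec z) (N - c • conjVec z) = 0 := by
      rw [inner_sub_right, inner_smul_right, hcc]; simp [hc]
    have hR : N - c • conjVec z = 0 := by
      refine eq_zero_of_forall_quadricTan hz h hs hR1 hR2 fun X hX => ?_
      have h3 := (fsMetric_eq hz h ν X).symm.trans (h2 X hX)
      have h4 := (mem_quadricTan_iff hz0 h hs X).1 hX
      have h5 : inner ℝ N (liftAt z X) = 0 := h3
      rw [inner_sub_left, h5, inner_real_eq_re, inner_smul_left, h4]
      simp
    have hN' : N = c • conjVec z := sub_eq_zero.1 hR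
    refine ⟨c, ?_, hN'⟩
    rw [h1, real_inner_self_eq_norm_sq, hN', norm_smul, norm_conjVec, hz] at hm
    have := norm_nonneg c
    nlinarith
  · rintro ⟨c, hc, hν⟩
    refine ⟨?_, fun X hX => ?_⟩
    · rw [hm, hν, real_inner_self_eq_norm_sq, norm_smul, norm_conjVec, hz, hc]; norm_num
    · have h4 := (mem_quadricTan_iff hz0 h hs X).1 hX
      rw [fsMetric_eq hz h, hν, inner_real_eq_re, inner_smul_left, h4]
      simp

theorem exists_eq_real_smul (hz : z ≠ 0) : ∃ (r : ℝ) (u : CVec (n + 1)), 0 < r ∧ ‖u‖ = 1 ∧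
    z = (r : ℂ) • u := by
  have h : ‖z‖ ≠ 0 := norm_ne_zero_iff.2 hz
  refine ⟨‖z‖, (‖z‖ : ℂ)⁻¹ • z, norm_pos_iff.2 hz, ?_, ?_⟩
  · simp [norm_smul, h]
  · rw [smul_smul, mul_inv_cancel₀ (by exact_mod_cast h), one_smul]

/-- Here `z` need not be a unit vector: the connection differentiates lifts in all of `ℂ^(n+2)`, so
normal fields have to be described at every point of the cone near the sphere. -/
theorem exists_liftAt_eq_smul_conjVec (hz : z ≠ 0) (h : hopf z = q) (hs : ∑ i, z i ^ 2 = 0)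
    {ν : Tan q} (hν : IsQuadricUnitNormal q ν) : ∃ c : ℂ, liftAt z ν = c • conjVec z := by
  obtain ⟨r, u, hr, hu, rfl⟩ := exists_eq_real_smul hz
  have hr0 : (r : ℂ) ≠ 0 := by exact_mod_cast hr.ne'
  have hu0 := ne_zero_of_norm_eq_one hu
  have hs' : ∑ i, u i ^ 2 = 0 := by
    simp only [PiLp.smul_apply, smul_eq_mul, mul_pow, ← Finset.mul_sum] at hs
    simpa [hr0] using hs
  rw [hopf_smul hu0 hr0] at h
  obtain ⟨c, -, hc⟩ := (isQuadricUnitNormal_iff hu h hs' ν).1 hν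
  refine ⟨c, (liftAt_smul hu0 hr0 ν).trans ?_⟩
  rw [hc, conjVec_smul, Complex.conj_ofReal, smul_comm]

theorem isQuadricUnitNormal_projAt_conjVec (hz : z ≠ 0) (h : hopf z = q)
    (hs : ∑ i, z i ^ 2 = 0) : IsQuadricUnitNormal q (projAt z (conjVec z) : CModel (n + 1)) := by
  obtain ⟨r, u, hr, hu, rfl⟩ := exists_eq_real_smul hz
  have hr0 : (r : ℂ) ≠ 0 := by exact_mod_cast hr.ne'
  have hu0 := ne_zero_of_norm_eq_one hu
  have hs' : ∑ i, u i ^ 2 = 0 := by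
    simp only [PiLp.smul_apply, smul_eq_mul, mul_pow, ← Finset.mul_sum] at hs
    simpa [hr0] using hs
  rw [hopf_smul hu0 hr0] at h
  refine (isQuadricUnitNormal_iff hu h hs' _).2 ⟨1, by simp, ?_⟩
  rw [conjVec_smul, Complex.conj_ofReal, projAt_smul hu0 hr0,
    liftAt_projAt hu0 (inner_self_conjVec hs'), one_smul]

/-- The derivative of a normal field of the cone `∑ z_i ^ 2 = 0`, in tangential directions. -/
theorem inner_fderiv_of_normal (hz : ‖z‖ = 1) (hs : ∑ i, z i ^ 2 = 0)
    {F : CVec (n + 1) → CVec (n + 1)} (hF : DifferentiableAt ℝ F z)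
    (hn : ∀ᶠ w in 𝓝 z, ∑ i, w i ^ 2 = 0 → ∃ c : ℂ, F w = c • conjVec w)
    {c : ℂ} (hc : F z = c • conjVec z) {X Y : CVec (n + 1)} (hX : inner ℂ z X = 0)
    (hX' : inner ℂ (conjVec z) X = 0) (hY : inner ℂ z Y = 0) (hY' : inner ℂ (conjVec z) Y = 0) :
    inner ℂ (fderiv ℝ F z X) Y = inner ℂ (c • conjVec X) Y := by
  set k : ℂ := inner ℂ (conjVec X) X with hk
  set l : ℂ := inner ℂ (conjVec X) Y with hl
  -- A curve with velocity `X` at `0` that stays on the cone exactly: the bilinear square of `tX` is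
  -- `t² k`, and the quadratic correction along `z̄` cancels it because the bilinear product of `z`
  -- and `z̄` is `1`.
  let γ : ℝ → CVec (n + 1) := fun t => z + t • X - (t ^ 2) • ((k / 2) • conjVec z)
  -- `Y` is corrected so that it stays orthogonal to the conjugate of `γ t`. A normal field is then
  -- orthogonal to `W` along `γ`, and differentiating that relation at `0` gives the claim.
  let W : ℝ → CVec (n + 1) := fun t => Y - t • (l • conjVec z)
  have hzz : inner ℂ z z = (1 : ℂ) := by
    rw [inner_self_eq_norm_sq_to_K, hz]; simp
  have hcc : inner ℂ (conjVec z) (conjVec z) = (1 : ℂ) := by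
    rw [inner_self_eq_norm_sq_to_K, norm_conjVec, hz]; simp
  have hzc := inner_self_conjVec hs
  have hcz : inner ℂ (conjVec z) z = 0 := by rw [inner_conjVec_self, hs]
  have hXz : inner ℂ (conjVec X) z = 0 := by rw [inner_conjVec_left_comm, hX']
  have hXc : inner ℂ (conjVec X) (conjVec z) = 0 := by rw [inner_conjVec_conjVec, hX]
  have hconj (t : ℝ) : conjVec (γ t) =
      conjVec z + (t : ℂ) • conjVec X - ((t : ℂ) ^ 2 * (starRingEnd ℂ) (k / 2)) • z := by
    have : γ t = z + (t : ℂ) • X - ((t : ℂ) ^ 2 * (k / 2)) • conjVec z := by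
      simp only [γ, ← Complex.coe_smul, smul_smul]; push_cast; rfl
    rw [this, ← conjCLM_apply, map_sub, map_add]
    simp only [conjCLM_apply, conjVec_smul, conjVec_conjVec, map_mul, map_pow, Complex.conj_ofReal]
  have hγc (t : ℝ) : ∑ i, γ t i ^ 2 = 0 := by
    rw [← inner_conjVec_self, hconj]
    have : γ t = z + (t : ℂ) • X - ((t : ℂ) ^ 2 * (k / 2)) • conjVec z := by
      simp only [γ, ← Complex.coe_smul, smul_smul]; push_cast; rfl
    rw [this]
    simp only [inner_sub_left, inner_add_left, inner_sub_right, inner_add_right, inner_smul_left,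
      inner_smul_right, hzz, hcc, hzc, hcz, hX, hX', hXz, hXc, ← hk, map_mul, map_pow,
      Complex.conj_ofReal, Complex.conj_conj]
    ring
  have hWγ (t : ℝ) : inner ℂ (conjVec (γ t)) (W t) = 0 := by
    have : W t = Y - ((t : ℂ) * l) • conjVec z := by
      simp only [W, ← Complex.coe_smul, smul_smul]
    rw [this, hconj]
    simp only [inner_sub_left, inner_add_left, inner_sub_right, inner_smul_left,
      inner_smul_right, hcc, hzc, hY, hY', hXc, ← hl, map_mul, map_pow,
      Complex.conj_ofReal, Complex.conj_conj]
    ring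
  have hγ0 : γ 0 = z := by simp [γ]
  have hγd : HasDerivAt γ X 0 := by
    have h1 : HasDerivAt (fun t : ℝ => t • X) ((1 : ℝ) • X) 0 := (hasDerivAt_id 0).smul_const X
    have h2 : HasDerivAt (fun t : ℝ => (t ^ 2) • ((k / 2) • conjVec z))
        (((2 : ℕ) * (0 : ℝ) ^ (2 - 1)) • ((k / 2) • conjVec z)) 0 :=
      (hasDerivAt_pow 2 (0 : ℝ)).smul_const _
    exact ((h1.const_add z).fun_sub h2).congr_deriv (by simp)
  have hWd : HasDerivAt W (-(l • conjVec z)) 0 := by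
    have h1 : HasDerivAt (fun t : ℝ => t • (l • conjVec z)) ((1 : ℝ) • (l • conjVec z)) 0 :=
      (hasDerivAt_id 0).smul_const _
    simpa [W] using h1.const_sub Y
  have hFd : HasDerivAt (fun t => F (γ t)) (fderiv ℝ F z X) 0 := by
    have h1 : HasFDerivAt F (fderiv ℝ F z) (γ 0) := by rw [hγ0]; exact hF.hasFDerivAt
    exact h1.comp_hasDerivAt 0 hγd
  have hI := HasDerivAt.inner ℂ hFd hWd
  have hev : (fun t => inner ℂ (F (γ t)) (W t)) =ᶠ[𝓝 0] fun _ => (0 : ℂ) := by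
    have h1 : Filter.Tendsto γ (𝓝 0) (𝓝 z) := by
      have := hγd.continuousAt.tendsto; rwa [hγ0] at this
    filter_upwards [h1.eventually hn] with t ht
    obtain ⟨d, hd⟩ := ht (hγc t)
    rw [hd, inner_smul_left, hWγ, mul_zero]
  have h0 := (hI.congr_of_eventuallyEq hev.symm).unique (hasDerivAt_const (0 : ℝ) (0 : ℂ))
  have hW0 : W 0 = Y := by simp [W]
  rw [hγ0, hc, hW0, inner_neg_right, inner_smul_left, inner_smul_right, hcc, mul_one] at h0
  rw [inner_smul_left, ← hl]
  linear_combination h0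

theorem inner_liftAt_projAt (hz : z ≠ 0) (u : CVec (n + 1)) {Y : CVec (n + 1)}
    (hY : inner ℂ z Y = 0) : inner ℂ (liftAt z (projAt z u)) Y = inner ℂ u Y := by
  obtain ⟨c, hc⟩ : ∃ c : ℂ, u - liftAt z (projAt z u) = c • z := by
    rw [← projAt_eq_zero_iff hz, map_sub, projAt_liftAt hz, sub_self]
  rw [eq_comm, ← sub_eq_zero, ← inner_sub_left, hc, inner_smul_left, hY, mul_zero]

/-- The tangential covariant derivative of a unit normal field of the quadric. -/
theorem fsMetric_fsConnection_normal (hz : ‖z‖ = 1) (h : hopf z = q) (hs : ∑ i, z i ^ 2 = 0)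
    {O : Set (CProj (n + 1))} {ζ : (x : CProj (n + 1)) → Tan x} (hO : IsOpen O) (hqO : q ∈ O)
    (hζ : ContMDiffOn 𝓘(ℝ, CModel (n + 1)) 𝓘(ℝ, CModel (n + 1)).tangent ∞
      (fun x => (⟨x, ζ x⟩ : TangentBundle 𝓘(ℝ, CModel (n + 1)) (CProj (n + 1)))) O)
    (hν : ∀ x ∈ O ∩ quadric n, IsQuadricUnitNormal x (ζ x))
    {c : ℂ} (hc : liftAt z (ζ q) = c • conjVec z) {X Y : Tan q}
    (hX : X ∈ quadricTan q) (hY : Y ∈ quadricTan q) :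
    fsMetric q (fsConnection (n + 1) ζ q X) Y =
      inner ℝ (c • conjVec (liftAt z X)) (liftAt z Y) := by
  have hz0 := ne_zero_of_norm_eq_one hz
  have hu1 := norm_unitRep q
  have hu0 := unitRep_ne_zero q
  obtain ⟨d, hd, hu⟩ := exists_unitRep_eq hz0 h
  have hdn : (starRingEnd ℂ) d * d = 1 := by
    have : ‖d‖ = 1 := by
      have := congrArg norm hu
      rw [norm_unitRep, norm_smul, hz, mul_one] at this
      exact this.symm
    rw [Complex.conj_mul', this]; simp
  have hus : ∑ i, unitRep q i ^ 2 = 0 := by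
    rw [hu]
    simp only [PiLp.smul_apply, smul_eq_mul, mul_pow, ← Finset.mul_sum, hs, mul_zero]
  have hsm (V : Tan q) : liftAt (unitRep q) V = d • liftAt z V := by
    rw [hu]; exact liftAt_smul hz0 hd V
  have hD := differentiableAt_hLift' ((hζ.contMDiffAt (hO.mem_nhds hqO)).mdifferentiableAt (by simp))
  -- Passing from `z` to `d z` multiplies lifts by `d` but conjugates by `d̄`, so with `d d̄ = 1`
  -- the coefficient of the normal changes from `c` to `d² c`.
  have hz' : hLift (unitRep q) (ζ (hopf (unitRep q))) = (d ^ 2 * c) • conjVec (unitRep q) := by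
    rw [← hLift_cast ζ]
    refine (hsm (ζ q)).trans ?_
    rw [hc, hu, conjVec_smul, smul_smul, smul_smul]
    congr 1
    linear_combination -(d * c) * hdn
  have hn : ∀ᶠ w in 𝓝 (unitRep q), ∑ i, w i ^ 2 = 0 →
      ∃ c : ℂ, hLift w (ζ (hopf w)) = c • conjVec w := by
    have h1 : ∀ᶠ w in 𝓝 (unitRep q), hopf w ∈ O := by
      apply (continuousAt_hopf hu0).eventually_mem
      rw [hopf_unitRep]
      exact hO.mem_nhds hqO
    filter_upwards [h1, isOpen_ne.mem_nhds hu0] with w hw hw0 hws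
    exact exists_liftAt_eq_smul_conjVec hw0 rfl hws (hν _ ⟨hw, w, hw0, rfl, hws⟩)
  have hXu := (mem_quadricTan_iff hu0 (hopf_unitRep q) hus X).1 hX
  have hYu := (mem_quadricTan_iff hu0 (hopf_unitRep q) hus Y).1 hY
  have key := inner_fderiv_of_normal hu1 hus hD hn hz' (inner_liftAt hu0 X) hXu
    (inner_liftAt hu0 Y) hYu
  rw [fsMetric_eq hu1 (hopf_unitRep q), inner_real_eq_re, inner_real_eq_re]
  congr 1
  rw [fsConnection_apply]
  refine (inner_liftAt_projAt hu0 _ (inner_liftAt hu0 Y)).trans (key.trans ?_)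
  rw [hsm, hsm, conjVec_smul]
  simp only [inner_smul_left, inner_smul_right, map_mul, map_pow, Complex.conj_conj]
  linear_combination (starRingEnd ℂ c * inner ℂ (conjVec (liftAt z X)) (liftAt z Y)) *
    (starRingEnd ℂ d * d + 1) * hdn

/-- The shape operators of the quadric are the conjugations `X ↦ -c X̄`. -/
theorem IsQuadricShapeOperator.liftAt_eq {ν : Tan q} {A : Tan q →ₗ[ℝ] Tan q}
    (hA : IsQuadricShapeOperator q ν A) (hz : ‖z‖ = 1) (h : hopf z = q) (hs : ∑ i, z i ^ 2 = 0)
    {c : ℂ} (hc : liftAt z ν = c • conjVec z) {X : Tan q} (hX : X ∈ quadricTan q) :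
    liftAt z (A X) = -(c • conjVec (liftAt z X)) := by
  obtain ⟨O, ζ, hO, hqO, hζ, hν, rfl, hAX⟩ := hA
  have hz0 := ne_zero_of_norm_eq_one hz
  obtain ⟨h1, h2⟩ := hAX X hX
  have hX' := (mem_quadricTan_iff hz0 h hs X).1 hX
  have h1' := (mem_quadricTan_iff hz0 h hs _).1 h1
  rw [← sub_eq_zero, sub_neg_eq_add]
  refine eq_zero_of_forall_quadricTan hz h hs ?_ ?_ fun Y hY => ?_
  · rw [inner_add_right, inner_smul_right, inner_conjVec_of_orthogonal hX',
      mul_zero, add_zero]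
    exact inner_liftAt hz0 (A X)
  · rw [inner_add_right, inner_smul_right,
      inner_conjVec_conjVec_of_orthogonal (inner_liftAt hz0 X), mul_zero, add_zero]
    exact h1'
  · have h3 := h2 Y hY
    rw [fsMetric_eq hz h, fsMetric_fsConnection_normal hz h hs hO hqO hζ hν hc hX hY] at h3
    rw [inner_add_left, h3, neg_add_cancel]

theorem IsQuadricShapeOperator.isQuadricUnitNormal {ν : Tan q} {A : Tan q →ₗ[ℝ] Tan q}
    (hA : IsQuadricShapeOperator q ν A) (hq : q ∈ quadric n) : IsQuadricUnitNormal q ν := by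
  obtain ⟨O, ζ, hO, hqO, hζ, hν, rfl, hAX⟩ := hA
  exact hν q ⟨hqO, hq⟩

/-- The section of the projection over an affine open set with value `z` at `[z]`. -/
def affSection (i : Fin (n + 2)) (z : CVec (n + 1)) (x : CProj (n + 1)) : CVec (n + 1) :=
  z i • affVec i (coord i x)

theorem affSection_ne_zero {i : Fin (n + 2)} (hz : z i ≠ 0) (x : CProj (n + 1)) :
    affSection i z x ≠ 0 := smul_ne_zero hz (affVec_ne_zero _ _)

theorem hopf_affSection {i : Fin (n + 2)} (hz : z i ≠ 0) {x : CProj (n + 1)} (hx : x ∈ affOpen i) :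
    hopf (affSection i z x) = x := by
  rw [affSection, hopf_smul (affVec_ne_zero _ _) hz, hopf_of_ne (affVec_ne_zero _ _)]
  exact (affChart i).left_inv hx

theorem affSection_hopf {i : Fin (n + 2)} (hz : z i ≠ 0) : affSection i z (hopf z) = z := by
  have h0 : z ≠ 0 := by rintro rfl; simp at hz
  rw [affSection, hopf_of_ne h0, coord_mk]
  exact smul_affVec_affCoord _ _ hz

theorem contMDiffOn_coord (i : Fin (n + 2)) :
    ContMDiffOn 𝓘(ℝ, CModel (n + 1)) 𝓘(ℝ, CModel (n + 1)) ∞ (coord i : CProj (n + 1) → _)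
      (affOpen i) :=
  contMDiffOn_of_mem_maximalAtlas (e := affChart i)
    (IsManifold.subset_maximalAtlas ⟨i, rfl⟩)

theorem contMDiffOn_affSection (i : Fin (n + 2)) (z : CVec (n + 1)) :
    ContMDiffOn 𝓘(ℝ, CModel (n + 1)) 𝓘(ℝ, CVec (n + 1)) ∞ (affSection i z) (affOpen i) := by
  have h : ContDiff ℝ ∞ fun v => z i • affVec i v := (contDiff_affVec i).const_smul (z i)
  exact h.contMDiff.comp_contMDiffOn (contMDiffOn_coord i)

/-- Moves a tangent vector between fibres over equal base points; the fibres share the same model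
space. -/
theorem totalSpace_mk_congr {x y : CProj (n + 1)} (h : x = y) (v : CModel (n + 1)) :
    (⟨x, v⟩ : TangentBundle 𝓘(ℝ, CModel (n + 1)) (CProj (n + 1))) = ⟨y, v⟩ := by
  subst h; rfl

/-- The required normal field is the projection of the conjugate of a local section of the
projection, taken through `z`; its value at `[z]` is then the prescribed normal. The operator is the
lifted map `X ↦ -X̄`. -/
theorem exists_isQuadricShapeOperator (hz : ‖z‖ = 1) (h : hopf z = q) (hs : ∑ i, z i ^ 2 = 0) :
    ∃ A : Tan q →ₗ[ℝ] Tan q,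
      IsQuadricShapeOperator q (projAt z (conjVec z) : CModel (n + 1)) A := by
  have hz0 := ne_zero_of_norm_eq_one hz
  subst h
  set i := idx (hopf z) with hi
  have hzi : z i ≠ 0 := idx_hopf hz0
  have hq : hopf z ∈ affOpen i := (exists_mem_affOpen (hopf z)).choose_spec
  let ζ : (x : CProj (n + 1)) → Tan x := fun x =>
    (projAt (affSection i z x) (conjVec (affSection i z x)) : CModel (n + 1))
  have hζz : ζ (hopf z) = (projAt z (conjVec z) : CModel (n + 1)) := by
    change (projAt (affSection i z (hopf z)) (conjVec (affSection i z (hopf z))) : CModel (n + 1)) = _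
    rw [affSection_hopf hzi]
  have hζν : ∀ x ∈ affOpen i ∩ quadric n, IsQuadricUnitNormal x (ζ x) := fun x hx => by
    have h0 := affSection_ne_zero hzi x
    have h1 := hopf_affSection hzi hx.1
    exact isQuadricUnitNormal_projAt_conjVec h0 h1
      (liftAt_mem_quadric_cone h0 (by rw [h1]; exact hx.2))
  -- `ζ` is the tangent map of `hopf` applied to the smooth field `w ↦ w̄` along the section, so its
  -- smoothness follows by composition.
  have hζs : ContMDiffOn 𝓘(ℝ, CModel (n + 1)) 𝓘(ℝ, CModel (n + 1)).tangent ∞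
      (fun x => (⟨x, ζ x⟩ : TangentBundle 𝓘(ℝ, CModel (n + 1)) (CProj (n + 1)))) (affOpen i) := by
    have ho : IsOpen {w : CVec (n + 1) | w ≠ 0} := isOpen_ne
    have h1 : ContMDiffOn 𝓘(ℝ, CVec (n + 1)) 𝓘(ℝ, CModel (n + 1)) ∞
        (hopf (m := n + 1)) {w | w ≠ 0} := fun w hw => (contMDiffAt_hopf hw).contMDiffWithinAt
    have h2 := h1.contMDiffOn_tangentMapWithin (m := ∞) (by simp) ho.uniqueMDiffOn
    have h3 : ContMDiff 𝓘(ℝ, CVec (n + 1)) 𝓘(ℝ, CVec (n + 1)).tangent ∞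
        (fun w : CVec (n + 1) => (⟨w, conjVec w⟩ : TangentBundle 𝓘(ℝ, CVec (n + 1)) (CVec (n + 1)))) :=
      contMDiff_vectorSpace_iff_contDiff.2 conjCLM.contDiff
    have h4 := h3.comp_contMDiffOn (contMDiffOn_affSection i z)
    have h5 := h2.comp h4 fun x hx => affSection_ne_zero hzi x
    refine h5.congr fun x hx => ?_
    have hx' := hopf_affSection hzi hx
    refine (totalSpace_mk_congr hx'.symm _).trans ?_
    simp only [Function.comp_apply, tangentMapWithin]
    rw [mfderivWithin_of_isOpen ho (affSection_ne_zero hzi x)]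
    rfl
  have hcz : liftAt z (ζ (hopf z)) = (1 : ℂ) • conjVec z := by
    rw [one_smul, hζz]
    exact liftAt_projAt hz0 (inner_self_conjVec hs)
  let A : CModel (n + 1) →ₗ[ℝ] CModel (n + 1) :=
    -((projAt z).toLinearMap ∘ₗ conjCLM.toLinearMap ∘ₗ liftAt z)
  refine ⟨A, affOpen i, ζ, isOpen_affOpen i, hq, hζs, hζν, hζz, fun X hX => ?_⟩
  have hX' := (mem_quadricTan_iff hz0 rfl hs X).1 hX
  have h1 : inner ℂ z (-conjVec (liftAt z X)) = 0 := by
    rw [inner_neg_right, inner_conjVec_of_orthogonal hX', neg_zero]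
  have h2 : inner ℂ (conjVec z) (-conjVec (liftAt z X)) = 0 := by
    rw [inner_neg_right, inner_conjVec_conjVec_of_orthogonal (inner_liftAt hz0 X), neg_zero]
  have hAX : A X = projAt z (-conjVec (liftAt z X)) := by rw [map_neg]; rfl
  have hAX' : liftAt z (A X) = -conjVec (liftAt z X) := by
    rw [hAX]; exact liftAt_projAt hz0 h1
  refine ⟨?_, fun Y hY => ?_⟩
  · have := projAt_mem_quadricTan hz0 rfl hs h1 h2
    rw [← hAX] at this
    exact this
  · refine (fsMetric_eq hz rfl _ _).trans ?_
    rw [fsMetric_fsConnection_normal hz rfl hs (isOpen_affOpen i) hq hζs hζν hcz hX hY]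
    rw [one_smul, ← inner_neg_left]
    exact congrArg (fun u => inner ℝ u (liftAt z Y)) hAX'

end CProj

/-! ### Differentials of vector-valued maps, read in a chart -/

section Charts

variable {n : ℕ} {M : Type*} [TopologicalSpace M] [ChartedSpace (EuclideanSpace ℝ (Fin n)) M]
  {V : Type*}

/-- The expression of a map in the preferred chart at `p`. -/
def chartRep (p : M) (F : M → V) : EuclideanSpace ℝ (Fin n) → V :=
  F ∘ (extChartAt (𝓡 n) p).symm

theorem chartRep_self (p : M) (F : M → V) : chartRep p F (extChartAt (𝓡 n) p p) = F p := by
  simp [chartRep]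

variable [NormedAddCommGroup V] [NormedSpace ℝ V]

/-- The differential of a vector-valued map, with values in the vector space itself. -/
def vDeriv (n : ℕ) {M : Type*} [TopologicalSpace M]
    [ChartedSpace (EuclideanSpace ℝ (Fin n)) M] (F : M → V) (p : M) :
    EuclideanSpace ℝ (Fin n) →L[ℝ] V :=
  mfderiv (𝓡 n) 𝓘(ℝ, V) F p

/-- At the centre of the preferred chart the manifold differential is by definition the derivative
of the chart expression. This reduces product rules on the manifold to ordinary calculus. -/
theorem hasFDerivAt_chartRep {F : M → V} {p : M} (hF : MDifferentiableAt (𝓡 n) 𝓘(ℝ, V) F p) :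
    HasFDerivAt (chartRep p F) (vDeriv n F p) (extChartAt (𝓡 n) p p) := by
  have h := hF.hasMFDerivAt.2
  rw [writtenInExtChartAt, extChartAt_model_space_eq_id] at h
  rw [modelWithCornersSelf_coe, Set.range_id] at h
  exact hasFDerivWithinAt_univ.1 h

theorem contDiffAt_chartRep {F : M → V} {p : M} (hF : ContMDiffAt (𝓡 n) 𝓘(ℝ, V) ∞ F p) :
    ContDiffAt ℝ ∞ (chartRep p F) (extChartAt (𝓡 n) p p) := by
  have h := (contMDiffAt_iff.1 hF).2
  rw [extChartAt_model_space_eq_id] at h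
  simpa [contDiffWithinAt_univ, chartRep] using h

theorem eventually_chart_symm_mem {U : Set M} (hU : IsOpen U) {p : M} (hp : p ∈ U) :
    ∀ᶠ x in 𝓝 (extChartAt (𝓡 n) p p), (extChartAt (𝓡 n) p).symm x ∈ U := by
  apply (continuousAt_extChartAt_symm p).eventually_mem
  rw [extChartAt_to_inv]
  exact hU.mem_nhds hp

theorem eventually_mem_chart_target (p : M) :
    ∀ᶠ x in 𝓝 (extChartAt (𝓡 n) p p), x ∈ (extChartAt (𝓡 n) p).target :=
  extChartAt_target_mem_nhds p

theorem vDeriv_clm_comp {W : Type*} [NormedAddCommGroup W] [NormedSpace ℝ W] (L : V →L[ℝ] W)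
    {F : M → V} {p : M} (hF : MDifferentiableAt (𝓡 n) 𝓘(ℝ, V) F p) :
    vDeriv n (fun x => L (F x)) p = L.comp (vDeriv n F p) :=
  (L.hasFDerivAt.hasMFDerivAt.comp p hF.hasMFDerivAt).mfderiv

variable [IsManifold (𝓡 n) ∞ M]

theorem mdifferentiableAt_extChartAt_symm {p : M} {x : EuclideanSpace ℝ (Fin n)}
    (hx : x ∈ (extChartAt (𝓡 n) p).target) :
    MDifferentiableAt 𝓘(ℝ, EuclideanSpace ℝ (Fin n)) (𝓡 n) (extChartAt (𝓡 n) p).symm x := by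
  have : IsManifold (𝓡 n) 1 M := IsManifold.of_le (n := ∞) (by simp)
  have := mdifferentiableWithinAt_extChartAt_symm hx
  rwa [modelWithCornersSelf_coe, Set.range_id, mdifferentiableWithinAt_univ] at this

/-- The differential of the inverse of the preferred chart at `p`. -/
def chartSymmDeriv (p : M) (x : EuclideanSpace ℝ (Fin n)) :
    EuclideanSpace ℝ (Fin n) →L[ℝ] EuclideanSpace ℝ (Fin n) :=
  mfderiv 𝓘(ℝ, EuclideanSpace ℝ (Fin n)) (𝓡 n) (extChartAt (𝓡 n) p).symm x

/-- Away from the centre the derivative of the chart expression is the differential up to a change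
of coordinates on the source. Identities valid for all tangent vectors therefore hold on a whole
neighbourhood in the chart and may be differentiated again. -/
theorem fderiv_chartRep {F : M → V} {p : M} {x : EuclideanSpace ℝ (Fin n)}
    (hx : x ∈ (extChartAt (𝓡 n) p).target)
    (hF : MDifferentiableAt (𝓡 n) 𝓘(ℝ, V) F ((extChartAt (𝓡 n) p).symm x)) :
    fderiv ℝ (chartRep p F) x =
      (vDeriv n F ((extChartAt (𝓡 n) p).symm x)).comp (chartSymmDeriv p x) := by
  have h := hF.hasMFDerivAt.comp x (mdifferentiableAt_extChartAt_symm hx).hasMFDerivAt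
  exact mfderiv_eq_fderiv.symm.trans h.mfderiv

theorem hasMFDerivAt_of_chartRep {F : M → V} {p p' : M} (hp : p' ∈ (extChartAt (𝓡 n) p).source)
    (hF : DifferentiableAt ℝ (chartRep p F) (extChartAt (𝓡 n) p p')) :
    HasMFDerivAt (𝓡 n) 𝓘(ℝ, V) F p' ((fderiv ℝ (chartRep p F) (extChartAt (𝓡 n) p p')).comp
      (vDeriv n (extChartAt (𝓡 n) p) p')) := by
  have : IsManifold (𝓡 n) 1 M := IsManifold.of_le (n := ∞) (by simp)
  have h := hF.hasFDerivAt.hasMFDerivAt.comp p'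
    (mdifferentiableAt_extChartAt (by simpa using hp)).hasMFDerivAt
  refine h.congr_of_eventuallyEq ?_
  filter_upwards [(isOpen_extChartAt_source (I := 𝓡 n) p).mem_nhds hp] with y hy
  simp only [Function.comp_apply, chartRep]
  rw [(extChartAt (𝓡 n) p).left_inv hy]

/-- Injective linear maps form an open set and the derivative is continuous in a chart; the
differential of the chart itself is invertible. -/
theorem eventually_injective_vDeriv [FiniteDimensional ℝ V] {F : M → V} {U : Set M}
    (hU : IsOpen U) (hF : ContMDiffOn (𝓡 n) 𝓘(ℝ, V) ∞ F U) {p : M} (hp : p ∈ U)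
    (h : Function.Injective (vDeriv n F p)) :
    ∀ᶠ y in 𝓝 p, Function.Injective (vDeriv n F y) := by
  have : IsManifold (𝓡 n) 1 M := IsManifold.of_le (n := ∞) (by simp)
  have hFp := hF.contMDiffAt (hU.mem_nhds hp)
  have h1 := contDiffAt_chartRep hFp
  have h2 := hasFDerivAt_chartRep (hFp.mdifferentiableAt (by simp))
  have hc : ContinuousAt (fderiv ℝ (chartRep p F)) (extChartAt (𝓡 n) p p) :=
    (h1.fderiv_right (m := 0) (by simp)).continuousAt
  have h3 : ∀ᶠ x in 𝓝 (extChartAt (𝓡 n) p p),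
      Function.Injective (fderiv ℝ (chartRep p F) x) := by
    refine hc.eventually_mem (ContinuousLinearMap.isOpen_injective.mem_nhds ?_)
    rw [h2.fderiv]
    exact h
  have h4 : ∀ᶠ x in 𝓝 (extChartAt (𝓡 n) p p), DifferentiableAt ℝ (chartRep p F) x := by
    filter_upwards [(h1.of_le (m := 1) (by simp)).eventually (by simp)] with x hx
    exact hx.differentiableAt (by simp)
  have h5 := (continuousAt_extChartAt (I := 𝓡 n) p).eventually (h3.and h4)
  filter_upwards [h5, (isOpen_extChartAt_source (I := 𝓡 n) p).mem_nhds (mem_extChartAt_source p)]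
    with y hy hys
  have h6 : vDeriv n F y = (fderiv ℝ (chartRep p F) (extChartAt (𝓡 n) p y)).comp
      (vDeriv n (extChartAt (𝓡 n) p) y) := (hasMFDerivAt_of_chartRep hys hy.2).mfderiv
  rw [h6]
  refine hy.1.comp ?_
  exact (isInvertible_mfderiv_extChartAt (I := 𝓡 n) hys).injective

end Charts

/-! ### Linear algebra of Legendrian pairs -/

/-- Two orthonormal vectors `x`, `y` and two linear maps `A`, `B` into their orthogonal complement,
such that `v ↦ A v + i B v` is injective with Lagrangian image. -/
structure LegendrianPair {n : ℕ} (x y : EuclideanSpace ℝ (Fin (n + 2)))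
    (A B : EuclideanSpace ℝ (Fin n) →L[ℝ] EuclideanSpace ℝ (Fin (n + 2))) : Prop where
  norm_left : ‖x‖ = 1
  norm_right : ‖y‖ = 1
  inner_eq : inner ℝ x y = 0
  left_x : ∀ v, inner ℝ (A v) x = 0
  left_y : ∀ v, inner ℝ (A v) y = 0
  right_x : ∀ v, inner ℝ (B v) x = 0
  right_y : ∀ v, inner ℝ (B v) y = 0
  symm : ∀ v w, inner ℝ (A v) (B w) = inner ℝ (A w) (B v)
  ker : ∀ v, A v = 0 → B v = 0 → v = 0

namespace LegendrianPair

variable {n : ℕ} {x y : EuclideanSpace ℝ (Fin (n + 2))}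
    {A B : EuclideanSpace ℝ (Fin n) →L[ℝ] EuclideanSpace ℝ (Fin (n + 2))}

theorem swap (h : LegendrianPair x y A B) : LegendrianPair y x B A where
  norm_left := h.norm_right
  norm_right := h.norm_left
  inner_eq := by rw [real_inner_comm, h.inner_eq]
  left_x := h.right_y
  left_y := h.right_x
  right_x := h.left_y
  right_y := h.left_x
  symm v w := by rw [real_inner_comm, ← h.symm, real_inner_comm]
  ker v h1 h2 := h.ker v h2 h1

theorem inner_self_left (h : LegendrianPair x y A B) : inner ℝ x x = (1 : ℝ) := by
  rw [real_inner_self_eq_norm_sq, h.norm_left, one_pow]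

/-- The rotation multiplies `x + i y` and `A + i B` by one unit complex number, so orthogonality and
the Lagrangian condition persist. Inverting the rotation recovers `A v` and `B v`, which gives the
kernel condition. -/
theorem rotate (h : LegendrianPair x y A B) {c s : ℝ} (hcs : c ^ 2 + s ^ 2 = 1) :
    LegendrianPair (c • x + s • y) (-(s • x) + c • y) (c • A + s • B) (-(s • A) + c • B) := by
  have h1 := h.inner_self_left
  have h2 := h.swap.inner_self_left
  have h3 := h.inner_eq
  have h4 := h.swap.inner_eq
  refine ⟨?_, ?_, ?_, fun v => ?_, fun v => ?_, fun v => ?_, fun v => ?_, fun v w => ?_,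
    fun v hv hv' => ?_⟩
  · rw [← sq_eq_sq₀ (norm_nonneg _) zero_le_one, ← real_inner_self_eq_norm_sq]
    simp only [inner_add_left, inner_add_right, inner_smul_left, inner_smul_right, h1, h2, h3, h4,
      conj_trivial]
    linear_combination hcs
  · rw [← sq_eq_sq₀ (norm_nonneg _) zero_le_one, ← real_inner_self_eq_norm_sq]
    simp only [inner_add_left, inner_add_right, inner_smul_left, inner_smul_right, h1, h2, h3, h4,
      conj_trivial, inner_neg_left, inner_neg_right]
    linear_combination hcs
  · simp only [inner_add_left, inner_add_right, inner_smul_left, inner_smul_right, h1, h2, h3, h4,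
      conj_trivial, inner_neg_right]
    ring
  iterate 4
    simp only [add_apply, neg_apply, smul_apply, inner_add_left, inner_add_right, inner_neg_left,
      inner_neg_right, inner_smul_left, inner_smul_right, h.left_x, h.left_y, h.right_x, h.right_y]
    ring
  · have h5 := h.symm v w
    have h6 : inner ℝ (B v) (A w) = inner ℝ (B w) (A v) := h.swap.symm v w
    have h7 := real_inner_comm (A v) (A w)
    have h8 := real_inner_comm (B v) (B w)
    simp only [add_apply, neg_apply, smul_apply, inner_add_left, inner_add_right,
      inner_neg_right, inner_smul_left, inner_smul_right, conj_trivial]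
    linear_combination c ^ 2 * h5 - s ^ 2 * h6 + s * c * h7 - s * c * h8
  · simp only [add_apply, neg_apply, smul_apply] at hv hv'
    refine h.ker v ?_ ?_
    · have : A v = (c ^ 2 + s ^ 2) • A v := by rw [hcs, one_smul]
      rw [this, show (c ^ 2 + s ^ 2) • A v = c • (c • A v + s • B v) - s • (-(s • A v) + c • B v) by
        module, hv, hv']
      simp
    · have : B v = (c ^ 2 + s ^ 2) • B v := by rw [hcs, one_smul]
      rw [this, show (c ^ 2 + s ^ 2) • B v = s • (c • A v + s • B v) + c • (-(s • A v) + c • B v) by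
        module, hv, hv']
      simp

/-- A dimension count: the range of `A`, of dimension `n`, together with the orthonormal vectors `x`
and `y` orthogonal to it fills `ℝ^(n+2)`. -/
theorem exists_apply_eq (h : LegendrianPair x y A B) (hA : Function.Injective A)
    {u : EuclideanSpace ℝ (Fin (n + 2))} (hx : inner ℝ u x = 0) (hy : inner ℝ u y = 0) :
    ∃ v, A v = u := by
  let L : (EuclideanSpace ℝ (Fin n) × ℝ × ℝ) →ₗ[ℝ] EuclideanSpace ℝ (Fin (n + 2)) :=
    A.toLinearMap.coprod ((LinearMap.toSpanSingleton ℝ _ x).coprod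
      (LinearMap.toSpanSingleton ℝ _ y))
  have hL (p : EuclideanSpace ℝ (Fin n) × ℝ × ℝ) : L p = A p.1 + (p.2.1 • x + p.2.2 • y) := rfl
  have hLx (p) : inner ℝ (L p) x = p.2.1 := by
    simp [hL, inner_add_left, inner_smul_left, h.left_x, h.norm_left, h.swap.inner_eq]
  have hLy (p) : inner ℝ (L p) y = p.2.2 := by
    simp [hL, inner_add_left, inner_smul_left, h.left_y, h.norm_right, h.inner_eq]
  have hinj : Function.Injective L := by
    rw [← LinearMap.ker_eq_bot, LinearMap.ker_eq_bot']
    intro p hp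
    have h1 : p.2.1 = 0 := by rw [← hLx, hp, inner_zero_left]
    have h2 : p.2.2 = 0 := by rw [← hLy, hp, inner_zero_left]
    have h3 : A p.1 = A 0 := by
      rw [hL, h1, h2] at hp
      simpa using hp
    exact Prod.ext (hA h3) (Prod.ext h1 h2)
  have hdim : Module.finrank ℝ (EuclideanSpace ℝ (Fin n) × ℝ × ℝ) =
      Module.finrank ℝ (EuclideanSpace ℝ (Fin (n + 2))) := by simp
  obtain ⟨p, rfl⟩ := (LinearMap.injective_iff_surjective_of_finrank_eq_finrank hdim).1 hinj u
  rw [hLx] at hx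
  rw [hLy] at hy
  exact ⟨p.1, by simp [hL, hx, hy]⟩

/-- `A + s B` is singular for only finitely many `s`. -/
theorem finite_singular (h : LegendrianPair x y A B) :
    {s : ℝ | ∃ v, v ≠ 0 ∧ A v + s • B v = 0}.Finite := by
  set S := {s : ℝ | ∃ v, v ≠ 0 ∧ A v + s • B v = 0} with hS
  choose v hv0 hv using fun s : S => s.2
  have hA (s : S) : A (v s) = -((s : ℝ) • B (v s)) := eq_neg_of_add_eq_zero_left (hv s)
  have h0 (s : S) : B (v s) ≠ 0 := fun hB => hv0 s (h.ker _ (by rw [hA, hB]; simp) hB)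
  -- Kernel vectors for different parameters behave like eigenvectors of a symmetric operator:
  -- `symm` makes their images under `B` orthogonal. There can thus be only finitely many.
  have hli : LinearIndependent ℝ fun s : S => B (v s) := by
    refine linearIndependent_of_ne_zero_of_inner_eq_zero h0 fun s t hst => ?_
    have h1 := h.symm (v s) (v t)
    rw [hA, hA, inner_neg_left, inner_neg_left, inner_smul_left, inner_smul_left,
      real_inner_comm (B (v s)) (B (v t))] at h1
    have h2 : ((s : ℝ) - t) * inner ℝ (B (v s)) (B (v t)) = 0 := by
      simp only [conj_trivial] at h1
      linear_combination -h1
    exact (mul_eq_zero.1 h2).resolve_left fun h3 => hst (Subtype.ext (sub_eq_zero.1 h3))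
  have := hli.finite
  exact Set.toFinite S

theorem finite_curvatures (h : LegendrianPair x y A B) :
    {c : ℝ | ∃ v, v ≠ 0 ∧ B v = -(c • A v)}.Finite := by
  refine h.swap.finite_singular.subset ?_
  rintro c ⟨v, hv, hc⟩
  exact ⟨v, hv, by rw [hc, neg_add_cancel]⟩

/-- The map `B A⁻¹` is a symmetric operator on the range of `A`, by `symm`, and has a real
eigenvalue since `n ≥ 1`. The sign convention makes the curvature minus the eigenvalue. -/
theorem exists_curvature (hn : 1 ≤ n) (h : LegendrianPair x y A B) (hA : Function.Injective A) :
    ∃ (c : ℝ) (v : _), v ≠ 0 ∧ B v = -(c • A v) := by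
  have hB (v) : B v ∈ LinearMap.range A.toLinearMap :=
    h.exists_apply_eq hA (h.right_x v) (h.right_y v)
  let e := LinearEquiv.ofInjective A.toLinearMap hA
  let T : LinearMap.range A.toLinearMap →ₗ[ℝ] LinearMap.range A.toLinearMap :=
    (B.toLinearMap.codRestrict _ hB) ∘ₗ e.symm.toLinearMap
  have hT (v) : (T (e v) : EuclideanSpace ℝ (Fin (n + 2))) = B v := by
    simp [T]
  have he (v) : (e v : EuclideanSpace ℝ (Fin (n + 2))) = A v := rfl
  have hsymm : T.IsSymmetric := by
    intro u w
    obtain ⟨u, rfl⟩ := e.surjective u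
    obtain ⟨w, rfl⟩ := e.surjective w
    rw [Submodule.coe_inner, Submodule.coe_inner, hT, hT, he, he, real_inner_comm, h.symm]
  have : Nonempty (Fin n) := ⟨⟨0, hn⟩⟩
  have : Nontrivial (LinearMap.range A.toLinearMap) := e.symm.toEquiv.nontrivial
  obtain ⟨c, u, hu⟩ : ∃ (c : ℝ) (u : _), Module.End.HasEigenvector T c u :=
    ⟨_, hsymm.hasEigenvalue_iSup_of_finiteDimensional.exists_hasEigenvector⟩
  obtain ⟨v, rfl⟩ := e.surjective u
  refine ⟨-c, v, ?_, ?_⟩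
  · rintro rfl
    exact hu.2 (map_zero e)
  · have := congrArg (Subtype.val) hu.apply_eq_smul
    rw [hT, Submodule.coe_smul, he] at this
    rw [this, neg_smul, neg_neg]

end LegendrianPair

namespace LegendrianPair

variable {n : ℕ} {x y : EuclideanSpace ℝ (Fin (n + 2))}
    {A B : EuclideanSpace ℝ (Fin n) →L[ℝ] EuclideanSpace ℝ (Fin (n + 2))}

/-- Rotation angles are taken as `arctan s`: their cosine is positive, so rotating amounts, up to a
nonzero factor, to passing to a member of the pencil `u + s v`. -/
theorem cos_smul_add_sin_smul_arctan {V : Type*} [AddCommGroup V] [Module ℝ V] (s : ℝ) (u v : V) :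
    Real.cos (Real.arctan s) • u + Real.sin (Real.arctan s) • v =
      Real.cos (Real.arctan s) • (u + s • v) := by
  have h : Real.sin (Real.arctan s) = Real.cos (Real.arctan s) * s := by
    conv_rhs => rw [← Real.tan_arctan s]
    rw [mul_comm]
    rw [Real.tan_arctan, ← Real.tan_mul_cos (Real.cos_arctan_pos s).ne', Real.tan_arctan]
  rw [h, smul_add, smul_smul]

theorem injective_rotate_of_notMem {s : ℝ} (hs : s ∉ {s : ℝ | ∃ v, v ≠ 0 ∧ A v + s • B v = 0}) :
    Function.Injective (Real.cos (Real.arctan s) • A + Real.sin (Real.arctan s) • B) := by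
  rw [injective_iff_map_eq_zero]
  intro v hv
  rw [add_apply, smul_apply, smul_apply, cos_smul_add_sin_smul_arctan, smul_eq_zero] at hv
  by_contra h0
  exact hs ⟨v, h0, hv.resolve_left (Real.cos_arctan_pos s).ne'⟩

theorem exists_injective_rotate (h : LegendrianPair x y A B) :
    ∃ t : ℝ, Function.Injective (Real.cos t • A + Real.sin t • B) := by
  obtain ⟨s, hs⟩ := h.finite_singular.infinite_compl.nonempty
  exact ⟨Real.arctan s, injective_rotate_of_notMem hs⟩

/-- A principal vector stays principal after rotation, while its curvature `l` changes by the
tangent addition formula to `(s + l) / (1 - s l)`. For a given old curvature only one `s` could take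
`l` there, and old curvatures are finite in number; so almost every rotation produces a new
curvature. -/
theorem exists_rotate_ne (hn : 1 ≤ n) (h : LegendrianPair x y A B) (hA : Function.Injective A) :
    ∃ t : ℝ, Function.Injective (Real.cos t • A + Real.sin t • B) ∧
      Real.cos t • x + Real.sin t • y ≠ x ∧
      {c : ℝ | ∃ v, v ≠ 0 ∧ (-(Real.sin t • A) + Real.cos t • B) v =
        -(c • (Real.cos t • A + Real.sin t • B) v)} ≠
      {c : ℝ | ∃ v, v ≠ 0 ∧ B v = -(c • A v)} := by
  obtain ⟨l, v, hv0, hv⟩ := h.exists_curvature hn hA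
  -- The values of `s` to avoid: those where the rotated `A` is singular, `0` (which would keep
  -- `x`), and the solutions of `(s + l) / (1 - s l) = c` for the old curvatures `c`. When `1 + c l
  -- = 0` there is no solution, and the value `0` of the quotient only excludes `0` once more.
  have hfin := (h.finite_singular.union (Set.finite_singleton 0)).union
    (h.finite_curvatures.image fun c => (c - l) / (1 + c * l))
  obtain ⟨s, hs⟩ := hfin.infinite_compl.nonempty
  simp only [Set.mem_compl_iff, Set.mem_union, not_or] at hs
  obtain ⟨⟨hs1, hs2⟩, hs3⟩ := hs
  have hinj := injective_rotate_of_notMem hs1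
  set t := Real.arctan s with ht
  have hcos : Real.cos t ≠ 0 := (Real.cos_arctan_pos s).ne'
  have hsin : Real.sin t = s * Real.cos t := by
    rw [← Real.tan_mul_cos hcos, ht, Real.tan_arctan]
  refine ⟨t, hinj, fun hx => ?_, fun hC => ?_⟩
  · have h1 := congrArg (fun u => inner ℝ u y) hx
    simp only [inner_add_left, inner_smul_left, h.inner_eq, h.swap.inner_self_left,
      conj_trivial] at h1
    rw [hsin] at h1
    have : s * Real.cos t = 0 := by linear_combination h1
    exact hs2 ((mul_eq_zero.1 this).resolve_right hcos)
  · have hAv : (Real.cos t • A + Real.sin t • B) v = (Real.cos t * (1 - s * l)) • A v := by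
      rw [add_apply, smul_apply, smul_apply, hv, hsin]; module
    -- Otherwise the rotated `A` would kill `v`, against its injectivity.
    have hls : 1 - s * l ≠ 0 := by
      intro h0
      rw [h0, mul_zero, zero_smul, ← map_zero (Real.cos t • A + Real.sin t • B)] at hAv
      exact hv0 (hinj hAv)
    have hmem : (s + l) / (1 - s * l) ∈ {c : ℝ | ∃ v, v ≠ 0 ∧ B v = -(c • A v)} := by
      rw [← hC]
      refine ⟨v, hv0, ?_⟩
      rw [hAv, smul_smul, show (s + l) / (1 - s * l) * (Real.cos t * (1 - s * l)) =
        Real.cos t * (s + l) by field_simp]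
      rw [add_apply, neg_apply, smul_apply, smul_apply, hv, hsin]
      module
    refine hs3 ⟨_, hmem, ?_⟩
    have h1 : 1 - s * l + (s + l) * l ≠ 0 := by
      have : 1 - s * l + (s + l) * l = 1 + l ^ 2 := by ring
      rw [this]; positivity
    have h2 : 1 + (s + l) / (1 - s * l) * l = (1 - s * l + (s + l) * l) / (1 - s * l) := by
      field_simp
    simp only []
    rw [h2, div_eq_iff (div_ne_zero h1 hls)]
    field_simp
    ring

end LegendrianPair

/-! ### Fronts: hypersurfaces with normal that may fail to be immersed -/

section Fronts

variable {n : ℕ} {M : Type*} [TopologicalSpace M] [ChartedSpace (EuclideanSpace ℝ (Fin n)) M]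

theorem inner_vDeriv_of_const (𝕜 : Type*) [RCLike 𝕜] {V : Type*} [NormedAddCommGroup V]
    [InnerProductSpace 𝕜 V] [NormedSpace ℝ V] {F G : M → V} {p : M} {c : 𝕜}
    (hF : MDifferentiableAt (𝓡 n) 𝓘(ℝ, V) F p) (hG : MDifferentiableAt (𝓡 n) 𝓘(ℝ, V) G p)
    (h : ∀ᶠ q in 𝓝 p, inner 𝕜 (F q) (G q) = c) (v : EuclideanSpace ℝ (Fin n)) :
    inner 𝕜 (F p) (vDeriv n G p v) + inner 𝕜 (vDeriv n F p v) (G p) = 0 := by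
  have h1 := (hasFDerivAt_chartRep hF).inner 𝕜 (hasFDerivAt_chartRep hG)
  have h2 : (fun x => inner 𝕜 (chartRep p F x) (chartRep p G x)) =ᶠ[𝓝 (extChartAt (𝓡 n) p p)]
      fun _ => c := by
    have hc := (continuousAt_extChartAt_symm (I := 𝓡 n) p).tendsto
    rw [extChartAt_to_inv] at hc
    exact hc.eventually h
  have h3 := (h1.congr_of_eventuallyEq h2.symm).unique (hasFDerivAt_const c _)
  have h4 := congrArg (fun L : EuclideanSpace ℝ (Fin n) →L[ℝ] 𝕜 => L v) h3
  simp only [chartRep_self] at h4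
  simpa [fderivInnerCLM_apply] using h4

/-- A pair of maps which is pointwise, together with the differentials, a Legendrian pair. -/
structure IsFront (U : Set M) (a b : M → EuclideanSpace ℝ (Fin (n + 2))) : Prop where
  smooth : ContMDiffOn (𝓡 n) 𝓘(ℝ, EuclideanSpace ℝ (Fin (n + 2))) ∞ a U
  smooth_normal : ContMDiffOn (𝓡 n) 𝓘(ℝ, EuclideanSpace ℝ (Fin (n + 2))) ∞ b U
  pair : ∀ p ∈ U, LegendrianPair (a p) (b p) (vDeriv n a p) (vDeriv n b p)

variable {U : Set M} {a b : M → EuclideanSpace ℝ (Fin (n + 2))}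

theorem mdifferentiableAt_of_contMDiffOn {V : Type*} [NormedAddCommGroup V] [NormedSpace ℝ V]
    {F : M → V} (hF : ContMDiffOn (𝓡 n) 𝓘(ℝ, V) ∞ F U) (hU : IsOpen U) {p : M} (hp : p ∈ U) :
    MDifferentiableAt (𝓡 n) 𝓘(ℝ, V) F p :=
  (hF.contMDiffAt (hU.mem_nhds hp)).mdifferentiableAt (by simp)

theorem contMDiffOn_smul_add_smul
    (ha : ContMDiffOn (𝓡 n) 𝓘(ℝ, EuclideanSpace ℝ (Fin (n + 2))) ∞ a U)
    (hb : ContMDiffOn (𝓡 n) 𝓘(ℝ, EuclideanSpace ℝ (Fin (n + 2))) ∞ b U) (c s : ℝ) :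
    ContMDiffOn (𝓡 n) 𝓘(ℝ, EuclideanSpace ℝ (Fin (n + 2))) ∞ (fun x => c • a x + s • b x) U :=
  (c • ContinuousLinearMap.fst ℝ (EuclideanSpace ℝ (Fin (n + 2))) (EuclideanSpace ℝ (Fin (n + 2)))
    + s • ContinuousLinearMap.snd ℝ (EuclideanSpace ℝ (Fin (n + 2)))
      (EuclideanSpace ℝ (Fin (n + 2)))).contDiff.contMDiff.comp_contMDiffOn (ha.prodMk_space hb)

theorem vDeriv_smul_add_smul (hU : IsOpen U)
    (ha : ContMDiffOn (𝓡 n) 𝓘(ℝ, EuclideanSpace ℝ (Fin (n + 2))) ∞ a U)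
    (hb : ContMDiffOn (𝓡 n) 𝓘(ℝ, EuclideanSpace ℝ (Fin (n + 2))) ∞ b U) {p : M} (hp : p ∈ U)
    (c s : ℝ) :
    vDeriv n (fun x => c • a x + s • b x) p = c • vDeriv n a p + s • vDeriv n b p := by
  have h1 := hasFDerivAt_chartRep (mdifferentiableAt_of_contMDiffOn ha hU hp)
  have h2 := hasFDerivAt_chartRep (mdifferentiableAt_of_contMDiffOn hb hU hp)
  have h3 : ContMDiffOn (𝓡 n) 𝓘(ℝ, EuclideanSpace ℝ (Fin (n + 2))) ∞
      (fun x => c • a x + s • b x) U := contMDiffOn_smul_add_smul ha hb c s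
  exact (hasFDerivAt_chartRep (mdifferentiableAt_of_contMDiffOn h3 hU hp)).unique
    ((h1.const_smul c).add (h2.const_smul s))

theorem IsFront.rotate (h : IsFront U a b) (hU : IsOpen U) (t : ℝ) :
    IsFront U (fun x => Real.cos t • a x + Real.sin t • b x)
      (fun x => -(Real.sin t • a x) + Real.cos t • b x) := by
  have e : (fun x => -(Real.sin t • a x) + Real.cos t • b x) =
      fun x => (-Real.sin t) • a x + Real.cos t • b x := by simp only [neg_smul]
  rw [e]
  refine ⟨contMDiffOn_smul_add_smul h.smooth h.smooth_normal _ _,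
    contMDiffOn_smul_add_smul h.smooth h.smooth_normal _ _, fun p hp => ?_⟩
  have h1 := (h.pair p hp).rotate (Real.cos_sq_add_sin_sq t)
  have e2 : (-Real.sin t) • vDeriv n a p = -(Real.sin t • vDeriv n a p) := by ext; simp
  rw [← neg_smul, ← e2] at h1
  rw [vDeriv_smul_add_smul hU h.smooth h.smooth_normal hp,
    vDeriv_smul_add_smul hU h.smooth h.smooth_normal hp]
  exact h1

theorem IsFront.isSphereHypersurface (h : IsFront U a b)
    (hinj : ∀ p ∈ U, Function.Injective (vDeriv n a p)) : IsSphereHypersurface U a b where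
  smooth := h.smooth
  smooth_normal := h.smooth_normal
  norm_eq p hp := (h.pair p hp).norm_left
  injective := hinj
  norm_normal p hp := (h.pair p hp).norm_right
  inner_eq p hp := (h.pair p hp).inner_eq
  inner_tangent p hp v := (h.pair p hp).left_y v

theorem IsFront.mono {U' : Set M} (h : IsFront U a b) (hU : U' ⊆ U) : IsFront U' a b where
  smooth := h.smooth.mono hU
  smooth_normal := h.smooth_normal.mono hU
  pair p hp := h.pair p (hU hp)

theorem inner_vDeriv_self (hU : IsOpen U)
    (ha : ContMDiffOn (𝓡 n) 𝓘(ℝ, EuclideanSpace ℝ (Fin (n + 2))) ∞ a U) (h : ∀ p ∈ U, ‖a p‖ = 1)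
    {p : M} (hp : p ∈ U) (v : EuclideanSpace ℝ (Fin n)) : inner ℝ (vDeriv n a p v) (a p) = 0 := by
  have h1 := mdifferentiableAt_of_contMDiffOn ha hU hp
  have h2 : ∀ᶠ q in 𝓝 p, inner ℝ (a q) (a q) = (1 : ℝ) := by
    filter_upwards [hU.mem_nhds hp] with q hq
    rw [real_inner_self_eq_norm_sq, h q hq, one_pow]
  have h3 := inner_vDeriv_of_const ℝ h1 h1 h2 v
  rw [real_inner_comm] at h3
  linarith

theorem IsSphereHypersurface.injective_vDeriv (h : IsSphereHypersurface U a b) {p : M}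
    (hp : p ∈ U) : Function.Injective (vDeriv n a p) := h.injective p hp

/-- The substantial point is the symmetry of the second fundamental form: differentiating `⟨da v, b⟩
= 0` identifies `⟨da v, db w⟩` with minus the normal component of the second derivative of `a`,
which is symmetric. -/
theorem IsSphereHypersurface.isFront [IsManifold (𝓡 n) ∞ M] (h : IsSphereHypersurface U a b)
    (hU : IsOpen U) : IsFront U a b where
  smooth := h.smooth
  smooth_normal := h.smooth_normal
  pair p hp := by
    have h1 := mdifferentiableAt_of_contMDiffOn h.smooth hU hp
    have h2 := mdifferentiableAt_of_contMDiffOn h.smooth_normal hU hp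
    have h3 : ∀ v, inner ℝ (vDeriv n a p v) (b p) = 0 := h.inner_tangent p hp
    refine ⟨h.norm_eq p hp, h.norm_normal p hp, h.inner_eq p hp,
      fun v => inner_vDeriv_self hU h.smooth h.norm_eq hp v, h3, fun v => ?_,
      fun v => inner_vDeriv_self hU h.smooth_normal h.norm_normal hp v, fun v w => ?_,
      fun v hv _ => h.injective p hp ?_⟩
    · have h4 : ∀ᶠ q in 𝓝 p, inner ℝ (a q) (b q) = (0 : ℝ) := by
        filter_upwards [hU.mem_nhds hp] with q hq using h.inner_eq q hq
      have h5 := inner_vDeriv_of_const ℝ h1 h2 h4 v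
      rw [h3, add_zero, real_inner_comm] at h5
      exact h5
    · have ha := contDiffAt_chartRep (h.smooth.contMDiffAt (hU.mem_nhds hp))
      have hb := hasFDerivAt_chartRep h2
      have hD : DifferentiableAt ℝ (fderiv ℝ (chartRep p a)) (extChartAt (𝓡 n) p p) :=
        (ha.fderiv_right (m := 1) (by norm_cast)).differentiableAt (by simp)
      have hsymm := ha.isSymmSndFDerivAt (by simp; norm_cast)
      have key (v w : EuclideanSpace ℝ (Fin n)) :
          inner ℝ (vDeriv n a p v) (vDeriv n b p w) + inner ℝ (fderiv ℝ (fderiv ℝ (chartRep p a))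
            (extChartAt (𝓡 n) p p) w v) (b p) = 0 := by
        have h4 := (hD.hasFDerivAt.clm_apply (hasFDerivAt_const v _)).inner ℝ hb
        have h5 : (fun x => inner ℝ (fderiv ℝ (chartRep p a) x v) (chartRep p b x))
            =ᶠ[𝓝 (extChartAt (𝓡 n) p p)] fun _ => (0 : ℝ) := by
          filter_upwards [eventually_chart_symm_mem hU hp, eventually_mem_chart_target p]
            with x hx hx'
          rw [fderiv_chartRep hx' (mdifferentiableAt_of_contMDiffOn h.smooth hU hx)]
          exact h.inner_tangent _ hx _
        have h6 := (h4.congr_of_eventuallyEq h5.symm).unique (hasFDerivAt_const 0 _)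
        have h7 := congrArg (fun L : EuclideanSpace ℝ (Fin n) →L[ℝ] ℝ => L w) h6
        rw [← (hasFDerivAt_chartRep h1).fderiv]
        simp only [chartRep_self] at h7
        simpa [fderivInnerCLM_apply] using h7
      have h8 := key v w
      have h9 := key w v
      rw [hsymm.eq] at h8
      linarith
    · exact hv.trans (map_zero (vDeriv n a p)).symm

end Fronts

/-! ### The complex vectors `(u + i v) / √2` -/

section PairLift

variable {n : ℕ} {x y : EuclideanSpace ℝ (Fin (n + 2))}
    {A B : EuclideanSpace ℝ (Fin n) →L[ℝ] EuclideanSpace ℝ (Fin (n + 2))}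

/-- The vector `(u + i v) / √2`. -/
def normCpx (u v : EuclideanSpace ℝ (Fin (n + 2))) : CVec (n + 1) :=
  ((Real.sqrt 2 : ℂ)⁻¹) • cpxVec u v

theorem inner_normCpx (a b c d : EuclideanSpace ℝ (Fin (n + 2))) :
    inner ℂ (normCpx a b) (normCpx c d) =
      (1 / 2 : ℂ) * ⟨inner ℝ a c + inner ℝ b d, inner ℝ a d - inner ℝ b c⟩ := by
  rw [normCpx, normCpx, inner_smul_left, inner_smul_right, inner_cpxVec, ← mul_assoc]
  congr 1
  rw [← Complex.ofReal_inv, Complex.conj_ofReal, ← Complex.ofReal_mul, ← mul_inv,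
    Real.mul_self_sqrt (by norm_num)]
  norm_num

theorem conjVec_normCpx (u v : EuclideanSpace ℝ (Fin (n + 2))) :
    conjVec (normCpx u v) = normCpx u (-v) := by
  rw [normCpx, normCpx, conjVec_smul, conjVec_cpxVec, ← Complex.ofReal_inv, Complex.conj_ofReal]

theorem smul_normCpx (c : ℂ) (u v : EuclideanSpace ℝ (Fin (n + 2))) :
    c • normCpx u v = normCpx (c.re • u - c.im • v) (c.im • u + c.re • v) := by
  rw [normCpx, normCpx, smul_comm, smul_cpxVec]

theorem sqrt_two_inv_ne_zero : ((Real.sqrt 2 : ℂ)⁻¹) ≠ 0 := by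
  simp

theorem normCpx_inj {u v u' v' : EuclideanSpace ℝ (Fin (n + 2))} :
    normCpx u v = normCpx u' v' ↔ u = u' ∧ v = v' := by
  rw [normCpx, normCpx, (smul_right_injective _ sqrt_two_inv_ne_zero).eq_iff, cpxVec_inj]

theorem normCpx_zero : normCpx (0 : EuclideanSpace ℝ (Fin (n + 2))) 0 = 0 := by
  have : cpxVec (0 : EuclideanSpace ℝ (Fin (n + 2))) 0 = 0 := map_zero cpxCLM
  rw [normCpx, this, smul_zero]

theorem normCpx_add (u v u' v' : EuclideanSpace ℝ (Fin (n + 2))) :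
    normCpx u v + normCpx u' v' = normCpx (u + u') (v + v') := by
  have : cpxVec (u + u') (v + v') = cpxVec u v + cpxVec u' v' := map_add cpxCLM (u, v) (u', v')
  rw [normCpx, normCpx, normCpx, this, smul_add]

theorem exists_eq_normCpx (w : CVec (n + 1)) : ∃ u v, w = normCpx u v := by
  refine ⟨reCLM ((Real.sqrt 2 : ℂ) • w), imCLM ((Real.sqrt 2 : ℂ) • w), ?_⟩
  rw [normCpx, cpxVec_reCLM_imCLM, smul_smul, inv_mul_cancel₀ (by simp), one_smul]

theorem norm_normCpx (hx : ‖x‖ = 1) (hy : ‖y‖ = 1) : ‖normCpx x y‖ = 1 := by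
  rw [norm_eq_sqrt_re_inner (𝕜 := ℂ), inner_normCpx, real_inner_self_eq_norm_sq,
    real_inner_self_eq_norm_sq, hx, hy]
  norm_num

theorem sum_sq_normCpx (hx : ‖x‖ = 1) (hy : ‖y‖ = 1) (hxy : inner ℝ x y = 0) :
    ∑ i, normCpx x y i ^ 2 = 0 := by
  rw [← inner_conjVec_self, conjVec_normCpx, inner_normCpx, inner_neg_left, inner_neg_left,
    real_inner_self_eq_norm_sq, real_inner_self_eq_norm_sq, real_inner_comm x y, hxy, hx, hy]
  simp [Complex.ext_iff]

theorem inner_normCpx_of_orthogonal {u v : EuclideanSpace ℝ (Fin (n + 2))}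
    (h1 : inner ℝ u x = 0) (h2 : inner ℝ u y = 0) (h3 : inner ℝ v x = 0) (h4 : inner ℝ v y = 0) :
    inner ℂ (normCpx x y) (normCpx u v) = 0 := by
  rw [inner_normCpx, real_inner_comm, h1, real_inner_comm, h4, real_inner_comm, h3,
    real_inner_comm, h2]
  simp [Complex.ext_iff]

/-- The two complex equations amount to four real ones, the sums and differences of the four inner
products. -/
theorem orthogonal_of_inner_normCpx {u v : EuclideanSpace ℝ (Fin (n + 2))}
    (h1 : inner ℂ (normCpx x y) (normCpx u v) = 0)
    (h2 : inner ℂ (conjVec (normCpx x y)) (normCpx u v) = 0) :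
    inner ℝ u x = 0 ∧ inner ℝ u y = 0 ∧ inner ℝ v x = 0 ∧ inner ℝ v y = 0 := by
  rw [inner_normCpx] at h1
  rw [conjVec_normCpx, inner_normCpx] at h2
  have h3 : (1 / 2 : ℂ) ≠ 0 := by norm_num
  have h1' := (mul_eq_zero.1 h1).resolve_left h3
  have h2' := (mul_eq_zero.1 h2).resolve_left h3
  simp only [Complex.ext_iff, Complex.zero_re, Complex.zero_im, inner_neg_left] at h1' h2'
  rw [real_inner_comm x u, real_inner_comm y u, real_inner_comm x v, real_inner_comm y v]
  refine ⟨?_, ?_, ?_, ?_⟩ <;> linarith [h1'.1, h1'.2, h2'.1, h2'.2]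

end PairLift

/-! ### The Gauss map of a front, its canonical lift and the Lagrangian condition -/

section Gauss

variable {n : ℕ} {M : Type*}

theorem gaussMap_eq_hopf_gaussLift (a b : M → EuclideanSpace ℝ (Fin (n + 2))) {p : M}
    (h : gaussLift a b p ≠ 0) : hopf (gaussLift a b p) = gaussMap a b p :=
  hopf_smul (right_ne_zero_of_smul h) sqrt_two_inv_ne_zero

/-- The rotation by `t` multiplies `a + i b` by `e^(-it)`, which leaves the class unchanged. -/
theorem gaussMap_rotate (a b : M → EuclideanSpace ℝ (Fin (n + 2))) (t : ℝ) (hp : gaussLift a b p ≠ 0) :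
    gaussMap (fun x => Real.cos t • a x + Real.sin t • b x)
      (fun x => -(Real.sin t • a x) + Real.cos t • b x) p = gaussMap a b p := by
  have h1 : cpxVec (Real.cos t • a p + Real.sin t • b p) (-(Real.sin t • a p) + Real.cos t • b p) =
      (⟨Real.cos t, -Real.sin t⟩ : ℂ) • cpxVec (a p) (b p) := by
    rw [smul_cpxVec]
    congr 1 <;> module
  have h2 : (⟨Real.cos t, -Real.sin t⟩ : ℂ) ≠ 0 := by
    intro h
    have h3 := congrArg Complex.re h
    have h4 := congrArg Complex.im h
    have h5 := Real.cos_sq_add_sin_sq t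
    simp only [Complex.zero_re, Complex.zero_im, neg_eq_zero] at h3 h4
    rw [h3, h4] at h5
    norm_num at h5
  change hopf (cpxVec _ _) = _
  rw [h1, hopf_smul (right_ne_zero_of_smul hp) h2]
  rfl

variable [TopologicalSpace M] [ChartedSpace (EuclideanSpace ℝ (Fin n)) M]
  {U : Set M} {a b : M → EuclideanSpace ℝ (Fin (n + 2))} {f : M → CProj (n + 1)}
  {F : M → CVec (n + 1)} {p : M}

theorem mapD_eq_projAt (hF : MDifferentiableAt (𝓡 n) 𝓘(ℝ, CVec (n + 1)) F p) (h0 : F p ≠ 0)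
    (hf : ∀ᶠ q in 𝓝 p, hopf (F q) = f q) (v : EuclideanSpace ℝ (Fin n)) :
    @Eq (CModel (n + 1)) (mapD f p v) (projAt (F p) (vDeriv n F p v)) := by
  have h1 := ((contMDiffAt_hopf h0).mdifferentiableAt (by simp)).hasMFDerivAt.comp p
    hF.hasMFDerivAt
  have h2 : f =ᶠ[𝓝 p] hopf ∘ F := hf.mono fun q hq => hq.symm
  have h3 := (h1.congr_of_eventuallyEq h2).mfderiv
  exact congrArg (fun L : EuclideanSpace ℝ (Fin n) →L[ℝ] CModel (n + 1) => L v) h3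

theorem IsHorizontalLift.ne_zero (h : IsHorizontalLift U f F) (hp : p ∈ U) : F p ≠ 0 :=
  ne_zero_of_norm_eq_one (h.norm_eq p hp)

theorem IsHorizontalLift.liftAt_mapD (h : IsHorizontalLift U f F) (hU : IsOpen U) (hp : p ∈ U)
    (v : EuclideanSpace ℝ (Fin n)) : liftAt (F p) (mapD f p v) = vDeriv n F p v := by
  have hf : ∀ᶠ q in 𝓝 p, hopf (F q) = f q := by
    filter_upwards [hU.mem_nhds hp] with q hq using h.lift q hq
  have h1 := mapD_eq_projAt (mdifferentiableAt_of_contMDiffOn h.smooth hU hp) (h.ne_zero hp) hf v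
  exact (congrArg (liftAt (F p)) h1).trans (liftAt_projAt (h.ne_zero hp) (h.horizontal p hp v))

theorem vDeriv_gaussLift (ha : MDifferentiableAt (𝓡 n) 𝓘(ℝ, EuclideanSpace ℝ (Fin (n + 2))) a p)
    (hb : MDifferentiableAt (𝓡 n) 𝓘(ℝ, EuclideanSpace ℝ (Fin (n + 2))) b p)
    (v : EuclideanSpace ℝ (Fin n)) :
    vDeriv n (gaussLift a b) p v = normCpx (vDeriv n a p v) (vDeriv n b p v) := by
  have h1 := (hasFDerivAt_chartRep ha).prodMk (hasFDerivAt_chartRep hb)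
  have h2 := ((cpxCLM (n := n)).hasFDerivAt.comp _ h1).const_smul ((Real.sqrt 2 : ℂ)⁻¹)
  have h3 : MDifferentiableAt (𝓡 n) 𝓘(ℝ, CVec (n + 1)) (gaussLift a b) p :=
    (((Real.sqrt 2 : ℂ)⁻¹ • cpxCLM (n := n)).differentiableAt.mdifferentiableAt).comp p
      (ha.prodMk_space hb)
  exact congrArg (fun L : EuclideanSpace ℝ (Fin n) →L[ℝ] CVec (n + 1) => L v)
    ((hasFDerivAt_chartRep h3).unique h2)

theorem IsFront.isHorizontalLift (h : IsFront U a b) (hU : IsOpen U) :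
    IsHorizontalLift U (gaussMap a b) (gaussLift a b) := by
  have hn : ∀ p ∈ U, ‖gaussLift a b p‖ = 1 := fun p hp =>
    norm_normCpx (h.pair p hp).norm_left (h.pair p hp).norm_right
  refine ⟨?_, hn, fun p hp => ?_, fun p hp => ?_, fun p hp v => ?_⟩
  · exact (((Real.sqrt 2 : ℂ)⁻¹ • cpxCLM (n := n)).contDiff.contMDiff).comp_contMDiffOn
      (h.smooth.prodMk_space h.smooth_normal)
  · exact sum_sq_normCpx (h.pair p hp).norm_left (h.pair p hp).norm_right (h.pair p hp).inner_eq
  · exact gaussMap_eq_hopf_gaussLift a b (ne_zero_of_norm_eq_one (hn p hp))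
  · have h1 := vDeriv_gaussLift (mdifferentiableAt_of_contMDiffOn h.smooth hU hp)
      (mdifferentiableAt_of_contMDiffOn h.smooth_normal hU hp) v
    have h2 := h.pair p hp
    exact (congrArg (inner ℂ (gaussLift a b p)) h1).trans (inner_normCpx_of_orthogonal (h2.left_x v)
      (h2.left_y v) (h2.right_x v) (h2.right_y v))

/-- The bridge from the quadric to the hypersurface: later statements about `df` become statements
about `da` and `db`. The map `f` only has to agree with the Gauss map on `U`. -/
theorem IsFront.liftAt_mapD (h : IsFront U a b) (hU : IsOpen U)
    (hf : Set.EqOn (gaussMap a b) f U) (hp : p ∈ U) (v : EuclideanSpace ℝ (Fin n)) :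
    liftAt (gaussLift a b p) (mapD f p v) = normCpx (vDeriv n a p v) (vDeriv n b p v) := by
  have h1 := h.isHorizontalLift hU
  have h2 : IsHorizontalLift U f (gaussLift a b) :=
    ⟨h1.smooth, h1.norm_eq, h1.sum_sq, fun p hp => (h1.lift p hp).trans (hf hp), h1.horizontal⟩
  rw [h2.liftAt_mapD hU hp, vDeriv_gaussLift (mdifferentiableAt_of_contMDiffOn h.smooth hU hp)
      (mdifferentiableAt_of_contMDiffOn h.smooth_normal hU hp)]

theorem IsFront.isLagrangianImmersion (h : IsFront U a b) (hU : IsOpen U)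
    (hinj : ∀ p ∈ U, Function.Injective (vDeriv n a p)) :
    IsLagrangianImmersion U (gaussMap a b) := by
  have hl := h.isHorizontalLift hU
  have hlift (p) (hp : p ∈ U) (v : EuclideanSpace ℝ (Fin n)) :=
    h.liftAt_mapD (f := gaussMap a b) hU (fun _ _ => rfl) hp v
  have hI (u v : EuclideanSpace ℝ (Fin (n + 2))) : Complex.I • normCpx u v = normCpx (-v) u := by
    rw [smul_normCpx]; simp
  have hlag (p) (hp : p ∈ U) (v w : EuclideanSpace ℝ (Fin n)) :
      inner ℝ (Complex.I • normCpx (vDeriv n a p v) (vDeriv n b p v))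
        (normCpx (vDeriv n a p w) (vDeriv n b p w)) = 0 := by
    rw [hI, inner_real_eq_re, inner_normCpx, inner_neg_left,
      (h.pair p hp).symm v w, real_inner_comm]
    simp
  refine ⟨fun p hp => ⟨_, hl.ne_zero hp, hl.lift p hp, hl.sum_sq p hp⟩, fun p hp => ?_,
    fun p hp => ?_, fun p hp v w => ?_, fun p hp N hN hNw => ?_⟩
  · have h1 := (contMDiffAt_hopf (hl.ne_zero hp)).comp_contMDiffWithinAt p (hl.smooth p hp)
    exact h1.congr (fun q hq => (hl.lift q hq).symm) (hl.lift p hp).symm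
  · refine (injective_iff_map_eq_zero _).2 fun v hv => ?_
    have h1 := hlift p hp v
    have h2 : liftAt (gaussLift a b p) (mapD (gaussMap a b) p v) = 0 :=
      (congrArg (liftAt (gaussLift a b p)) hv).trans (map_zero _)
    rw [h2, ← normCpx_zero, normCpx_inj] at h1
    exact hinj p hp (h1.1.symm.trans (map_zero _).symm)
  · rw [fsMetric_eq (hl.norm_eq p hp) (hl.lift p hp), liftAt_cpxJ (hl.ne_zero hp) (hl.lift p hp)]
    exact (congrArg₂ (fun u w => inner ℝ (Complex.I • u) w) (hlift p hp v) (hlift p hp w)).trans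
      (hlag p hp v w)
  · have hpair := h.pair p hp
    have hz0 := hl.ne_zero hp
    have h1 := (mem_quadricTan_iff hz0 (hl.lift p hp) (hl.sum_sq p hp) N).1 hN
    have h2 := inner_liftAt hz0 N
    obtain ⟨u, v, huv⟩ := exists_eq_normCpx (liftAt (gaussLift a b p) N)
    rw [huv] at h1 h2
    obtain ⟨hux, huy, hvx, hvy⟩ := orthogonal_of_inner_normCpx h2 h1
    -- Let `u + i v` be the lift of `N` up to scale, so that the lift of `J N` is `-v + i u`. The
    -- vector `X` is chosen to match the real part; what remains is `db X = u`. The defect `u - db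
    -- X` is the real vector left in `N + J df X`, and it equals `da Y` for some `Y`. Since `N` and
    -- `J df X` are both orthogonal to `df Y`, the defect has zero norm.
    obtain ⟨X, hX⟩ := hpair.exists_apply_eq (hinj p hp) (u := -v)
      (by rw [inner_neg_left, hvx, neg_zero]) (by rw [inner_neg_left, hvy, neg_zero])
    have h3 : normCpx u v + Complex.I • normCpx (vDeriv n a p X) (vDeriv n b p X) =
        normCpx (u - vDeriv n b p X) 0 := by
      rw [hI, normCpx_add, hX, add_neg_cancel, sub_eq_add_neg]
    obtain ⟨Y, hY⟩ := hpair.exists_apply_eq (hinj p hp) (u := u - vDeriv n b p X)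
      (by rw [inner_sub_left, hux, hpair.right_x, sub_zero])
      (by rw [inner_sub_left, huy, hpair.right_y, sub_zero])
    have h4 : inner ℝ (normCpx u v) (normCpx (vDeriv n a p Y) (vDeriv n b p Y)) = 0 := by
      have h5 := hNw Y
      rw [fsMetric_eq (hl.norm_eq p hp) (hl.lift p hp)] at h5
      rw [← huv, ← hlift p hp]
      exact h5
    have h6 : inner ℝ (normCpx (u - vDeriv n b p X) 0)
        (normCpx (vDeriv n a p Y) (vDeriv n b p Y)) = 0 := by
      rw [← h3, inner_add_left, h4, hlag p hp, add_zero]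
    rw [inner_real_eq_re, inner_normCpx, hY] at h6
    have h7 : u - vDeriv n b p X = 0 := by
      have h8 : inner ℝ (u - vDeriv n b p X) (u - vDeriv n b p X) = (0 : ℝ) := by simpa using h6
      exact inner_self_eq_zero.1 h8
    refine ⟨X, liftAt_injective hz0 ?_⟩
    refine (hlift p hp X).trans ?_
    refine Eq.trans ?_ (liftAt_cpxJ hz0 (hl.lift p hp) N).symm
    refine Eq.trans ?_ (congrArg (Complex.I • ·) huv).symm
    rw [hI, hX, ← sub_eq_zero.1 h7]

end Gauss

/-! ### Making a unit lift horizontal by a change of phase -/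

section LagrangianLift

variable {n : ℕ}

/-- The imaginary part of the Hermitian inner product. -/
def imInner (m : ℕ) : CVec m →L[ℝ] CVec m →L[ℝ] ℝ :=
  LinearMap.toContinuousLinearMap
    { toFun := fun u => innerSL ℝ (Complex.I • u)
      map_add' := fun u v => by rw [smul_add, map_add]
      map_smul' := fun c u => by ext; simp [smul_comm Complex.I c] }

theorem imInner_apply {m : ℕ} (u v : CVec m) : imInner m u v = (inner ℂ u v).im := by
  change inner ℝ (Complex.I • u) v = _
  rw [inner_real_eq_re, inner_smul_left]
  simp

theorem liftAt_projAt_eq {m : ℕ} {z : CVec m} (hz : ‖z‖ = 1) (u : CVec m) :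
    liftAt z (projAt z u) = u - inner ℂ z u • z := by
  have h0 := ne_zero_of_norm_eq_one hz
  have h1 : inner ℂ z (u - inner ℂ z u • z) = 0 := by
    rw [inner_sub_right, inner_smul_right, inner_self_eq_norm_sq_to_K, hz]; simp
  rw [← liftAt_projAt h0 h1, map_sub, (projAt_eq_zero_iff h0 _).2 ⟨_, rfl⟩, sub_zero]

/-- A closed form of Kähler type has a primitive phase that makes a unit vector field horizontal. -/
theorem exists_phase {m : ℕ} {E : Type*} [NormedAddCommGroup E] [NormedSpace ℝ E]
    {B : Set E} (hB : IsOpen B) (hBc : Convex ℝ B) {G : E → CVec m}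
    (hG : ContDiffOn ℝ ∞ G B) (hn : ∀ x ∈ B, ‖G x‖ = 1)
    (hL : ∀ x ∈ B, ∀ v w, (inner ℂ (fderiv ℝ G x v) (fderiv ℝ G x w)).im = 0) :
    ∃ φ : E → ℝ, ContDiffOn ℝ ∞ φ B ∧ ∀ x ∈ B, ∀ v,
      inner ℂ (Complex.exp (-(φ x * Complex.I)) • G x)
        (fderiv ℝ (fun y => Complex.exp (-(φ y * Complex.I)) • G y) x v) = 0 := by
  -- The connection form of the Hopf fibration pulled back by `G`. In its differential the
  -- second-order term of `G` is symmetric and the rest is `Im ⟨dG, dG⟩`, which vanishes by `hL`.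
  let η : E → E →L[ℝ] ℝ := fun x => (imInner m (G x)).comp (fderiv ℝ G x)
  have hdG : ContDiffOn ℝ ∞ (fderiv ℝ G) B := hG.fderiv_of_isOpen hB (by simp)
  have hη : ContDiffOn ℝ ∞ η B := ((imInner m).contDiff.comp_contDiffOn hG).clm_comp hdG
  have hGd {x} (hx : x ∈ B) : HasFDerivAt G (fderiv ℝ G x) x :=
    ((hG.contDiffAt (hB.mem_nhds hx)).differentiableAt (by simp)).hasFDerivAt
  have hsym : ∀ a ∈ B, ∀ x y, fderiv ℝ η a x y = fderiv ℝ η a y x := by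
    intro a ha
    have key (x y : E) : fderiv ℝ η a x y =
        imInner m (G a) (fderiv ℝ (fderiv ℝ G) a x y) := by
      have h1 : HasFDerivAt η (fderiv ℝ η a) a :=
        ((hη.contDiffAt (hB.mem_nhds ha)).differentiableAt (by simp)).hasFDerivAt
      have h2 := h1.clm_apply (hasFDerivAt_const y a)
      have h3 : HasFDerivAt (fderiv ℝ G) (fderiv ℝ (fderiv ℝ G) a) a :=
        ((hdG.contDiffAt (hB.mem_nhds ha)).differentiableAt (by simp)).hasFDerivAt
      have h4 := ((imInner m).hasFDerivAt.comp a (hGd ha)).clm_apply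
        (h3.clm_apply (hasFDerivAt_const y a))
      have h5 := congrArg (fun L : E →L[ℝ] ℝ => L x) (h2.unique h4)
      have h6 := hL a ha x y
      rw [← imInner_apply] at h6
      simpa [h6] using h5
    intro x y
    rw [key, key, ((hG.contDiffAt (hB.mem_nhds ha)).isSymmSndFDerivAt (by simp; norm_cast)).eq]
  obtain ⟨φ, hφ⟩ := hBc.exists_forall_hasFDerivAt_of_fderiv_symmetric hB
    (hη.differentiableOn (by simp)) hsym
  refine ⟨φ, ?_, fun x hx v => ?_⟩
  · rw [contDiffOn_infty_iff_fderiv_of_isOpen hB]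
    exact ⟨fun x hx => (hφ x hx).differentiableAt.differentiableWithinAt,
      hη.congr fun x hx => (hφ x hx).fderiv⟩
  · have h1 : HasFDerivAt (fun y => ((φ y : ℝ) : ℂ)) (Complex.ofRealCLM.comp (η x)) x :=
      Complex.ofRealCLM.hasFDerivAt.comp x (hφ x hx)
    have h2 := ((h1.mul_const Complex.I).fun_neg).cexp
    have h3 := (h2.fun_smul (hGd hx)).fderiv
    -- The norm of `G` is constant, so `⟨G, dG⟩` is purely imaginary and equals `i η`. The phase
    -- contributes `-i dφ = -i η` and cancels it.
    have h4 : (inner ℂ (G x) (fderiv ℝ G x v)).re = 0 := by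
      have h5 := (hGd hx).inner ℝ (hGd hx)
      have h6 : (fun y => inner ℝ (G y) (G y)) =ᶠ[𝓝 x] fun _ => (1 : ℝ) := by
        filter_upwards [hB.mem_nhds hx] with y hy
        rw [real_inner_self_eq_norm_sq, hn y hy, one_pow]
      have h7 := congrArg (fun L : E →L[ℝ] ℝ => L v)
        ((h5.congr_of_eventuallyEq h6.symm).unique (hasFDerivAt_const 1 x))
      simp only [ContinuousLinearMap.comp_apply, ContinuousLinearMap.prod_apply,
        fderivInnerCLM_apply, zero_apply] at h7
      rw [real_inner_comm] at h7
      rw [← inner_real_eq_re, real_inner_comm]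
      linarith
    have h8 : inner ℂ (G x) (fderiv ℝ G x v) = η x v * Complex.I := by
      change _ = ((imInner m (G x) (fderiv ℝ G x v) : ℝ) : ℂ) * Complex.I
      rw [imInner_apply]
      apply Complex.ext <;> simp [h4]
    have h9 : inner ℂ (G x) (G x) = (1 : ℂ) := by
      rw [inner_self_eq_norm_sq_to_K, hn x hx]; simp
    rw [h3]
    simp only [add_apply, smul_apply, ContinuousLinearMap.smulRight_apply, neg_apply,
      ContinuousLinearMap.comp_apply, Complex.ofRealCLM_apply, inner_add_right, inner_smul_left,
      inner_smul_right, h8, h9, smul_eq_mul]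
    ring

end LagrangianLift

/-! ### Local horizontal lifts of Lagrangian immersions -/

section LocalLift

variable {n : ℕ} {M : Type*} [TopologicalSpace M] [ChartedSpace (EuclideanSpace ℝ (Fin n)) M]
  {U : Set M} {a b : M → EuclideanSpace ℝ (Fin (n + 2))} {f : M → CProj (n + 1)}
  {F : M → CVec (n + 1)} {p : M}

/-- Composition of `f` with a normalised affine section. The result is in general not horizontal;
that is repaired later by the phase. -/
theorem exists_local_unit_lift (hf : ContMDiff (𝓡 n) 𝓘(ℝ, CModel (n + 1)) ∞ f) (p₀ : M) :
    ∃ (U : Set M) (K : M → CVec (n + 1)), IsOpen U ∧ p₀ ∈ U ∧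
      ContMDiffOn (𝓡 n) 𝓘(ℝ, CVec (n + 1)) ∞ K U ∧ (∀ p ∈ U, ‖K p‖ = 1) ∧
      ∀ p ∈ U, hopf (K p) = f p := by
  set z := unitRep (f p₀) with hz
  set i := idx (f p₀) with hi
  have hzi : z i ≠ 0 := by
    have := idx_hopf (unitRep_ne_zero (f p₀))
    rwa [hopf_unitRep] at this
  have hs : ContMDiffOn (𝓡 n) 𝓘(ℝ, CVec (n + 1)) ∞ (fun p => affSection i z (f p))
      (f ⁻¹' affOpen i) :=
    (contMDiffOn_affSection i z).comp hf.contMDiffOn fun p hp => hp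
  have hne (p : M) : ‖affSection i z (f p)‖ ≠ 0 :=
    norm_ne_zero_iff.2 (affSection_ne_zero hzi _)
  refine ⟨f ⁻¹' affOpen i, fun p => ‖affSection i z (f p)‖⁻¹ • affSection i z (f p),
    (isOpen_affOpen i).preimage hf.continuous, (exists_mem_affOpen (f p₀)).choose_spec,
    fun p hp => ?_, fun p _ => ?_, fun p hp => ?_⟩
  · have h1 : ContDiffAt ℝ ∞ (fun w : CVec (n + 1) => ‖w‖⁻¹ • w) (affSection i z (f p)) :=
      ((contDiffAt_norm ℝ (affSection_ne_zero hzi _)).inv (hne p)).smul contDiffAt_id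
    exact ContMDiffAt.comp_contMDiffWithinAt (g := fun w : CVec (n + 1) => ‖w‖⁻¹ • w)
      (f := fun p => affSection i z (f p)) p h1.contMDiffAt (hs p hp)
  · rw [norm_smul, norm_inv, norm_norm, inv_mul_cancel₀ (hne p)]
  · simp only []
    rw [← Complex.coe_smul, hopf_smul (affSection_ne_zero hzi _) (by simpa using hne p)]
    exact hopf_affSection hzi hp

/-- Unit lifts of Lagrangian immersions satisfy the Lagrangian condition. -/
theorem im_inner_vDeriv_eq_zero (hU : IsOpen U)
    (hf : ∀ p ∈ U, ∀ v w, fsMetric (f p) (cpxJ (f p) (mapD f p v)) (mapD f p w) = 0)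
    (hK : ContMDiffOn (𝓡 n) 𝓘(ℝ, CVec (n + 1)) ∞ F U) (hn : ∀ p ∈ U, ‖F p‖ = 1)
    (hl : ∀ p ∈ U, hopf (F p) = f p) (hp : p ∈ U) (v w : EuclideanSpace ℝ (Fin n)) :
    (inner ℂ (vDeriv n F p v) (vDeriv n F p w)).im = 0 := by
  have h0 := ne_zero_of_norm_eq_one (hn p hp)
  have hd := mdifferentiableAt_of_contMDiffOn hK hU hp
  have hev : ∀ᶠ q in 𝓝 p, hopf (F q) = f q := by
    filter_upwards [hU.mem_nhds hp] with q hq using hl q hq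
  have hL (v : EuclideanSpace ℝ (Fin n)) : liftAt (F p) (mapD f p v) =
      vDeriv n F p v - inner ℂ (F p) (vDeriv n F p v) • F p :=
    (congrArg (liftAt (F p)) (mapD_eq_projAt hd h0 hev v)).trans (liftAt_projAt_eq (hn p hp) _)
  -- As `|F| = 1`, the vertical components `⟨F, dF v⟩` and `⟨F, dF w⟩` are imaginary. Removing them
  -- changes `⟨dF v, dF w⟩` by a real number only, so its imaginary part is that of the horizontal
  -- lifts.
  have hre (v : EuclideanSpace ℝ (Fin n)) : (inner ℂ (F p) (vDeriv n F p v)).re = 0 := by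
    have h1 : ∀ᶠ q in 𝓝 p, inner ℝ (F q) (F q) = (1 : ℝ) := by
      filter_upwards [hU.mem_nhds hp] with q hq
      rw [real_inner_self_eq_norm_sq, hn q hq, one_pow]
    have h2 := inner_vDeriv_of_const ℝ hd hd h1 v
    rw [real_inner_comm] at h2
    rw [← inner_real_eq_re, real_inner_comm]
    linarith
  have h1 := hf p hp v w
  rw [fsMetric_eq (hn p hp) (hl p hp), liftAt_cpxJ h0 (hl p hp)] at h1
  have h2 : inner ℝ (Complex.I • (vDeriv n F p v - inner ℂ (F p) (vDeriv n F p v) • F p))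
      (vDeriv n F p w - inner ℂ (F p) (vDeriv n F p w) • F p) = 0 :=
    (congrArg₂ (fun u w => inner ℝ (Complex.I • u) w) (hL v) (hL w)).symm.trans h1
  have h3 : inner ℂ (F p) (F p) = (1 : ℂ) := by
    rw [inner_self_eq_norm_sq_to_K, hn p hp]; simp
  have h4 := inner_conj_symm (𝕜 := ℂ) (vDeriv n F p v) (F p)
  rw [inner_real_eq_re, inner_smul_left] at h2
  simp only [inner_sub_left, inner_sub_right, inner_smul_left, inner_smul_right, h3, ← h4] at h2
  have h5 := hre v
  have h6 := hre w
  simp only [Complex.conj_I, Complex.mul_re, Complex.neg_re, Complex.I_re, Complex.neg_im,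
    Complex.I_im, Complex.sub_im, Complex.mul_im, Complex.conj_re, Complex.conj_im, Complex.sub_re,
    Complex.one_re, Complex.one_im, h5, h6] at h2
  linarith

variable [IsManifold (𝓡 n) ∞ M]

theorem contMDiffAt_extChartAt_symm {x : EuclideanSpace ℝ (Fin n)}
    (hx : x ∈ (extChartAt (𝓡 n) p).target) :
    ContMDiffAt 𝓘(ℝ, EuclideanSpace ℝ (Fin n)) (𝓡 n) ∞ (extChartAt (𝓡 n) p).symm x :=
  (contMDiffOn_extChartAt_symm (I := 𝓡 n) p).contMDiffAt ((isOpen_extChartAt_target (I := 𝓡 n) p).mem_nhds hx)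

/-- The phase is found on a ball in the chart, where closed forms have primitives, and carried back
to the manifold. Changing the phase preserves the norm and the projected point. -/
theorem exists_local_horizontal_lift (hf : IsLagrangianImmersion Set.univ f) (p₀ : M) :
    ∃ (U : Set M) (F : M → CVec (n + 1)), IsOpen U ∧ p₀ ∈ U ∧ IsHorizontalLift U f F := by
  obtain ⟨U₀, K, hU₀, hp₀, hK, hKn, hKl⟩ :=
    exists_local_unit_lift (contMDiffOn_univ.1 hf.smooth) p₀
  set ψ := extChartAt (𝓡 n) p₀ with hψ
  obtain ⟨r, hr, hB⟩ := Metric.eventually_nhds_iff_ball.1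
    ((eventually_chart_symm_mem (n := n) hU₀ hp₀).and (eventually_mem_chart_target (n := n) p₀))
  set B := Metric.ball (ψ p₀) r with hBdef
  have hBo : IsOpen B := Metric.isOpen_ball
  set G : EuclideanSpace ℝ (Fin n) → CVec (n + 1) := chartRep p₀ K with hG
  have hKd {q : M} (hq : q ∈ U₀) : MDifferentiableAt (𝓡 n) 𝓘(ℝ, CVec (n + 1)) K q :=
    mdifferentiableAt_of_contMDiffOn hK hU₀ hq
  have hGs : ContDiffOn ℝ ∞ G B := fun x hx => by
    have h1 := (hK.contMDiffAt (hU₀.mem_nhds (hB x hx).1)).comp x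
      (contMDiffAt_extChartAt_symm (hB x hx).2)
    exact (contMDiffAt_iff_contDiffAt.1 h1).contDiffWithinAt
  have hGn : ∀ x ∈ B, ‖G x‖ = 1 := fun x hx => hKn _ (hB x hx).1
  have hGL : ∀ x ∈ B, ∀ v w, (inner ℂ (fderiv ℝ G x v) (fderiv ℝ G x w)).im = 0 :=
    fun x hx v w => by
      rw [hG, fderiv_chartRep (hB x hx).2 (hKd (hB x hx).1)]
      exact im_inner_vDeriv_eq_zero hU₀ (fun p _ => hf.tangent_to_normal p trivial) hK hKn hKl
        (hB x hx).1 _ _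
  obtain ⟨φ, hφ, hh⟩ := exists_phase hBo (convex_ball _ _) hGs hGn hGL
  set H : EuclideanSpace ℝ (Fin n) → CVec (n + 1) :=
    fun x => Complex.exp (-(φ x * Complex.I)) • G x with hH
  have hHs : ContDiffOn ℝ ∞ H B := by
    have h1 : ContDiffOn ℝ ∞ (fun x => ((φ x : ℝ) : ℂ)) B :=
      Complex.ofRealCLM.contDiff.comp_contDiffOn hφ
    exact ((h1.mul contDiffOn_const).neg.cexp).smul hGs
  have hUo : IsOpen (ψ.source ∩ ψ ⁻¹' B) :=
    (continuousOn_extChartAt p₀).isOpen_inter_preimage (isOpen_extChartAt_source (I := 𝓡 n) p₀) hBo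
  have hval (p) (hp : p ∈ ψ.source ∩ ψ ⁻¹' B) :
      p ∈ U₀ ∧ H (ψ p) = Complex.exp (-(φ (ψ p) * Complex.I)) • K p := by
    have h1 : ψ.symm (ψ p) = p := ψ.left_inv hp.1
    have h2 := (hB _ hp.2).1
    rw [h1] at h2
    refine ⟨h2, ?_⟩
    simp only [hH, hG, chartRep, Function.comp_apply]
    rw [h1]
  have hn (p) (hp : p ∈ ψ.source ∩ ψ ⁻¹' B) : ‖H (ψ p)‖ = 1 := by
    rw [(hval p hp).2, norm_smul, hKn p (hval p hp).1, ← neg_mul, ← Complex.ofReal_neg,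
      Complex.norm_exp_ofReal_mul_I, one_mul]
  have hl (p) (hp : p ∈ ψ.source ∩ ψ ⁻¹' B) : hopf (H (ψ p)) = f p := by
    rw [(hval p hp).2, hopf_smul (ne_zero_of_norm_eq_one (hKn p (hval p hp).1))
      (Complex.exp_ne_zero _), hKl p (hval p hp).1]
  refine ⟨ψ.source ∩ ψ ⁻¹' B, fun p => H (ψ p), hUo,
    ⟨mem_extChartAt_source p₀, Metric.mem_ball_self hr⟩, ?_, hn, fun p hp => ?_, hl,
    fun p hp v => ?_⟩
  · have h1 : ContMDiffOn (𝓡 n) 𝓘(ℝ, EuclideanSpace ℝ (Fin n)) ∞ ψ (chartAt _ p₀).source :=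
      contMDiffOn_extChartAt
    rw [← extChartAt_source (𝓡 n)] at h1
    exact hHs.contMDiffOn.comp (h1.mono Set.inter_subset_left) fun p hp => hp.2
  · exact liftAt_mem_quadric_cone (ne_zero_of_norm_eq_one (hn p hp))
      (by rw [hl p hp]; exact hf.mem_quadric p trivial)
  · have : IsManifold (𝓡 n) 1 M := IsManifold.of_le (n := ∞) (by simp)
    have h1 : DifferentiableAt ℝ H (ψ p) :=
      (hHs.contDiffAt (hBo.mem_nhds hp.2)).differentiableAt (by simp)
    have h2 := h1.hasFDerivAt.hasMFDerivAt.comp p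
      (mdifferentiableAt_extChartAt (I := 𝓡 n) (by simpa [hψ] using hp.1)).hasMFDerivAt
    have h3 : vDeriv n (fun p => H (ψ p)) p = (fderiv ℝ H (ψ p)).comp (vDeriv n ψ p) := h2.mfderiv
    exact (congrArg (fun L : EuclideanSpace ℝ (Fin n) →L[ℝ] CVec (n + 1) => inner ℂ (H (ψ p)) (L v))
      h3).trans (hh _ hp.2 _)

end LocalLift

/-! ### From horizontal lifts to fronts -/

section LiftFront

variable {n : ℕ} {M : Type*} [TopologicalSpace M] [ChartedSpace (EuclideanSpace ℝ (Fin n)) M]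
  {U : Set M} {f : M → CProj (n + 1)} {F : M → CVec (n + 1)}

/-- A horizontal lift of a Lagrangian immersion is the canonical lift of a front. -/
theorem IsHorizontalLift.exists_isFront (hU : IsOpen U) (hF : IsHorizontalLift U f F)
    (hf : IsLagrangianImmersion U f) :
    ∃ a b : M → EuclideanSpace ℝ (Fin (n + 2)), IsFront U a b ∧ Set.EqOn (gaussMap a b) f U := by
  let a : M → EuclideanSpace ℝ (Fin (n + 2)) := fun p => reCLM (√2 • F p)
  let b : M → EuclideanSpace ℝ (Fin (n + 2)) := fun p => imCLM (√2 • F p)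
  have hab (p : M) : gaussLift a b p = F p := by
    rw [gaussLift, cpxVec_reCLM_imCLM, ← Complex.coe_smul, smul_smul,
      inv_mul_cancel₀ (by simp), one_smul]
  have ha : ContMDiffOn (𝓡 n) 𝓘(ℝ, EuclideanSpace ℝ (Fin (n + 2))) ∞ a U :=
    (reCLM ∘L (√2 • ContinuousLinearMap.id ℝ (CVec (n + 1)))).contDiff.contMDiff.comp_contMDiffOn
      hF.smooth
  have hb : ContMDiffOn (𝓡 n) 𝓘(ℝ, EuclideanSpace ℝ (Fin (n + 2))) ∞ b U :=
    (imCLM ∘L (√2 • ContinuousLinearMap.id ℝ (CVec (n + 1)))).contDiff.contMDiff.comp_contMDiffOn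
      hF.smooth
  refine ⟨a, b, ⟨ha, hb, fun p hp => ?_⟩, fun p hp => ?_⟩
  · have hFd := mdifferentiableAt_of_contMDiffOn hF.smooth hU hp
    have hFp : F p = normCpx (a p) (b p) := (hab p).symm
    have hdF (v : EuclideanSpace ℝ (Fin n)) :
        vDeriv n F p v = normCpx (vDeriv n a p v) (vDeriv n b p v) := by
      rw [← vDeriv_gaussLift (mdifferentiableAt_of_contMDiffOn ha hU hp)
        (mdifferentiableAt_of_contMDiffOn hb hU hp), funext hab]
    have h1 : inner ℂ (F p) (F p) = (1 : ℂ) := by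
      rw [inner_self_eq_norm_sq_to_K, hF.norm_eq p hp]; simp
    have h2 : inner ℂ (conjVec (F p)) (F p) = 0 := by rw [inner_conjVec_self, hF.sum_sq p hp]
    have hor (v : EuclideanSpace ℝ (Fin n)) : inner ℝ (vDeriv n a p v) (a p) = 0 ∧
        inner ℝ (vDeriv n a p v) (b p) = 0 ∧ inner ℝ (vDeriv n b p v) (a p) = 0 ∧
        inner ℝ (vDeriv n b p v) (b p) = 0 := by
      apply orthogonal_of_inner_normCpx
      · rw [← hFp, ← hdF]
        exact hF.horizontal p hp v
      -- The orthogonality of `dF` to the conjugate of `F` comes from differentiating `∑ F_i ^ 2 =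
      -- 0`; the two terms of the product rule coincide.
      · rw [← hFp, ← hdF]
        have h3 : MDifferentiableAt (𝓡 n) 𝓘(ℝ, CVec (n + 1)) (fun q => conjCLM (F q)) p :=
          conjCLM.differentiableAt.mdifferentiableAt.comp p hFd
        have h4 : ∀ᶠ q in 𝓝 p, inner ℂ (conjCLM (F q)) (F q) = 0 := by
          filter_upwards [hU.mem_nhds hp] with q hq
          rw [conjCLM_apply, inner_conjVec_self, hF.sum_sq q hq]
        have h5 := inner_vDeriv_of_const ℂ h3 hFd h4 v
        rw [vDeriv_clm_comp conjCLM hFd, ContinuousLinearMap.comp_apply, conjCLM_apply,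
          conjCLM_apply, inner_conjVec_left_comm (vDeriv n F p v), ← two_mul] at h5
        exact (mul_eq_zero.1 h5).resolve_left two_ne_zero
    rw [hFp, inner_normCpx] at h1
    rw [hFp, conjVec_normCpx, inner_normCpx] at h2
    simp only [real_inner_self_eq_norm_sq, inner_neg_left, Complex.ext_iff] at h1 h2
    rw [real_inner_comm (a p) (b p)] at h2
    norm_num at h1 h2
    refine ⟨?_, ?_, ?_, fun v => (hor v).1, fun v => (hor v).2.1, fun v => (hor v).2.2.1,
      fun v => (hor v).2.2.2, fun v w => ?_, fun v hv hv' => ?_⟩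
    · rw [← sq_eq_sq₀ (norm_nonneg _) zero_le_one]; linarith [h1.1, h2.1]
    · rw [← sq_eq_sq₀ (norm_nonneg _) zero_le_one]; linarith [h1.1, h2.1]
    · linarith [h2.2]
    · have h3 := im_inner_vDeriv_eq_zero hU hf.tangent_to_normal hF.smooth hF.norm_eq hF.lift hp v w
      rw [hdF, hdF, inner_normCpx] at h3
      norm_num at h3
      rw [real_inner_comm (vDeriv n b p v)]
      linarith
    · have h3 := hF.liftAt_mapD hU hp v
      rw [hdF, hv, hv', normCpx_zero] at h3
      have h4 : mapD f p v = (0 : CModel (n + 1)) :=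
        liftAt_injective (hF.ne_zero hp) (h3.trans (map_zero _).symm)
      exact hf.injective p hp (h4.trans (map_zero (mapD f p)).symm)
  · have h1 := hab p
    rw [← gaussMap_eq_hopf_gaussLift a b (by rw [h1]; exact hF.ne_zero hp), h1]
    exact hF.lift p hp

end LiftFront

/-! ### The scalar equation between angles and principal curvatures -/

section Angles

/-- The unit complex number `e^(-2iθ)`. -/
def anglePhase (θ : ℝ) : ℂ := ⟨Real.cos (2 * θ), -Real.sin (2 * θ)⟩

theorem anglePhase_neg_half (x : ℝ) : anglePhase (-x / 2) = Complex.exp (x * Complex.I) := by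
  rw [anglePhase, show 2 * (-x / 2) = -x by ring, Real.cos_neg, Real.sin_neg, neg_neg,
    Complex.exp_mul_I]
  apply Complex.ext <;> simp [← Complex.ofReal_cos, ← Complex.ofReal_sin]

/-- Multiplied by `e^(iθ)`, the equation says that `e^(iθ) (1 + i l)` has vanishing real part. -/
theorem anglePhase_eq_iff (l θ : ℝ) :
    -((1 : ℂ) * ⟨1, l⟩) = anglePhase θ * ⟨1, -l⟩ ↔ Real.cos θ = l * Real.sin θ := by
  have h := Real.cos_sq_add_sin_sq θ
  simp only [anglePhase, Complex.ext_iff, one_mul, Complex.neg_re, Complex.neg_im, Complex.mul_re,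
    Complex.mul_im, Real.cos_two_mul, Real.sin_two_mul]
  constructor
  · rintro ⟨h1, h2⟩
    linear_combination (-(Real.cos θ - l * Real.sin θ)) * h - Real.cos θ / 2 * h1 +
      Real.sin θ / 2 * h2 - Real.sin θ * l * h
  · intro h1
    constructor
    · linear_combination (-2 * Real.cos θ) * h1
    · linear_combination (2 * Real.sin θ) * h1 + 2 * l * h

theorem sin_ne_zero_and_eq_cot {l θ : ℝ} (h : Real.cos θ = l * Real.sin θ) :
    Real.sin θ ≠ 0 ∧ l = Real.cot θ := by
  have h0 : Real.sin θ ≠ 0 := by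
    intro h1
    have h2 := Real.cos_sq_add_sin_sq θ
    rw [h, h1] at h2
    norm_num at h2
  exact ⟨h0, by rw [Real.cot_eq_cos_div_sin, h, mul_div_cancel_right₀ _ h0]⟩

theorem cos_arccot (l : ℝ) :
    Real.cos (Real.pi / 2 - Real.arctan l) = l * Real.sin (Real.pi / 2 - Real.arctan l) := by
  rw [Real.cos_pi_div_two_sub, Real.sin_pi_div_two_sub,
    ← Real.tan_mul_cos (Real.cos_arctan_pos l).ne', Real.tan_arctan]

theorem cpx_one_ne_zero (l : ℝ) : (⟨1, l⟩ : ℂ) ≠ 0 := fun h => by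
  simpa using congrArg Complex.re h

theorem norm_one_neg (l : ℝ) : ‖(⟨1, -l⟩ : ℂ)‖ = ‖(⟨1, l⟩ : ℂ)‖ := by
  have : (⟨1, -l⟩ : ℂ) = (starRingEnd ℂ) ⟨1, l⟩ := rfl
  rw [this, Complex.norm_conj]

/-- The unit complex number `-c (1 + i l) / (1 - i l)`. -/
def curvaturePhase (c : ℂ) (l : ℝ) : ℂ := -(c * ⟨1, l⟩) / ⟨1, -l⟩

theorem norm_curvaturePhase {c : ℂ} (hc : ‖c‖ = 1) (l : ℝ) : ‖curvaturePhase c l‖ = 1 := by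
  have : ‖(⟨1, l⟩ : ℂ)‖ ≠ 0 := norm_ne_zero_iff.2 (cpx_one_ne_zero l)
  rw [curvaturePhase, norm_div, norm_neg, norm_mul, hc, norm_one_neg, one_mul, div_self this]

/-- The left side is the form in which the angle equation appears for a principal direction; the
factor `1 - i l` never vanishes. -/
theorem eq_anglePhase_iff (c : ℂ) (l θ : ℝ) :
    -(c * ⟨1, l⟩) = anglePhase θ * ⟨1, -l⟩ ↔ anglePhase θ = curvaturePhase c l := by
  rw [curvaturePhase, eq_div_iff (cpx_one_ne_zero _), eq_comm]

theorem exists_anglePhase {c : ℂ} (hc : ‖c‖ = 1) (l : ℝ) :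
    ∃ θ : ℝ, anglePhase θ = curvaturePhase c l := by
  refine ⟨-(curvaturePhase c l).arg / 2, ?_⟩
  rw [anglePhase_neg_half]
  have := Complex.norm_mul_exp_arg_mul_I (curvaturePhase c l)
  rwa [norm_curvaturePhase hc, Complex.ofReal_one, one_mul] at this

/-- A branch of the phase centred at `u₀`: the logarithm is taken of `u / u₀`, which is near `1` for
`u` near `u₀`. This avoids the jump of `Complex.arg` and permits smooth angles. -/
theorem anglePhase_branch {u u₀ : ℂ} (hu : ‖u‖ = 1) (hu₀ : ‖u₀‖ = 1) :
    anglePhase (-(u₀.arg + (Complex.log (u / u₀)).im) / 2) = u := by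
  have h0 : u₀ ≠ 0 := norm_ne_zero_iff.1 (by rw [hu₀]; norm_num)
  have h1 : u ≠ 0 := norm_ne_zero_iff.1 (by rw [hu]; norm_num)
  have h2 : ((Complex.log (u / u₀)).im : ℂ) * Complex.I = Complex.log (u / u₀) := by
    apply Complex.ext
    · simp [Complex.log_re, hu, hu₀]
    · simp
  have h3 := Complex.norm_mul_exp_arg_mul_I u₀
  rw [hu₀, Complex.ofReal_one, one_mul] at h3
  rw [anglePhase_neg_half, Complex.ofReal_add, add_mul, Complex.exp_add, h3, h2,
    Complex.exp_log (div_ne_zero h1 h0), mul_div_cancel₀ _ h0]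

/-- Comparing the two equations eliminates `c` and says that `(1 + i l) (1 - i m) e^(i(θ - φ))` is
real. The product of the first two factors is `(1 + l m) + i (l - m)`, so the vanishing imaginary
part determines the cotangent. -/
theorem cot_sub_of_anglePhase {c : ℂ} (hc : ‖c‖ = 1) {l m θ φ : ℝ}
    (hl : anglePhase θ = curvaturePhase c l) (hm : anglePhase φ = curvaturePhase c m)
    (hlm : l ≠ m) :
    Real.sin (θ - φ) ≠ 0 ∧ Real.cot (θ - φ) = -((l * m + 1) / (l - m)) := by
  have hc0 : -c ≠ 0 := neg_ne_zero.2 (norm_ne_zero_iff.1 (by rw [hc]; norm_num))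
  rw [← eq_anglePhase_iff] at hl hm
  have h1 : (⟨1, l⟩ * ⟨1, -m⟩ : ℂ) * anglePhase φ = anglePhase θ * (⟨1, -l⟩ * ⟨1, m⟩) := by
    apply mul_left_cancel₀ hc0
    linear_combination (⟨1, -m⟩ * anglePhase φ) * hl - (anglePhase θ * ⟨1, -l⟩) * hm
  -- Sum and difference of the angles: the common factor `e^(-iσ)` then drops out of `h1`, and only
  -- `δ` remains in `hT`.
  obtain ⟨σ, δ, hδ', e1, e2⟩ : ∃ σ δ, θ - φ = δ ∧ 2 * θ = σ + δ ∧ 2 * φ = σ - δ :=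
    ⟨θ + φ, θ - φ, rfl, by ring, by ring⟩
  simp only [anglePhase, e1, e2, Complex.ext_iff, Complex.mul_re, Complex.mul_im, Real.cos_add,
    Real.cos_sub, Real.sin_add, Real.sin_sub] at h1
  rw [hδ']
  have hσ := Real.cos_sq_add_sin_sq σ
  have hδ := Real.cos_sq_add_sin_sq δ
  obtain ⟨h2, h3⟩ := h1
  have hT : (1 + l * m) * Real.sin δ + (l - m) * Real.cos δ = 0 := by
    linear_combination Real.cos σ / 2 * h3 + Real.sin σ / 2 * h2 -
      ((1 + l * m) * Real.sin δ + (l - m) * Real.cos δ) * hσ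
  have hlm' : l - m ≠ 0 := sub_ne_zero.2 hlm
  have hs : Real.sin δ ≠ 0 := by
    intro h0
    rw [h0, mul_zero, zero_add] at hT
    rw [h0, (mul_eq_zero.1 hT).resolve_left hlm'] at hδ
    norm_num at hδ
  refine ⟨hs, ?_⟩
  rw [Real.cot_eq_cos_div_sin, ← neg_div, div_eq_div_iff hs hlm']
  linear_combination hT

end Angles

/-! ### The angle equation at a point of a front -/

section Pointwise

variable {n : ℕ} {M : Type*} [TopologicalSpace M] [ChartedSpace (EuclideanSpace ℝ (Fin n)) M]
  {U : Set M} {a b : M → EuclideanSpace ℝ (Fin (n + 2))} {f : M → CProj (n + 1)} {p : M}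

theorem IsFront.mapD_mem_quadricTan (h : IsFront U a b) (hU : IsOpen U)
    (hf : Set.EqOn (gaussMap a b) f U) (hp : p ∈ U) (v : EuclideanSpace ℝ (Fin n)) :
    mapD f p v ∈ quadricTan (f p) := by
  have hl := h.isHorizontalLift hU
  refine (mem_quadricTan_iff (hl.ne_zero hp) ((hl.lift p hp).trans (hf hp)) (hl.sum_sq p hp) _).2 ?_
  refine (congrArg (inner ℂ _) (h.liftAt_mapD hU hf hp v)).trans ?_
  have hpair := h.pair p hp
  change inner ℂ (conjVec (normCpx (a p) (b p))) _ = 0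
  rw [conjVec_normCpx]
  apply inner_normCpx_of_orthogonal (hpair.left_x v) _ (hpair.right_x v) _
  · rw [inner_neg_right, hpair.left_y, neg_zero]
  · rw [inner_neg_right, hpair.right_y, neg_zero]

/-- The equation of angle functions, in terms of the horizontal lift. -/
theorem IsFront.angle_iff (h : IsFront U a b) (hU : IsOpen U)
    (hf : Set.EqOn (gaussMap a b) f U) (hp : p ∈ U) {ν : Tan (f p)} {A : Tan (f p) →ₗ[ℝ] Tan (f p)}
    (hA : IsQuadricShapeOperator (f p) ν A) {c : ℂ}
    (hc : liftAt (gaussLift a b p) ν = c • conjVec (gaussLift a b p))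
    (v : EuclideanSpace ℝ (Fin n)) (θ : ℝ) :
    A (mapD f p v) = Real.cos (2 * θ) • mapD f p v -
        Real.sin (2 * θ) • cpxJ (f p) (mapD f p v) ↔
      -(c • normCpx (vDeriv n a p v) (-vDeriv n b p v)) =
        anglePhase θ • normCpx (vDeriv n a p v) (vDeriv n b p v) := by
  have hl := h.isHorizontalLift hU
  have hz := hl.norm_eq p hp
  have hz0 := hl.ne_zero hp
  have hq := (hl.lift p hp).trans (hf hp)
  have hm := h.liftAt_mapD hU hf hp v
  have h1 := hA.liftAt_eq hz hq (hl.sum_sq p hp) hc (h.mapD_mem_quadricTan hU hf hp v)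
  have h2 : liftAt (gaussLift a b p) (mapD f p v) = normCpx (vDeriv n a p v) (vDeriv n b p v) := hm
  have h3 : liftAt (gaussLift a b p) (A (mapD f p v)) =
      -(c • normCpx (vDeriv n a p v) (-vDeriv n b p v)) := by
    refine h1.trans ?_
    rw [← conjVec_normCpx]
    exact congrArg (fun u => -(c • conjVec u)) h2
  have h4 : liftAt (gaussLift a b p) (Real.cos (2 * θ) • mapD f p v -
        Real.sin (2 * θ) • cpxJ (f p) (mapD f p v) : Tan (f p)) =
      anglePhase θ • normCpx (vDeriv n a p v) (vDeriv n b p v) := by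
    have h5 : liftAt (gaussLift a b p) (cpxJ (f p) (mapD f p v)) =
        Complex.I • normCpx (vDeriv n a p v) (vDeriv n b p v) :=
      (liftAt_cpxJ hz0 hq _).trans (congrArg (Complex.I • ·) h2)
    refine (map_sub (liftAt (gaussLift a b p)) _ _).trans ?_
    refine (congrArg₂ (· - ·) (map_smul (liftAt (gaussLift a b p)) _ _)
      (map_smul (liftAt (gaussLift a b p)) _ _)).trans ?_
    refine (congrArg₂ (fun u w => Real.cos (2 * θ) • u - Real.sin (2 * θ) • w) h2 h5).trans ?_
    rw [← Complex.coe_smul, ← Complex.coe_smul, smul_smul, ← sub_smul]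
    congr 1
    apply Complex.ext <;> simp [anglePhase, -Complex.ofReal_cos, -Complex.ofReal_sin]
  rw [← h3, ← h4]
  exact ⟨fun h => congrArg (liftAt (gaussLift a b p)) h, fun h => liftAt_injective hz0 h⟩

/-- On a principal direction both sides are complex multiples of the single nonzero vector `normCpx
(da v) 0`, with factors `-c (1 + i l)` and `e^(-2iθ) (1 - i l)`. The vector equation is thus scalar.
-/
theorem IsFront.angle_iff_of_principal (h : IsFront U a b) (hU : IsOpen U)
    (hf : Set.EqOn (gaussMap a b) f U) (hp : p ∈ U) {ν : Tan (f p)} {A : Tan (f p) →ₗ[ℝ] Tan (f p)}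
    (hA : IsQuadricShapeOperator (f p) ν A) {c : ℂ}
    (hc : liftAt (gaussLift a b p) ν = c • conjVec (gaussLift a b p))
    {v : EuclideanSpace ℝ (Fin n)} {l : ℝ} (hv : vDeriv n a p v ≠ 0)
    (hl : vDeriv n b p v = -(l • vDeriv n a p v)) (θ : ℝ) :
    A (mapD f p v) = Real.cos (2 * θ) • mapD f p v -
        Real.sin (2 * θ) • cpxJ (f p) (mapD f p v) ↔ anglePhase θ = curvaturePhase c l := by
  have h1 : normCpx (vDeriv n a p v) (vDeriv n b p v) =
      (⟨1, -l⟩ : ℂ) • normCpx (vDeriv n a p v) 0 := by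
    rw [smul_normCpx, hl]; simp
  have h2 : normCpx (vDeriv n a p v) (-vDeriv n b p v) =
      (⟨1, l⟩ : ℂ) • normCpx (vDeriv n a p v) 0 := by
    rw [smul_normCpx, hl]; simp
  have h3 : normCpx (vDeriv n a p v) 0 ≠ 0 := by
    rw [Ne, ← normCpx_zero, normCpx_inj]
    exact fun h => hv h.1
  rw [h.angle_iff hU hf hp hA hc, h1, h2, smul_smul, smul_smul, ← neg_smul,
    (smul_left_injective ℂ h3).eq_iff, eq_anglePhase_iff]

/-- The derivative of `b` is already orthogonal to `a`, so the spherical covariant derivative is the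
flat one. Reversing the normal reverses the curvature. -/
theorem IsFront.isPrincipalAt_smul_iff (h : IsFront U a b) (hU : IsOpen U) (hp : p ∈ U) {ε : ℝ}
    (hε : ε = 1 ∨ ε = -1) (v : EuclideanSpace ℝ (Fin n)) (l : ℝ) :
    IsPrincipalAt a (fun q => ε • b q) p v l ↔
      vDeriv n b p v = -((ε * l) • vDeriv n a p v) := by
  have h1 : vDeriv n (fun q => ε • b q) p = ε • vDeriv n b p :=
    vDeriv_clm_comp (ε • ContinuousLinearMap.id ℝ _)
      (mdifferentiableAt_of_contMDiffOn h.smooth_normal hU hp)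
  have h2 : sphereCovD a (fun q => ε • b q) p v = ε • vDeriv n b p v := by
    change vDeriv n (fun q => ε • b q) p v - inner ℝ (a p) (vDeriv n (fun q => ε • b q) p v) • a p = _
    rw [h1, smul_apply, inner_smul_right, real_inner_comm, (h.pair p hp).right_x]
    simp
  have h3 : vecD a p (l • v : EuclideanSpace ℝ (Fin n)) = l • vDeriv n a p v :=
    map_smul (vDeriv n a p) l v
  have h4 : IsPrincipalAt a (fun q => ε • b q) p v l ↔
      ε • vDeriv n b p v = -(l • vDeriv n a p v) := by
    exact ⟨fun h => h2.symm.trans (h.trans (congrArg Neg.neg h3)),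
      fun h => h2.trans (h.trans (congrArg Neg.neg h3).symm)⟩
  rw [h4]
  rcases hε with rfl | rfl
  · simp
  · simp [neg_eq_iff_eq_neg]

theorem IsFront.isPrincipalAt_iff (h : IsFront U a b) (hU : IsOpen U) (hp : p ∈ U)
    (v : EuclideanSpace ℝ (Fin n)) (l : ℝ) :
    IsPrincipalAt a b p v l ↔ vDeriv n b p v = -(l • vDeriv n a p v) := by
  have := h.isPrincipalAt_smul_iff hU hp (Or.inl rfl) v l
  simpa only [one_smul, one_mul] using this

theorem IsFront.principalCurvatures_eq (h : IsFront U a b) (hU : IsOpen U) (hp : p ∈ U) :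
    principalCurvatures a b p = {c | ∃ v, v ≠ 0 ∧ vDeriv n b p v = -(c • vDeriv n a p v)} := by
  ext c
  exact exists_congr fun v => and_congr_right fun _ => h.isPrincipalAt_iff hU hp v c

theorem IsFrameOn.vDeriv_ne_zero {W : Set M} {e : Fin n → (p : M) → TangentSpace (𝓡 n) p}
    (he : IsFrameOn W e) (hp : p ∈ W) (ha : Function.Injective (vDeriv n a p)) (j : Fin n) :
    vDeriv n a p (e j p) ≠ 0 := fun h =>
  (he p hp).ne_zero j (ha (h.trans (map_zero _).symm))

end Pointwise

/-! ### Smoothness of the horizontal lift of a vector field along a map -/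

section SmoothLift

variable {n : ℕ} {M : Type*} [TopologicalSpace M] [ChartedSpace (EuclideanSpace ℝ (Fin n)) M]
  {W : Set M} {f : M → CProj (n + 1)} {F : M → CVec (n + 1)}

theorem mfderivWithin_coord {z : CVec (n + 1)} {q : CProj (n + 1)} (hz : z ≠ 0) (h : hopf z = q)
    {i : Fin (n + 2)} (hi : q ∈ affOpen i) (X : Tan q) :
    @Eq (CModel (n + 1)) (mfderivWithin 𝓘(ℝ, CModel (n + 1)) 𝓘(ℝ, CModel (n + 1)) (coord i)
      (affOpen i) q X) (dAffCoord i z (liftAt z X)) := by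
  subst h
  have hzi : z i ≠ 0 := by rwa [hopf_of_ne hz, mk_mem_affOpen] at hi
  have ho := isOpen_affOpen (m := n + 1) i
  have h1 : HasMFDerivAt 𝓘(ℝ, CModel (n + 1)) 𝓘(ℝ, CModel (n + 1)) (coord i) (hopf z)
      (mfderivWithin 𝓘(ℝ, CModel (n + 1)) 𝓘(ℝ, CModel (n + 1)) (coord i) (affOpen i) (hopf z)) := by
    rw [mfderivWithin_of_isOpen ho hi]
    exact (((contMDiffOn_coord i).contMDiffAt (ho.mem_nhds hi)).mdifferentiableAt
      (by simp)).hasMFDerivAt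
  have h2 := h1.comp z ((contMDiffAt_hopf hz).mdifferentiableAt (by simp)).hasMFDerivAt
  have h3 : HasMFDerivAt 𝓘(ℝ, CVec (n + 1)) 𝓘(ℝ, CModel (n + 1)) (affCoord i) z
      ((dAffCoord i z).restrictScalars ℝ) :=
    ((hasFDerivAt_affCoord i z hzi).restrictScalars ℝ).hasMFDerivAt
  have h4 : (coord i ∘ hopf) =ᶠ[𝓝 z] affCoord i := by
    filter_upwards [isOpen_ne.mem_nhds hz] with w hw
    rw [Function.comp_apply, hopf_of_ne hw, coord_mk]
  have h5 := (h3.congr_of_eventuallyEq h4).mfderiv.symm.trans h2.mfderiv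
  have h6 := congrArg (fun L : CVec (n + 1) →L[ℝ] CModel (n + 1) => L (liftAt z X)) h5
  refine Eq.trans ?_ h6.symm
  exact congrArg (fun Y : CModel (n + 1) => (mfderivWithin 𝓘(ℝ, CModel (n + 1))
    𝓘(ℝ, CModel (n + 1)) (coord i) (affOpen i) (hopf z) Y : CModel (n + 1)))
    (projAt_liftAt hz X).symm

/-- Near a point the lift is the smooth expression `liftCoord` in `F` and the affine coordinates of
the vector; those coordinates are smooth as the second component of the tangent map of the affine
chart. -/
theorem contMDiffOn_liftAt (hW : IsOpen W)
    (hF : ContMDiffOn (𝓡 n) 𝓘(ℝ, CVec (n + 1)) ∞ F W) (h0 : ∀ p ∈ W, F p ≠ 0)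
    (hl : ∀ p ∈ W, hopf (F p) = f p) {ν : (p : M) → Tan (f p)}
    (hν : ContMDiffOn (𝓡 n) 𝓘(ℝ, CModel (n + 1)).tangent ∞
      (fun p => (⟨f p, ν p⟩ : TangentBundle 𝓘(ℝ, CModel (n + 1)) (CProj (n + 1)))) W) :
    ContMDiffOn (𝓡 n) 𝓘(ℝ, CVec (n + 1)) ∞ (fun p => liftAt (F p) (ν p)) W := by
  intro p₀ hp₀
  set i := idx (f p₀) with hi
  have hfi : f p₀ ∈ affOpen i := (exists_mem_affOpen (f p₀)).choose_spec
  have ho := isOpen_affOpen (m := n + 1) i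
  have hf : ContinuousOn f W :=
    (FiberBundle.continuous_proj (CModel (n + 1))
      (TangentSpace 𝓘(ℝ, CModel (n + 1)) (M := CProj (n + 1)))).comp_continuousOn hν.continuousOn
  have hW' : IsOpen (W ∩ f ⁻¹' affOpen i) := hf.isOpen_inter_preimage hW ho
  have h1 := (contMDiffOn_coord (n := n) i).contMDiffOn_tangentMapWithin (m := ∞) (by simp)
    ho.uniqueMDiffOn
  have h2 := h1.comp (hν.mono (Set.inter_subset_left (t := f ⁻¹' affOpen i))) fun p hp => hp.2
  have h3 := (contMDiff_snd_tangentBundle_modelSpace (CModel (n + 1))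
    𝓘(ℝ, CModel (n + 1)) (n := ∞)).comp_contMDiffOn h2
  have h4 := (h3.prodMk_space (hF.mono (Set.inter_subset_left (t := f ⁻¹' affOpen i)))).contMDiffAt
    (hW'.mem_nhds ⟨hp₀, hfi⟩)
  have hFi {p : M} (hp : p ∈ W ∩ f ⁻¹' affOpen i) : F p i ≠ 0 := by
    have h5 : f p ∈ affOpen i := hp.2
    rwa [← hl p hp.1, hopf_of_ne (h0 p hp.1), mk_mem_affOpen] at h5
  have h5 (v : CModel (n + 1)) : ContDiffAt ℝ ∞
      (fun x : CModel (n + 1) × CVec (n + 1) => liftCoord i x.2 x.1) (v, F p₀) :=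
    ContDiffAt.comp (g := fun x : CVec (n + 1) × CModel (n + 1) => liftCoord i x.1 x.2)
      (f := Prod.swap) (v, F p₀) (contDiffAt_liftCoord i (h0 p₀ hp₀) v)
      (contDiff_snd.prodMk contDiff_fst).contDiffAt
  have h6 := ContMDiffAt.comp (g := fun x : CModel (n + 1) × CVec (n + 1) => liftCoord i x.2 x.1)
    p₀ (h5 _).contMDiffAt h4
  refine (h6.congr_of_eventuallyEq ?_).contMDiffWithinAt
  filter_upwards [hW'.mem_nhds ⟨hp₀, hfi⟩] with p hp
  refine (eq_liftCoord i (hFi hp) (inner_liftAt (h0 p hp.1) (ν p))).trans ?_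
  exact congrArg (liftCoord i (F p))
    (mfderivWithin_coord (h0 p hp.1) (hl p hp.1) hp.2 (ν p)).symm

end SmoothLift

/-! ### Hypersurfaces with the same Gauss map -/

section Parallel

variable {n : ℕ} {M : Type*} [TopologicalSpace M] [ChartedSpace (EuclideanSpace ℝ (Fin n)) M]
  [IsManifold (𝓡 n) ∞ M] {U : Set M} {a b a' b' : M → EuclideanSpace ℝ (Fin (n + 2))}
  {f : M → CProj (n + 1)}

theorem eventually_eq_of_vDeriv_eq_zero {V : Type*} [NormedAddCommGroup V] [NormedSpace ℝ V]
    {c : M → V} (hU : IsOpen U) (hc : ∀ p ∈ U, MDifferentiableAt (𝓡 n) 𝓘(ℝ, V) c p)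
    (h : ∀ p ∈ U, vDeriv n c p = 0) {p₀ : M} (hp₀ : p₀ ∈ U) : ∀ᶠ p in 𝓝 p₀, c p = c p₀ := by
  obtain ⟨r, hr, hB⟩ := Metric.eventually_nhds_iff_ball.1
    ((eventually_chart_symm_mem (n := n) hU hp₀).and (eventually_mem_chart_target (n := n) p₀))
  set ψ := extChartAt (𝓡 n) p₀ with hψ
  have hd : ∀ x ∈ Metric.ball (ψ p₀) r, DifferentiableAt ℝ (chartRep p₀ c) x := fun x hx =>
    ((hc _ (hB x hx).1).comp x (mdifferentiableAt_extChartAt_symm (hB x hx).2)).differentiableAt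
  have hz : ∀ x ∈ Metric.ball (ψ p₀) r, fderiv ℝ (chartRep p₀ c) x = 0 := fun x hx => by
    rw [fderiv_chartRep (hB x hx).2 (hc _ (hB x hx).1), h _ (hB x hx).1]
    exact ContinuousLinearMap.zero_comp _
  have h1 : ∀ᶠ p in 𝓝 p₀, ψ p ∈ Metric.ball (ψ p₀) r :=
    (continuousAt_extChartAt p₀).eventually_mem (Metric.ball_mem_nhds _ hr)
  filter_upwards [h1, (isOpen_extChartAt_source (I := 𝓡 n) p₀).mem_nhds
    (mem_extChartAt_source p₀)] with p hp hps
  have h2 := (convex_ball (ψ p₀) r).is_const_of_fderivWithin_eq_zero (𝕜 := ℝ)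
    (fun x hx => (hd x hx).differentiableWithinAt) (fun x hx => by
      rw [fderivWithin_of_isOpen Metric.isOpen_ball hx, hz x hx]) hp (Metric.mem_ball_self hr)
  simp only [chartRep, Function.comp_apply] at h2
  rwa [ψ.left_inv hps, ψ.left_inv (mem_extChartAt_source p₀)] at h2

theorem IsPreconnected.eq_of_eventually_eq {X Y : Type*} [TopologicalSpace X] {S : Set X}
    (hS : IsPreconnected S) {c : X → Y} (h : ∀ x ∈ S, ∀ᶠ y in 𝓝 x, c y = c x) {x y : X}
    (hx : x ∈ S) (hy : y ∈ S) : c x = c y := by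
  have := isPreconnected_iff_preconnectedSpace.1 hS
  have h1 : IsLocallyConstant fun x : S => c x := by
    rw [IsLocallyConstant.iff_eventually_eq]
    exact fun x => continuous_subtype_val.continuousAt.eventually (h x x.2)
  exact h1.apply_eq_of_preconnectedSpace ⟨x, hx⟩ ⟨y, hy⟩

/-- Hypersurfaces with the same Gauss map are parallel. -/
theorem IsFront.exists_parallel (hU : IsOpen U) (hUc : IsPreconnected U) (h : IsFront U a b)
    (h' : IsFront U a' b') (hf : Set.EqOn (gaussMap a b) f U) (hf' : Set.EqOn (gaussMap a' b') f U) :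
    ∃ t : ℝ, ∀ p ∈ U, a' p = Real.cos t • a p + Real.sin t • b p ∧
      b' p = -(Real.sin t • a p) + Real.cos t • b p := by
  rcases U.eq_empty_or_nonempty with rfl | ⟨p₀, hp₀⟩
  · exact ⟨0, fun p hp => hp.elim⟩
  have hl := h.isHorizontalLift hU
  have hl' := h'.isHorizontalLift hU
  set F := gaussLift a b with hF
  set F' := gaussLift a' b' with hF'
  -- The lifts have the same projection, so `F' = c F`. Horizontality of both lifts kills both terms
  -- in the derivative of the inner product, and `c` is locally constant.
  let c : M → ℂ := fun p => inner ℂ (F p) (F' p)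
  have hFF (p) (hp : p ∈ U) : inner ℂ (F p) (F p) = (1 : ℂ) := by
    rw [inner_self_eq_norm_sq_to_K, hl.norm_eq p hp]; simp
  have hc (p) (hp : p ∈ U) : c p ≠ 0 ∧ F' p = c p • F p := by
    obtain ⟨d, hd, hd'⟩ := exists_smul_of_hopf_eq (hl.ne_zero hp) (hl'.ne_zero hp)
      ((hl'.lift p hp).trans ((hf' hp).trans ((hl.lift p hp).trans (hf hp)).symm))
    have : c p = d := by
      simp only [c]
      rw [hd', inner_smul_right, hFF p hp, mul_one]
    rw [this]
    exact ⟨hd, hd'⟩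
  have hFd {p} (hp : p ∈ U) := mdifferentiableAt_of_contMDiffOn hl.smooth hU hp
  have hFd' {p} (hp : p ∈ U) := mdifferentiableAt_of_contMDiffOn hl'.smooth hU hp
  have hcd : ∀ p ∈ U, MDifferentiableAt (𝓡 n) 𝓘(ℝ, ℂ) c p := fun p hp => by
    have h1 : ContDiff ℝ ∞ fun x : CVec (n + 1) × CVec (n + 1) => inner ℂ x.1 x.2 :=
      contDiff_inner
    exact ((h1.differentiable (by simp)).differentiableAt.mdifferentiableAt).comp p
      ((hFd hp).prodMk_space (hFd' hp))
  have hc0 : ∀ p ∈ U, vDeriv n c p = 0 := fun p hp => by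
    have h1 := (hasFDerivAt_chartRep (hFd hp)).inner ℂ (hasFDerivAt_chartRep (hFd' hp))
    have h2 := (hasFDerivAt_chartRep (hcd p hp)).unique h1
    rw [h2]
    ext1 v
    have h3 : inner ℂ (F p) (vDeriv n F p v) = 0 := hl.horizontal p hp v
    have h4 : inner ℂ (F' p) (vDeriv n F' p v) = 0 := hl'.horizontal p hp v
    obtain ⟨hcp, hFp⟩ := hc p hp
    have h5 : inner ℂ (F p) (vDeriv n F' p v) = 0 := by
      rw [hFp, inner_smul_left] at h4
      exact (mul_eq_zero.1 h4).resolve_left ((map_ne_zero _).2 hcp)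
    have h6 : inner ℂ (vDeriv n F p v) (F' p) = 0 := by
      rw [hFp, inner_smul_right, ← inner_conj_symm, h3, map_zero, mul_zero]
    simp only [ContinuousLinearMap.comp_apply, ContinuousLinearMap.prod_apply,
      fderivInnerCLM_apply, chartRep_self, zero_apply, h5, h6, add_zero]
  have hconst (p) (hp : p ∈ U) : c p = c p₀ :=
    hUc.eq_of_eventually_eq
      (fun x hx => eventually_eq_of_vDeriv_eq_zero hU hcd hc0 hx) hp hp₀
  have hnorm : ‖c p₀‖ = 1 := by
    have h1 := congrArg norm (hc p₀ hp₀).2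
    rw [norm_smul, hl.norm_eq p₀ hp₀, hl'.norm_eq p₀ hp₀, mul_one] at h1
    exact h1.symm
  have hexp := Complex.norm_mul_exp_arg_mul_I (c p₀)
  rw [hnorm, Complex.ofReal_one, one_mul] at hexp
  -- The rotation by `t` multiplies the lift by `e^(-it)`, hence the sign.
  refine ⟨-(c p₀).arg, fun p hp => ?_⟩
  have h1 := (hc p hp).2
  rw [hconst p hp] at h1
  have h2 : normCpx (a' p) (b' p) = c p₀ • normCpx (a p) (b p) := h1
  rw [smul_normCpx, normCpx_inj] at h2
  have h3 : (c p₀).re = Real.cos (c p₀).arg := by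
    rw [← Complex.exp_ofReal_mul_I_re, hexp]
  have h4 : (c p₀).im = Real.sin (c p₀).arg := by
    rw [← Complex.exp_ofReal_mul_I_im, hexp]
  rw [h2.1, h2.2, h3, h4, Real.cos_neg, Real.sin_neg]
  constructor <;> module

end Parallel

/-! ### The canonical normal and smooth choices of angles -/

section Main

variable {n : ℕ} {M : Type*} [TopologicalSpace M] [ChartedSpace (EuclideanSpace ℝ (Fin n)) M]
  {U : Set M} {a b : M → EuclideanSpace ℝ (Fin (n + 2))} {f : M → CProj (n + 1)}

theorem IsFront.liftAt_gaussNormal (h : IsFront U a b) (hU : IsOpen U) {p : M} (hp : p ∈ U) :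
    liftAt (gaussLift a b p) (gaussNormal a b p) = (1 : ℂ) • conjVec (gaussLift a b p) := by
  have hl := h.isHorizontalLift hU
  rw [one_smul]
  exact liftAt_projAt (hl.ne_zero hp) (inner_self_conjVec (hl.sum_sq p hp))

theorem IsFront.apply_eq_of_isShapeOperatorAlong (h : IsFront U a b) (hU : IsOpen U)
    {A : (p : M) → Tan (gaussMap a b p) →ₗ[ℝ] Tan (gaussMap a b p)}
    (hA : IsShapeOperatorAlong U (gaussMap a b) (gaussNormal a b) A) {p : M} (hp : p ∈ U)
    {X : Tan (gaussMap a b p)} (hX : X ∈ quadricTan (gaussMap a b p)) :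
    A p X = -CProj.dHopf (gaussLift a b p) (conjVec (CProj.hLift (gaussLift a b p) X)) := by
  have hl := h.isHorizontalLift hU
  have h1 := (hA p hp).liftAt_eq (hl.norm_eq p hp) (hl.lift p hp) (hl.sum_sq p hp)
    (h.liftAt_gaussNormal hU hp) hX
  rw [one_smul] at h1
  refine (projAt_liftAt (hl.ne_zero hp) (A p X)).symm.trans ?_
  exact (congrArg (projAt (gaussLift a b p)) h1).trans (map_neg _ _)

theorem IsFront.exists_isShapeOperatorAlong (h : IsFront U a b) (hU : IsOpen U) :
    ∃ A, IsShapeOperatorAlong U (gaussMap a b) (gaussNormal a b) A := by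
  have hl := h.isHorizontalLift hU
  have key (p : M) : ∃ A : Tan (gaussMap a b p) →ₗ[ℝ] Tan (gaussMap a b p), p ∈ U →
      IsQuadricShapeOperator (gaussMap a b p) (gaussNormal a b p) A := by
    by_cases hp : p ∈ U
    · obtain ⟨A, hA⟩ := exists_isQuadricShapeOperator (hl.norm_eq p hp) (hl.lift p hp)
        (hl.sum_sq p hp)
      exact ⟨A, fun _ => hA⟩
    · exact ⟨0, fun h => absurd h hp⟩
  choose A hA using key
  exact ⟨A, hA⟩

theorem contMDiffOn_curvaturePhase {W : Set M} {c : M → ℂ} {l : M → ℝ}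
    (hc : ContMDiffOn (𝓡 n) 𝓘(ℝ, ℂ) ∞ c W) (hl : ContMDiffOn (𝓡 n) 𝓘(ℝ, ℝ) ∞ l W) (ε : ℝ) :
    ContMDiffOn (𝓡 n) 𝓘(ℝ, ℂ) ∞ (fun p => curvaturePhase (c p) (ε * l p)) W := by
  have h1 : ContDiff ℝ ∞ fun x : ℂ × ℝ => curvaturePhase x.1 (ε * x.2) := by
    have h2 (s : ℝ) : ContDiff ℝ ∞ fun x : ℂ × ℝ => (⟨1, s * (ε * x.2)⟩ : ℂ) := by
      have h3 : (fun x : ℂ × ℝ => (⟨1, s * (ε * x.2)⟩ : ℂ)) =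
          fun x => 1 + ((s * (ε * x.2) : ℝ) : ℂ) * Complex.I := by
        ext x
        apply Complex.ext <;> simp
      rw [h3]
      exact contDiff_const.add ((Complex.ofRealCLM.contDiff.comp
        (contDiff_const.mul (contDiff_const.mul contDiff_snd))).mul contDiff_const)
    have h4 : (fun x : ℂ × ℝ => curvaturePhase x.1 (ε * x.2)) =
        fun x => -(x.1 * ⟨1, 1 * (ε * x.2)⟩) * (⟨1, -1 * (ε * x.2)⟩ : ℂ)⁻¹ := by
      ext x
      rw [curvaturePhase, div_eq_mul_inv, one_mul, neg_one_mul]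
    rw [h4]
    exact (contDiff_fst.mul (h2 1)).neg.mul ((h2 (-1)).inv fun x => cpx_one_ne_zero _)
  exact h1.contMDiff.comp_contMDiffOn (hc.prodMk_space hl)

/-- Near every point a smooth function with values in the unit circle has a smooth phase. -/
theorem exists_smooth_phase {W : Set M} (hW : IsOpen W) {ι : Type*} [Finite ι] {u : ι → M → ℂ}
    (hu : ∀ j, ContMDiffOn (𝓡 n) 𝓘(ℝ, ℂ) ∞ (u j) W) (hn : ∀ j, ∀ p ∈ W, ‖u j p‖ = 1) {p₀ : M}
    (hp₀ : p₀ ∈ W) : ∃ (W' : Set M) (θ : ι → M → ℝ), IsOpen W' ∧ p₀ ∈ W' ∧ W' ⊆ W ∧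
      (∀ j, ContMDiffOn (𝓡 n) 𝓘(ℝ, ℝ) ∞ (θ j) W') ∧ ∀ p ∈ W', ∀ j, anglePhase (θ j p) = u j p := by
  have h0 (j) : u j p₀ ≠ 0 := norm_ne_zero_iff.1 (by rw [hn j p₀ hp₀]; norm_num)
  -- The quotients equal `1` at `p₀`, so near `p₀` they stay off the negative axis, where the
  -- logarithm is not smooth; finitely many indices allow a common neighbourhood.
  have hev : ∀ᶠ p in 𝓝 p₀, p ∈ W ∧ ∀ j, u j p / u j p₀ ∈ Complex.slitPlane := by
    refine (hW.eventually_mem hp₀).and (Filter.eventually_all.2 fun j => ?_)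
    have h1 : ContinuousAt (fun p => u j p / u j p₀) p₀ :=
      (((hu j).continuousOn.continuousAt (hW.mem_nhds hp₀)).div_const _)
    apply h1.eventually_mem
    rw [div_self (h0 j)]
    exact Complex.isOpen_slitPlane.mem_nhds Complex.one_mem_slitPlane
  obtain ⟨W', hW', hW'o, hp₀'⟩ := mem_nhds_iff.1 hev
  refine ⟨W', fun j p => -((u j p₀).arg + (Complex.log (u j p / u j p₀)).im) / 2, hW'o, hp₀',
    fun p hp => (hW' hp).1, fun j p hp => ?_, fun p hp j =>
      anglePhase_branch (hn j p (hW' hp).1) (hn j p₀ hp₀)⟩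
  have h1 : ContDiffAt ℝ ∞ (fun w : ℂ => -((u j p₀).arg + (Complex.log (w / u j p₀)).im) / 2)
      (u j p) := by
    have h2 : ContDiffAt ℝ ∞ Complex.log (u j p / u j p₀) :=
      (Complex.contDiffAt_log ((hW' hp).2 j)).restrict_scalars ℝ
    have h3 : ContDiffAt ℝ ∞ (fun w : ℂ => Complex.log (w / u j p₀)) (u j p) :=
      ContDiffAt.comp (u j p) h2 (contDiffAt_id.div_const _)
    exact ((contDiffAt_const.add (Complex.imCLM.contDiff.contDiffAt.comp _ h3)).neg).div_const _
  exact h1.contMDiffAt.comp_contMDiffWithinAt p ((hu j p (hW' hp).1).mono fun q hq => (hW' hq).1)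

end Main

/-! ### Immersive rotations, non-uniqueness and arbitrary choices of the normal -/

section Main

variable {n : ℕ} {M : Type*} [TopologicalSpace M] [ChartedSpace (EuclideanSpace ℝ (Fin n)) M]
  {U W : Set M} {a b : M → EuclideanSpace ℝ (Fin (n + 2))} {f : M → CProj (n + 1)}

/-- Used with `x = da v` and `y = db v` to show that the angle equation for the normal `z̄` forces
`v` to be principal. Multiplied by `e^(iθ)`, the equation says that the real part of `e^(-iθ) (x + i
y)`, namely `cos θ x + sin θ y`, vanishes. -/
theorem anglePhase_smul_normCpx {x y : EuclideanSpace ℝ (Fin (n + 2))} {θ : ℝ} (hx : x ≠ 0)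
    (h : -((1 : ℂ) • normCpx x (-y)) = anglePhase θ • normCpx x y) :
    Real.sin θ ≠ 0 ∧ y = -(Real.cot θ • x) := by
  have hs := Real.cos_sq_add_sin_sq θ
  rw [one_smul, ← neg_one_smul ℂ, smul_normCpx, smul_normCpx, normCpx_inj] at h
  obtain ⟨h1, h2⟩ := h
  simp only [anglePhase, Complex.neg_re, Complex.neg_im, Complex.one_re, Complex.one_im, neg_zero,
    zero_smul, sub_zero, zero_add, smul_neg, neg_smul, one_smul, sub_neg_eq_add, neg_neg,
    Real.cos_two_mul, Real.sin_two_mul] at h1 h2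
  have h3 : Real.cos θ • x + Real.sin θ • y = 0 := by
    have e1 : (2 * Real.cos θ ^ 2) • x + (2 * Real.sin θ * Real.cos θ) • y = 0 := by
      refine Eq.trans ?_ (sub_eq_zero.2 h1.symm)
      module
    have e2 : (2 * Real.sin θ * Real.cos θ) • x + (2 * Real.sin θ ^ 2) • y = 0 := by
      rw [show 2 * Real.sin θ ^ 2 = 2 - 2 * Real.cos θ ^ 2 by linear_combination 2 * hs]
      refine Eq.trans ?_ (sub_eq_zero.2 h2)
      module
    -- `e1` and `e2` are the wanted vector multiplied by `2 cos θ` and `2 sin θ`; it is recovered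
    -- from `cos² + sin² = 1`.
    have e3 : Real.cos θ • x + Real.sin θ • y =
        (Real.cos θ / 2) • ((2 * Real.cos θ ^ 2) • x + (2 * Real.sin θ * Real.cos θ) • y) +
        (Real.sin θ / 2) • ((2 * Real.sin θ * Real.cos θ) • x + (2 * Real.sin θ ^ 2) • y) := by
      simp only [smul_add, smul_smul]
      rw [add_add_add_comm, ← add_smul, ← add_smul]
      congr 2
      · linear_combination -Real.cos θ * hs
      · linear_combination -Real.sin θ * hs
    rw [e3, e1, e2]; simp
  have h0 : Real.sin θ ≠ 0 := by
    intro h4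
    rw [h4] at hs
    rw [h4, zero_smul, add_zero, smul_eq_zero] at h3
    rw [h3.resolve_right hx] at hs
    norm_num at hs
  refine ⟨h0, ?_⟩
  rw [Real.cot_eq_cos_div_sin, ← smul_right_injective _ h0 |>.eq_iff, smul_neg, smul_smul,
    mul_div_cancel₀ _ h0]
  exact eq_neg_of_add_eq_zero_right h3

theorem IsFront.exists_isSphereHypersurface_rotate [IsManifold (𝓡 n) ∞ M] (h : IsFront U a b)
    (hU : IsOpen U) {p₀ : M} (hp₀ : p₀ ∈ U) {t : ℝ}
    (ht : Function.Injective (Real.cos t • vDeriv n a p₀ + Real.sin t • vDeriv n b p₀)) :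
    ∃ U' : Set M, IsOpen U' ∧ p₀ ∈ U' ∧ U' ⊆ U ∧
      IsSphereHypersurface U' (fun x => Real.cos t • a x + Real.sin t • b x)
        (fun x => -(Real.sin t • a x) + Real.cos t • b x) := by
  have hr := h.rotate hU t
  have hi : Function.Injective (vDeriv n (fun x => Real.cos t • a x + Real.sin t • b x) p₀) := by
    rw [vDeriv_smul_add_smul hU h.smooth h.smooth_normal hp₀]
    exact ht
  obtain ⟨U', hU', hU'o, hp₀'⟩ := mem_nhds_iff.1
    ((hU.eventually_mem hp₀).and (eventually_injective_vDeriv hU hr.smooth hp₀ hi))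
  exact ⟨U', hU'o, hp₀', fun p hp => (hU' hp).1,
    (hr.mono fun p hp => (hU' hp).1).isSphereHypersurface fun p hp => (hU' hp).2⟩

theorem IsFront.eqOn_gaussMap_rotate (h : IsFront U a b) (hU : IsOpen U) (t : ℝ) :
    Set.EqOn (gaussMap (fun x => Real.cos t • a x + Real.sin t • b x)
      (fun x => -(Real.sin t • a x) + Real.cos t • b x)) (gaussMap a b) U := fun _ hp =>
  gaussMap_rotate a b t ((h.isHorizontalLift hU).ne_zero hp)

theorem IsLagrangianImmersion.mono (hf : IsLagrangianImmersion U f) (hW : W ⊆ U) :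
    IsLagrangianImmersion W f where
  mem_quadric p hp := hf.mem_quadric p (hW hp)
  smooth := hf.smooth.mono hW
  injective p hp := hf.injective p (hW hp)
  tangent_to_normal p hp := hf.tangent_to_normal p (hW hp)
  normal_to_tangent p hp := hf.normal_to_tangent p (hW hp)

/-- The horizontal lift only yields a front; a rotation that is immersive at `p₀` is immersive
nearby and has the same Gauss map. -/
theorem IsLagrangianImmersion.exists_isSphereHypersurface [IsManifold (𝓡 n) ∞ M]
    (hf : IsLagrangianImmersion Set.univ f) (p₀ : M) :
    ∃ (U : Set M) (a b : M → EuclideanSpace ℝ (Fin (n + 2))),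
      IsOpen U ∧ p₀ ∈ U ∧ IsSphereHypersurface U a b ∧ Set.EqOn (gaussMap a b) f U := by
  obtain ⟨U, F, hU, hp₀, hF⟩ := exists_local_horizontal_lift hf p₀
  obtain ⟨a, b, h, hab⟩ := hF.exists_isFront hU (hf.mono (Set.subset_univ U))
  obtain ⟨t, ht⟩ := (h.pair p₀ hp₀).exists_injective_rotate
  obtain ⟨U', hU', hp₀', hUU', hs⟩ := h.exists_isSphereHypersurface_rotate hU hp₀ ht
  exact ⟨U', _, _, hU', hp₀', hs, fun p hp =>
    (h.eqOn_gaussMap_rotate hU t (hUU' hp)).trans (hab (hUU' hp))⟩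

theorem IsSphereHypersurface.exists_ne [IsManifold (𝓡 n) ∞ M] (hn : 1 ≤ n)
    (h : IsSphereHypersurface U a b) (hU : IsOpen U) {p₀ : M} (hp₀ : p₀ ∈ U) :
    ∃ (U' : Set M) (a' b' : M → EuclideanSpace ℝ (Fin (n + 2))),
      IsOpen U' ∧ p₀ ∈ U' ∧ U' ⊆ U ∧ IsSphereHypersurface U' a' b' ∧
      Set.EqOn (gaussMap a' b') (gaussMap a b) U' ∧ a' p₀ ≠ a p₀ ∧
      principalCurvatures a' b' p₀ ≠ principalCurvatures a b p₀ := by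
  have hF := h.isFront hU
  obtain ⟨t, ht, hne, hcurv⟩ := (hF.pair p₀ hp₀).exists_rotate_ne hn (h.injective_vDeriv hp₀)
  obtain ⟨U', hU', hp₀', hUU', hs⟩ := hF.exists_isSphereHypersurface_rotate hU hp₀ ht
  refine ⟨U', _, _, hU', hp₀', hUU', hs, (hF.eqOn_gaussMap_rotate hU t).mono hUU', hne, ?_⟩
  have e : (fun x => -(Real.sin t • a x) + Real.cos t • b x) =
      fun x => (-Real.sin t) • a x + Real.cos t • b x := by simp only [neg_smul]
  have e2 : (-Real.sin t) • vDeriv n a p₀ = -(Real.sin t • vDeriv n a p₀) := by ext; simp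
  rw [(hF.rotate hU t).principalCurvatures_eq hU hp₀, hF.principalCurvatures_eq hU hp₀, e,
    vDeriv_smul_add_smul hU hF.smooth hF.smooth_normal hp₀,
    vDeriv_smul_add_smul hU hF.smooth hF.smooth_normal hp₀, e2]
  exact hcurv

/-- The metric induced by the Gauss map is half the sum of the pullbacks by `a` and `b`; on two
principal directions it is `(1 + k l) / 2` times the metric induced by `a`. -/
theorem IsFront.fsMetric_mapD_eq_zero (h : IsFront U a b) (hU : IsOpen U)
    (hf : Set.EqOn (gaussMap a b) f U) {p : M} (hp : p ∈ U) {v w : EuclideanSpace ℝ (Fin n)}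
    {k l : ℝ} (hv : vDeriv n b p v = -(k • vDeriv n a p v))
    (hw : vDeriv n b p w = -(l • vDeriv n a p w))
    (hvw : inner ℝ (vDeriv n a p v) (vDeriv n a p w) = 0) :
    fsMetric (f p) (mapD f p v) (mapD f p w) = 0 := by
  have hl := h.isHorizontalLift hU
  refine (fsMetric_eq (hl.norm_eq p hp) ((hl.lift p hp).trans (hf hp)) _ _).trans ?_
  refine (congrArg₂ (inner ℝ) (h.liftAt_mapD hU hf hp v) (h.liftAt_mapD hU hf hp w)).trans ?_
  rw [inner_real_eq_re, inner_normCpx, hv, hw]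
  simp [inner_smul_left, inner_smul_right, hvw]

/-- The factor `c` is given as an explicit inner product rather than by an existential, so that its
smooth dependence on the point can be proved. -/
theorem IsFront.exists_phase (h : IsFront U a b) (hU : IsOpen U)
    (hf : Set.EqOn (gaussMap a b) f U) {p : M} (hp : p ∈ U) {ν : Tan (f p)}
    {A : Tan (f p) →ₗ[ℝ] Tan (f p)} (hA : IsQuadricShapeOperator (f p) ν A) :
    ‖inner ℂ (conjVec (gaussLift a b p)) (liftAt (gaussLift a b p) ν)‖ = 1 ∧
      liftAt (gaussLift a b p) ν =
        (inner ℂ (conjVec (gaussLift a b p)) (liftAt (gaussLift a b p) ν) : ℂ) •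
          conjVec (gaussLift a b p) := by
  have hl := h.isHorizontalLift hU
  have hq := (hl.lift p hp).trans (hf hp)
  have hn := hA.isQuadricUnitNormal ⟨_, hl.ne_zero hp, hq, hl.sum_sq p hp⟩
  obtain ⟨c, hc, hcν⟩ := (isQuadricUnitNormal_iff (hl.norm_eq p hp) hq (hl.sum_sq p hp) ν).1 hn
  have h1 : inner ℂ (conjVec (gaussLift a b p)) (liftAt (gaussLift a b p) ν) = c := by
    rw [hcν, inner_smul_right, inner_self_eq_norm_sq_to_K, norm_conjVec, hl.norm_eq p hp]
    simp
  rw [h1]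
  exact ⟨hc, hcν⟩

theorem IsFront.contMDiffOn_phase (h : IsFront U a b) (hU : IsOpen U)
    (hf : Set.EqOn (gaussMap a b) f U) (hWU : W ⊆ U) (hW : IsOpen W) {ν : (p : M) → Tan (f p)}
    (hν : ContMDiffOn (𝓡 n) 𝓘(ℝ, CModel (n + 1)).tangent ∞
      (fun p => (⟨f p, ν p⟩ : TangentBundle 𝓘(ℝ, CModel (n + 1)) (CProj (n + 1)))) W) :
    ContMDiffOn (𝓡 n) 𝓘(ℝ, ℂ) ∞
      (fun p => (inner ℂ (conjVec (gaussLift a b p)) (liftAt (gaussLift a b p) (ν p)) : ℂ)) W := by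
  have hl := h.isHorizontalLift hU
  have hz := hl.smooth.mono hWU
  have hlift := contMDiffOn_liftAt hW hz (fun p hp => hl.ne_zero (hWU hp))
    (fun p hp => (hl.lift p (hWU hp)).trans (hf (hWU hp))) hν
  have h1 : ContDiff ℝ ∞ fun x : CVec (n + 1) × CVec (n + 1) =>
      (inner ℂ (conjCLM x.1) x.2 : ℂ) :=
    (conjCLM.contDiff.comp contDiff_fst).inner ℂ contDiff_snd
  have h2 := h1.contMDiff.comp_contMDiffOn (hz.prodMk_space hlift)
  exact h2.congr fun p _ => rfl

end Main

/-! ### Assembly of the theorem -/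

theorem theorem1 (n : ℕ) (hn : 1 ≤ n) {M : Type*} [TopologicalSpace M]
    [ChartedSpace (EuclideanSpace ℝ (Fin n)) M] [IsManifold (𝓡 n) ∞ M] :
    -- the Gauss map of a hypersurface of the sphere
    (∀ a b : M → EuclideanSpace ℝ (Fin (n + 2)), IsSphereHypersurface Set.univ a b →
      IsLagrangianImmersion Set.univ (gaussMap a b) ∧
      IsHorizontalLift Set.univ (gaussMap a b) (gaussLift a b) ∧
      (∀ p, IsQuadricUnitNormal (gaussMap a b p) (gaussNormal a b p)) ∧
      (∃ A, IsShapeOperatorAlong Set.univ (gaussMap a b) (gaussNormal a b) A) ∧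
      ∀ A, IsShapeOperatorAlong Set.univ (gaussMap a b) (gaussNormal a b) A →
        (∀ p, ∀ X ∈ quadricTan (gaussMap a b p),
          A p X = -CProj.dHopf (gaussLift a b p) (conjVec (CProj.hLift (gaussLift a b p) X))) ∧
        ∀ W : Set M, IsOpen W → ∀ e : Fin n → (p : M) → TangentSpace (𝓡 n) p,
          (∀ l : Fin n → M → ℝ, IsPrincipalFrame W a b e l →
            (∃ θ : Fin n → M → ℝ, AreAngleFunctions W (gaussMap a b) A e θ ∧
              ∀ j, ContMDiffOn (𝓡 n) 𝓘(ℝ, ℝ) ∞ (l j) W →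
                ContMDiffOn (𝓡 n) 𝓘(ℝ, ℝ) ∞ (θ j) W) ∧
            ∀ θ : Fin n → M → ℝ, AreAngleFunctions W (gaussMap a b) A e θ →
              ∀ p ∈ W, ∀ j, Real.sin (θ j p) ≠ 0 ∧ l j p = Real.cot (θ j p)) ∧
          (∀ θ : Fin n → M → ℝ, IsFrameOn W e → AreAngleFunctions W (gaussMap a b) A e θ →
            (∀ p ∈ W, ∀ j, Real.sin (θ j p) ≠ 0) ∧
            IsPrincipalFrame W a b e (fun j p => Real.cot (θ j p)))) ∧
    -- Lagrangian immersions are locally Gauss maps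
    (∀ f : M → CProj (n + 1), IsLagrangianImmersion Set.univ f →
      (∀ p₀ : M, ∃ (U : Set M) (a b : M → EuclideanSpace ℝ (Fin (n + 2))),
        IsOpen U ∧ p₀ ∈ U ∧ IsSphereHypersurface U a b ∧ Set.EqOn (gaussMap a b) f U) ∧
      -- non-uniqueness
      (∀ (U : Set M) (a b : M → EuclideanSpace ℝ (Fin (n + 2))), IsOpen U →
        IsSphereHypersurface U a b → Set.EqOn (gaussMap a b) f U → ∀ p₀ ∈ U,
        ∃ (U' : Set M) (a' b' : M → EuclideanSpace ℝ (Fin (n + 2))),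
          IsOpen U' ∧ p₀ ∈ U' ∧ U' ⊆ U ∧ IsSphereHypersurface U' a' b' ∧
          Set.EqOn (gaussMap a' b') f U' ∧ a' p₀ ≠ a p₀ ∧
          principalCurvatures a' b' p₀ ≠ principalCurvatures a b p₀) ∧
      -- the hypersurfaces are parallel
      (∀ (U : Set M) (a b a' b' : M → EuclideanSpace ℝ (Fin (n + 2))), IsOpen U →
        IsPreconnected U → IsSphereHypersurface U a b → IsSphereHypersurface U a' b' →
        Set.EqOn (gaussMap a b) f U → Set.EqOn (gaussMap a' b') f U →
        ∃ t : ℝ, ∀ p ∈ U, a' p = Real.cos t • a p + Real.sin t • b p ∧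
          b' p = -(Real.sin t • a p) + Real.cos t • b p) ∧
      -- principal frames are adapted, for any choice of `A` and either orientation
      (∀ (U : Set M) (a b : M → EuclideanSpace ℝ (Fin (n + 2))), IsOpen U →
        IsSphereHypersurface U a b → Set.EqOn (gaussMap a b) f U →
        ∀ ε : ℝ, ε = 1 ∨ ε = -1 →
        ∀ W ⊆ U, IsOpen W →
        ∀ (e : Fin n → (p : M) → TangentSpace (𝓡 n) p) (l : Fin n → M → ℝ),
        IsPrincipalFrame W a (fun p => ε • b p) e l →
        (∀ p ∈ W, ∀ j k, inner ℝ (vecD a p (e j p)) (vecD a p (e k p)) = 0 →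
          CProj.fsMetric (f p) (mapD f p (e j p)) (mapD f p (e k p)) = 0) ∧
        ∀ (ν : (p : M) → CProj.Tan (f p)) (A : (p : M) → CProj.Tan (f p) →ₗ[ℝ] CProj.Tan (f p)),
        IsShapeOperatorAlong W f ν A →
        (∃ θ : Fin n → M → ℝ, AreAngleFunctions W f A e θ) ∧
        (ContMDiffOn (𝓡 n) 𝓘(ℝ, CModel (n + 1)).tangent ∞
            (fun p => (⟨f p, ν p⟩ : TangentBundle 𝓘(ℝ, CModel (n + 1)) (CProj (n + 1)))) W →
          (∀ j, ContMDiffOn (𝓡 n) 𝓘(ℝ, ℝ) ∞ (l j) W) →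
          ∀ p₀ ∈ W, ∃ (W' : Set M) (θ : Fin n → M → ℝ), IsOpen W' ∧ p₀ ∈ W' ∧ W' ⊆ W ∧
            (∀ j, ContMDiffOn (𝓡 n) 𝓘(ℝ, ℝ) ∞ (θ j) W') ∧ AreAngleFunctions W' f A e θ) ∧
        ∀ θ : Fin n → M → ℝ, AreAngleFunctions W f A e θ →
          ∀ p ∈ W, ∀ j k, l j p ≠ l k p →
            Real.sin (θ j p - θ k p) ≠ 0 ∧
            Real.cot (θ j p - θ k p) = -(ε * ((l j p * l k p + 1) / (l j p - l k p))))) := by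
  refine ⟨fun a b h => ?_, fun f hf => ⟨hf.exists_isSphereHypersurface, ?_, ?_, ?_⟩⟩
  · have hF := h.isFront isOpen_univ
    have hl := hF.isHorizontalLift isOpen_univ
    refine ⟨hF.isLagrangianImmersion isOpen_univ fun p hp => h.injective_vDeriv hp, hl,
      fun p => isQuadricUnitNormal_projAt_conjVec (hl.ne_zero trivial) (hl.lift p trivial)
        (hl.sum_sq p trivial), hF.exists_isShapeOperatorAlong isOpen_univ, fun A hA =>
      ⟨fun p X hX => hF.apply_eq_of_isShapeOperatorAlong isOpen_univ hA trivial hX,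
        fun W hW e => ⟨fun l hl => ?_, fun θ he hθ => ?_⟩⟩⟩
    · have key (p : M) (hp : p ∈ W) (j : Fin n) (θ : ℝ) :=
        (hF.angle_iff_of_principal isOpen_univ (fun _ _ => rfl) trivial (hA p trivial)
          (hF.liftAt_gaussNormal isOpen_univ trivial)
          (hl.1.vDeriv_ne_zero hp (h.injective_vDeriv trivial) j)
          ((hF.isPrincipalAt_iff isOpen_univ trivial _ _).1 (hl.2 p hp j)) θ).trans
        ((eq_anglePhase_iff 1 (l j p) θ).symm.trans (anglePhase_eq_iff (l j p) θ))
      -- This branch of the arc cotangent is smooth on all of `ℝ`, so for the canonical normal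
      -- smooth angles exist on the whole of `W`, not just locally.
      refine ⟨⟨fun j p => Real.pi / 2 - Real.arctan (l j p), fun p hp j =>
        (key p hp j _).2 (cos_arccot _), fun j hj => ?_⟩, fun θ hθ p hp j =>
          sin_ne_zero_and_eq_cot ((key p hp j _).1 (hθ p hp j))⟩
      have h1 : ContDiff ℝ ∞ fun x : ℝ => Real.pi / 2 - Real.arctan x :=
        contDiff_const.sub Real.contDiff_arctan
      exact h1.contMDiff.comp_contMDiffOn hj
    · have key (p : M) (hp : p ∈ W) (j : Fin n) :=
        anglePhase_smul_normCpx (he.vDeriv_ne_zero hp (h.injective_vDeriv trivial) j)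
          ((hF.angle_iff isOpen_univ (fun _ _ => rfl) trivial (hA p trivial)
            (hF.liftAt_gaussNormal isOpen_univ trivial) _ _).1 (hθ p hp j))
      exact ⟨fun p hp j => (key p hp j).1, he, fun p hp j =>
        (hF.isPrincipalAt_iff isOpen_univ trivial _ _).2 (key p hp j).2⟩
  · intro U a b hU h hab p₀ hp₀
    obtain ⟨U', a', b', hU', hp₀', hUU', h', hab', hne⟩ := h.exists_ne hn hU hp₀
    exact ⟨U', a', b', hU', hp₀', hUU', h', fun p hp => (hab' hp).trans (hab (hUU' hp)), hne⟩
  · intro U a b a' b' hU hUc h h' hab hab'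
    exact (h.isFront hU).exists_parallel hU hUc (h'.isFront hU) hab hab'
  · intro U a b hU h hab ε hε W hWU hW e l hel
    have hF := h.isFront hU
    have hprin (p : M) (hp : p ∈ W) (j : Fin n) :=
      (hF.isPrincipalAt_smul_iff hU (hWU hp) hε _ _).1 (hel.2 p hp j)
    refine ⟨fun p hp j k hjk => hF.fsMetric_mapD_eq_zero hU hab (hWU hp) (hprin p hp j)
      (hprin p hp k) hjk, fun ν A hA => ?_⟩
    -- The phase by which the chosen normal differs from the canonical normal `z̄`. The curvatures
    -- enter below as `ε * l`, because the angle equation refers to the normal `b` of the lift.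
    set c : M → ℂ := fun p => inner ℂ (conjVec (gaussLift a b p)) (liftAt (gaussLift a b p) (ν p))
    have hc (p : M) (hp : p ∈ W) := hF.exists_phase hU hab (hWU hp) (hA p hp)
    have key (p : M) (hp : p ∈ W) (j : Fin n) (θ : ℝ) :
        A p (mapD f p (e j p)) = Real.cos (2 * θ) • mapD f p (e j p) -
          Real.sin (2 * θ) • cpxJ (f p) (mapD f p (e j p)) ↔
        anglePhase θ = curvaturePhase (c p) (ε * l j p) :=
      hF.angle_iff_of_principal hU hab (hWU hp) (hA p hp) (hc p hp).2
        (hel.1.vDeriv_ne_zero hp (h.injective_vDeriv (hWU hp)) j) (hprin p hp j) θ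
    refine ⟨?_, fun hν hls p₀ hp₀ => ?_, fun θ hθ p hp j k hjk => ?_⟩
    · have hex (j : Fin n) (p : M) : ∃ θ : ℝ, p ∈ W →
          anglePhase θ = curvaturePhase (c p) (ε * l j p) := by
        by_cases hp : p ∈ W
        · obtain ⟨θ, hθ⟩ := exists_anglePhase (hc p hp).1 (ε * l j p)
          exact ⟨θ, fun _ => hθ⟩
        · exact ⟨0, fun h => absurd h hp⟩
      choose θ hθ using hex
      exact ⟨θ, fun p hp j => (key p hp j _).2 (hθ j p hp)⟩
    · have hcs : ContMDiffOn (𝓡 n) 𝓘(ℝ, ℂ) ∞ c W := hF.contMDiffOn_phase hU hab hWU hW hν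
      obtain ⟨W', θ, hW', hp₀', hWW', hθs, hθ⟩ := exists_smooth_phase hW
        (fun j => contMDiffOn_curvaturePhase hcs (hls j) ε)
        (fun j p hp => norm_curvaturePhase (hc p hp).1 _) hp₀
      exact ⟨W', θ, hW', hp₀', hWW', hθs, fun p hp j => (key p (hWW' hp) j _).2 (hθ p hp j)⟩
    · have hε0 : ε ≠ 0 := by rcases hε with rfl | rfl <;> norm_num
      obtain ⟨h1, h2⟩ := cot_sub_of_anglePhase (hc p hp).1 ((key p hp j _).1 (hθ p hp j))
        ((key p hp k _).1 (hθ p hp k)) fun h => hjk (mul_left_cancel₀ hε0 h)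
      refine ⟨h1, h2.trans ?_⟩
      -- With curvatures `ε l`, the numerator `ε² l_j l_k + 1` does not see the orientation, while
      -- the denominator changes sign with `ε`.
      rcases hε with rfl | rfl
      · ring
      · rw [show -1 * l j p - -1 * l k p = -(l j p - l k p) by ring, div_neg]
        ring

end
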